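/- Let $n\ge 1$, $p=p_1+p_2$, and let $X_t=(X_{1,t},X_{2,t})\in\mathbb R^{p_1}\times\mathbb R^{p_2}$, $t=1,\dots,n$, be the Gaussian Markov process $X_{t+1}=A_tX_t+B_tW_{t+1}$, $t=1,\dots,n-1$, where $X_1\sim N(0,Q_{X_1})$ with $Q_{X_1}\succeq0$, the $W_{t}\sim N(0,Q_{W_{t}})$ with $Q_{W_t}\succeq 0$, $t=2,\dots,n$, are independent of each other and of $X_1$, and $A_t,B_t$ are non-random matrices. For $\Delta_1,\Delta_2\in\mathbb R$ let the joint nonanticipative rate distortion function be $$R(\Delta_1,\Delta_2)=\inf I(X^n;Y^n)\in[0,\infty],$$ the infimum over all joint laws of $(X^n,Y^n)$, $Y_t=(Y_{1,t},Y_{2,t})\in\mathbb R^{p_1}\times\mathbb R^{p_2}$, whose $X^n$-marginal is the given one, which are causal, $P_{Y^t|X^n}=P_{Y^t|X^t}$ for $t=1,\dots,n-1$, and for which $\frac1n\mathbf E\sum_{t=1}^n\|X_{i,t}-Y_{i,t}\|^2\le\Delta_i$, $i=1,2$ (with $\inf\emptyset=\infty$). For symmetric positive semidefinite $p\times p$ matrices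 $\Sigma_1,\dots,\Sigma_n$ put $$\Sigma_1^-=Q_{X_1},\qquad \Sigma_{t}^-=A_{t-1}\Sigma_{t-1}A_{t-1}^{T}+B_{t-1}Q_{W_{t}}B_{t-1}^{T},\quad t=2,\dots,n,$$ and let $\mathcal M^G(\Delta_1,\Delta_2)$ be the set of all $(\Sigma_1,\dots,\Sigma_n)$ with $0\preceq\Sigma_t\preceq\Sigma_t^-$ for all $t$ and $\frac1n\sum_{t}\operatorname{tr}(\Sigma_{t})_{ii}\le\Delta_i$, $i=1,2$, where $(\Sigma_t)_{11}$ and $(\Sigma_t)_{22}$ are the diagonal blocks of sizes $p_1$ and $p_2$. (a) For every $(\Sigma_t)\in\mathcal M^G(\Delta_1,\Delta_2)$ there are matrices $H_t$ and $Q_{V_t}$, $t=1,\dots,n$, such that $$H_t\Sigma_t^-=\Sigma_t^--\Sigma_t=\Sigma_t^-H_t^{T}\succeq0,\qquad Q_{V_t}=H_t\Sigma_t^--H_t\Sigma_t^-H_t^{T}\succeq0. \qquad (*)$$ For all matrices satisfying $(*)$, the realization $$Y_t=H_tX_t+(I-H_t)A_{t-1}Y_{t-1}+V_t\quad(t\ge2),\qquad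 Y_1=H_1X_1+V_1,$$ with $V_t\sim N(0,Q_{V_t})$ independent of each other and of $X^n$, induces a joint law that is feasible for $R(\Delta_1,\Delta_2)$; its test channel is conditionally Gaussian: the law of $Y_t$ given $(X^t,Y^{t-1})$ is $N(H_tX_t+(I-H_t)A_{t-1}Y_{t-1},Q_{V_t})$ (without the term in $Y_{t-1}$ for $t=1$); moreover $\mathbf E[X_t|Y^t]=Y_t$ almost surely, $\Sigma_t$ is the covariance of the error $X_t-\mathbf E[X_t|Y^t]$, and $\Sigma_t^-$, $t\ge2$, that of $X_t-\mathbf E[X_t|Y^{t-1}]$. If $\Delta_1,\Delta_2\ge0$, then for some $(\Sigma_t)\in\mathcal M^G(\Delta_1,\Delta_2)$ and some $(H_t,Q_{V_t})$ satisfying $(*)$ the law induced by the realization is optimal, that is, $I(X^n;Y^n)=R(\Delta_1,\Delta_2)$. If $Q_{X_1}$ and all $B_{t-1}Q_{W_t}B_{t-1}^{T}$, $t=2,\dots,n$, have full rank, then, for every $(\Sigma_t)\in\mathcal M^G(\Delta_1,\Delta_2)$ and all matrices satisfying $(*)$, $\Sigma_t^-$ is invertible and $Q_{V_t}=\Sigma_t-\Sigma_t(\Sigma_t^-)^{-1}\Sigma_t\succeq0$.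 (b) One has $$R(\Delta_1,\Delta_2)=\inf_{\mathcal M^G(\Delta_1,\Delta_2)}\sum_{t=1}^nI(X_t;Y_t|Y_{t-1})=\inf_{\mathcal M^G(\Delta_1,\Delta_2)}\frac12\sum_{t=1}^n\log\frac{|\Sigma_t^-|}{|\Sigma_t|},$$ where in the first infimum $(X^n,Y^n)$ has the law induced by the realization in (a) (and the term for $t=1$ is $I(X_1;Y_1)$). In the second, the logarithm is $+\infty$ if $|\Sigma_t|=0<|\Sigma_t^-|$; if $|\Sigma_t|=|\Sigma_t^-|=0$, it is $+\infty$ when $\operatorname{rank}\Sigma_t<\operatorname{rank}\Sigma_t^-$, and otherwise $|\cdot|$ denotes the product of the nonzero eigenvalues. -/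

import Mathlib

open MeasureTheory ProbabilityTheory InformationTheory
open scoped ENNReal

namespace JointNRDF

noncomputable section

/-- A vector `(x₁, x₂)` with `x₁ ∈ ℝ^{p₁}` and `x₂ ∈ ℝ^{p₂}`. -/
abbrev Vec (p₁ p₂ : ℕ) : Type := EuclideanSpace ℝ (Fin p₁ ⊕ Fin p₂)

/-- A matrix from `ℝ^{q₁} × ℝ^{q₂}` to `ℝ^{p₁} × ℝ^{p₂}`. -/
abbrev Mat (p₁ p₂ q₁ q₂ : ℕ) : Type := Matrix (Fin p₁ ⊕ Fin p₂) (Fin q₁ ⊕ Fin q₂) ℝ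

/-- A path `x_1, …, x_n` with `n = m + 1`; time `t ∈ {1, …, n}` is the index `t - 1 : Fin (m + 1)`,
and the transition from time `t` to time `t + 1` is the index `t - 1 : Fin m`. -/
abbrev Path (m p₁ p₂ : ℕ) : Type := Fin (m + 1) → Vec p₁ p₂

/-! ### Information measures -/

section Info

variable {Ω 𝓧 𝓨 𝓩 : Type*} [MeasurableSpace Ω] [MeasurableSpace 𝓧] [MeasurableSpace 𝓨]
  [MeasurableSpace 𝓩]

/-- Mutual information `I(X; Y)` (natural logarithm), an element of `[0, ∞]`. -/
def mutualInfo (μ : Measure Ω) (X : Ω → 𝓧) (Y : Ω → 𝓨) : ℝ≥0∞ :=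
  klDiv (μ.map fun ω => (X ω, Y ω)) ((μ.map X).prod (μ.map Y))

/-- Conditional mutual information `I(X; Y | Z)`: the divergence of `P_{Z,X,Y}` from
`P_Z ⊗ (P_{X|Z} × P_{Y|Z})`. -/
def condMutualInfo [StandardBorelSpace 𝓧] [Nonempty 𝓧] [StandardBorelSpace 𝓨] [Nonempty 𝓨]
    (μ : Measure Ω) [IsFiniteMeasure μ] (X : Ω → 𝓧) (Y : Ω → 𝓨) (Z : Ω → 𝓩) : ℝ≥0∞ :=
  klDiv (μ.map fun ω => (Z ω, X ω, Y ω))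
    ((μ.map Z).compProd ((condDistrib X Z μ).prod (condDistrib Y Z μ)))

end Info

/-! ### The joint nonanticipative rate distortion function -/

section NRDF

variable {m p₁ p₂ : ℕ}

/-- Causality: `P_{Y^t | X^n} = P_{Y^t | X^t}` for `t = 1, …, n - 1`. -/
def IsCausal (μ : Measure (Path m p₁ p₂ × Path m p₁ p₂)) [IsFiniteMeasure μ] : Prop :=
  ∀ t : Fin m, ∀ᵐ ω ∂μ,
    condDistrib (fun ω (s : Set.Iic t.castSucc) => ω.2 s) (fun ω => ω.1) μ ω.1 =
      condDistrib (fun ω (s : Set.Iic t.castSucc) => ω.2 s)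
        (fun ω (s : Set.Iic t.castSucc) => ω.1 s) μ (fun s => ω.1 s)

/-- `(1/n) ∑ₜ ‖x_{1,t} - y_{1,t}‖²`. -/
def distortion₁ (x y : Path m p₁ p₂) : ℝ :=
  (1 / ((m : ℝ) + 1)) * ∑ t, ∑ j : Fin p₁, (x t (Sum.inl j) - y t (Sum.inl j)) ^ 2

/-- `(1/n) ∑ₜ ‖x_{2,t} - y_{2,t}‖²`. -/
def distortion₂ (x y : Path m p₁ p₂) : ℝ :=
  (1 / ((m : ℝ) + 1)) * ∑ t, ∑ j : Fin p₂, (x t (Sum.inr j) - y t (Sum.inr j)) ^ 2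

/-- The joint laws `P_{X^n, Y^n}` over which the joint NRDF is an infimum: the `X`-marginal is the
given source law, `Y` is causal, and both average distortions are (finite and) within the bounds. -/
structure IsFeasible (P : Measure (Path m p₁ p₂)) (Δ₁ Δ₂ : ℝ)
    (μ : Measure (Path m p₁ p₂ × Path m p₁ p₂)) [IsFiniteMeasure μ] : Prop where
  marginal : μ.map Prod.fst = P
  causal : IsCausal μ
  integrable₁ : Integrable (fun ω => distortion₁ ω.1 ω.2) μ
  integrable₂ : Integrable (fun ω => distortion₂ ω.1 ω.2) μ
  fidelity₁ : ∫ ω, distortion₁ ω.1 ω.2 ∂μ ≤ Δ₁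
  fidelity₂ : ∫ ω, distortion₂ ω.1 ω.2 ∂μ ≤ Δ₂

/-- The joint NRDF `inf I(X^n; Y^n)` of a source law `P`, with values in `[0, ∞]`. -/
def jointNRDF (P : Measure (Path m p₁ p₂)) (Δ₁ Δ₂ : ℝ) : ℝ≥0∞ :=
  ⨅ (μ : ProbabilityMeasure (Path m p₁ p₂ × Path m p₁ p₂))
    (_ : IsFeasible P Δ₁ Δ₂ (μ : Measure (Path m p₁ p₂ × Path m p₁ p₂))),
    mutualInfo (μ : Measure (Path m p₁ p₂ × Path m p₁ p₂)) Prod.fst Prod.snd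

/-- The summand at time `t` of the sequential rate: `I(X_t; Y_t | Y_{t-1})`, which is
`I(X_1; Y_1)` at the first time. -/
def stageInfo (μ : Measure (Path m p₁ p₂ × Path m p₁ p₂)) [IsFiniteMeasure μ] :
    Fin (m + 1) → ℝ≥0∞ :=
  Fin.cases (mutualInfo μ (fun ω => ω.1 0) (fun ω => ω.2 0))
    (fun i => condMutualInfo μ (fun ω => ω.1 i.succ) (fun ω => ω.2 i.succ)
      (fun ω => ω.2 i.castSucc))

/-- The σ-algebra generated by `Y^t`. -/
abbrev sigmaY (t : Fin (m + 1)) : MeasurableSpace (Path m p₁ p₂ × Path m p₁ p₂) :=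
  MeasurableSpace.comap
    (fun (ω : Path m p₁ p₂ × Path m p₁ p₂) (s : Set.Iic t) => ω.2 s) inferInstance

/-- `X̂_{t|s} = E[X_t | Y^s]`. -/
def estimate (μ : Measure (Path m p₁ p₂ × Path m p₁ p₂)) (t s : Fin (m + 1)) :
    Path m p₁ p₂ × Path m p₁ p₂ → Vec p₁ p₂ :=
  condExp (sigmaY s) μ (fun ω => ω.1 t)

/-- `E[(X_t - X̂_{t|s}) (X_t - X̂_{t|s})ᵀ]`. -/
def errorCov (μ : Measure (Path m p₁ p₂ × Path m p₁ p₂)) (t s : Fin (m + 1)) :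
    Mat p₁ p₂ p₁ p₂ :=
  Matrix.of fun i j =>
    ∫ ω, (ω.1 t i - estimate μ t s ω i) * (ω.1 t j - estimate μ t s ω j) ∂μ

end NRDF

/-! ### The rate of one Gaussian stage -/

/-- Product of the nonzero eigenvalues (with multiplicity) of a real symmetric matrix. -/
def pseudoDet {ι : Type*} [Fintype ι] [DecidableEq ι] (M : Matrix ι ι ℝ) : ℝ :=
  (M.charpoly.roots.filter fun x => x ≠ 0).prod

open Classical in
/-- `(1/2) log (|T| / |G|) ∈ [0, ∞]` for `0 ⪯ G ⪯ T`. If `|G| = 0 < |T|` it is `∞`. If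
`|G| = |T| = 0` it is `∞` when `rank G < rank T`, and otherwise (`G` and `T` have the same range)
the determinants are those of the restrictions to the common range. -/
def gaussRate {ι : Type*} [Fintype ι] [DecidableEq ι] (T G : Matrix ι ι ℝ) : ℝ≥0∞ :=
  if G.det ≠ 0 then ENNReal.ofReal (1 / 2 * Real.log (T.det / G.det))
  else if G.rank = T.rank then ENNReal.ofReal (1 / 2 * Real.log (pseudoDet T / pseudoDet G))
  else ∞

/-! ### The Gaussian Markov tuple -/

/-- The data of `X_{t+1} = A_t X_t + B_t W_{t+1}`, `t = 1, …, n - 1`, `n = m + 1`, with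
`X_1 ~ N(0, QX)` and independent `W_{t+1} ~ N(0, QW_{t+1})`, independent of `X_1`; here `QW i` is
the covariance of the noise of the transition `i`. -/
structure Source (m p₁ p₂ q₁ q₂ : ℕ) where
  A : Fin m → Mat p₁ p₂ p₁ p₂
  B : Fin m → Mat p₁ p₂ q₁ q₂
  QX : Mat p₁ p₂ p₁ p₂
  QW : Fin m → Mat q₁ q₂ q₁ q₂
  posX : QX.PosSemidef
  posW : ∀ i, (QW i).PosSemidef

namespace Source

variable {m p₁ p₂ q₁ q₂ : ℕ} (S : Source m p₁ p₂ q₁ q₂)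

/-- The path `x_1, …, x_n` started at `x1` and driven by the noise `w`. -/
def path (x1 : Vec p₁ p₂) (w : Fin m → Vec q₁ q₂) : Path m p₁ p₂ :=
  Fin.induction x1 fun i x =>
    Matrix.toEuclideanLin (S.A i) x + Matrix.toEuclideanLin (S.B i) (w i)

/-- The law of `X^n`. -/
def law : Measure (Path m p₁ p₂) :=
  ((multivariateGaussian 0 S.QX).prod
    (Measure.pi fun i => multivariateGaussian 0 (S.QW i))).map fun u => S.path u.1 u.2

lemma measurable_path :
    Measurable fun u : Vec p₁ p₂ × (Fin m → Vec q₁ q₂) => S.path u.1 u.2 := by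
  refine measurable_pi_iff.2 fun t => ?_
  induction t using Fin.induction with
  | zero => exact measurable_fst
  | succ i ih =>
    have hA : Measurable (Matrix.toEuclideanLin (S.A i)) :=
      (LinearMap.continuous_of_finiteDimensional _).measurable
    have hB : Measurable (Matrix.toEuclideanLin (S.B i)) :=
      (LinearMap.continuous_of_finiteDimensional _).measurable
    exact (hA.comp ih).add (hB.comp ((measurable_pi_apply i).comp measurable_snd))

instance : IsProbabilityMeasure S.law :=
  Measure.isProbabilityMeasure_map S.measurable_path.aemeasurable

/-- `Σ⁻_1 = QX` and `Σ⁻_{t+1} = A_t Σ_t A_tᵀ + B_t QW_{t+1} B_tᵀ`. -/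
def predCov (G : Fin (m + 1) → Mat p₁ p₂ p₁ p₂) : Fin (m + 1) → Mat p₁ p₂ p₁ p₂ :=
  Fin.cases S.QX fun i =>
    S.A i * G i.castSucc * (S.A i).transpose + S.B i * S.QW i * (S.B i).transpose

/-- The constraint set of error covariances: `0 ⪯ Σ_t ⪯ Σ⁻_t` and the time averages of the traces of
the two diagonal blocks are at most `Δ₁` and `Δ₂`. -/
structure IsErrorCov (Δ₁ Δ₂ : ℝ) (G : Fin (m + 1) → Mat p₁ p₂ p₁ p₂) : Prop where
  pos : ∀ t, (G t).PosSemidef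
  le : ∀ t, (S.predCov G t - G t).PosSemidef
  trace₁ : (1 / ((m : ℝ) + 1)) * ∑ t, (G t).toBlocks₁₁.trace ≤ Δ₁
  trace₂ : (1 / ((m : ℝ) + 1)) * ∑ t, (G t).toBlocks₂₂.trace ≤ Δ₂

/-- The equations for `H_t` and the noise covariance `QV_t`, given the error covariances. -/
structure IsChannel (G H QV : Fin (m + 1) → Mat p₁ p₂ p₁ p₂) : Prop where
  gain : ∀ t, H t * S.predCov G t = S.predCov G t - G t
  gain_symm : ∀ t, S.predCov G t - G t = S.predCov G t * (H t).transpose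
  gain_pos : ∀ t, (H t * S.predCov G t).PosSemidef
  noise : ∀ t, QV t = H t * S.predCov G t - H t * S.predCov G t * (H t).transpose
  noise_pos : ∀ t, (QV t).PosSemidef

/-- `A_{t-1} y_{t-1}`, which is `0` at the first time. -/
def shift (y : Path m p₁ p₂) : Path m p₁ p₂ :=
  Fin.cases 0 fun i => Matrix.toEuclideanLin (S.A i) (y i.castSucc)

/-- `y_t = H_t x_t + (I - H_t) A_{t-1} y_{t-1} + v_t`, with `y_1 = H_1 x_1 + v_1`. -/
def reproduction (H : Fin (m + 1) → Mat p₁ p₂ p₁ p₂) (x v : Path m p₁ p₂) : Path m p₁ p₂ :=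
  Fin.induction (Matrix.toEuclideanLin (H 0) (x 0) + v 0) fun i y =>
    Matrix.toEuclideanLin (H i.succ) (x i.succ) +
      Matrix.toEuclideanLin (1 - H i.succ) (Matrix.toEuclideanLin (S.A i) y) + v i.succ

/-- The joint law of `(X^n, Y^n)` when `Y` is the reproduction of the source `X` with independent
noises `V_t ~ N(0, QV_t)`, independent of `X`. -/
def jointLaw (H QV : Fin (m + 1) → Mat p₁ p₂ p₁ p₂) :
    Measure (Path m p₁ p₂ × Path m p₁ p₂) :=
  (S.law.prod (Measure.pi fun t => multivariateGaussian 0 (QV t))).map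
    fun u => (u.1, S.reproduction H u.1 u.2)

lemma measurable_reproduction (H : Fin (m + 1) → Mat p₁ p₂ p₁ p₂) :
    Measurable fun u : Path m p₁ p₂ × Path m p₁ p₂ => S.reproduction H u.1 u.2 := by
  have hM : ∀ M : Mat p₁ p₂ p₁ p₂, Measurable (Matrix.toEuclideanLin M) := fun M =>
    (LinearMap.continuous_of_finiteDimensional _).measurable
  have hx : ∀ t, Measurable fun u : Path m p₁ p₂ × Path m p₁ p₂ => u.1 t := fun t =>
    (measurable_pi_apply t).comp measurable_fst
  have hv : ∀ t, Measurable fun u : Path m p₁ p₂ × Path m p₁ p₂ => u.2 t := fun t =>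
    (measurable_pi_apply t).comp measurable_snd
  refine measurable_pi_iff.2 fun t => ?_
  induction t using Fin.induction with
  | zero => exact ((hM (H 0)).comp (hx 0)).add (hv 0)
  | succ i ih =>
    exact (((hM (H i.succ)).comp (hx i.succ)).add
      ((hM (1 - H i.succ)).comp ((hM (S.A i)).comp ih))).add (hv i.succ)

instance (H QV : Fin (m + 1) → Mat p₁ p₂ p₁ p₂) : IsProbabilityMeasure (S.jointLaw H QV) :=
  Measure.isProbabilityMeasure_map
    (measurable_fst.prodMk (S.measurable_reproduction H)).aemeasurable

/-- The test channel is conditionally Gaussian and depends on the past only through `Y_{t-1}`: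
given `X^t` and `Y^{t-1}`, the law of `Y_t` is
`N(H_t X_t + (I - H_t) A_{t-1} Y_{t-1}, QV_t)`. -/
def HasGaussianTestChannel (H QV : Fin (m + 1) → Mat p₁ p₂ p₁ p₂)
    (μ : Measure (Path m p₁ p₂ × Path m p₁ p₂)) [IsFiniteMeasure μ] : Prop :=
  ∀ t, ∀ᵐ ω ∂μ,
    condDistrib (fun ω => ω.2 t)
        (fun ω => ((fun s => ω.1 s : Set.Iic t → Vec p₁ p₂),
          (fun s => ω.2 s : Set.Iio t → Vec p₁ p₂))) μ
        ((fun s => ω.1 s), (fun s => ω.2 s)) =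
      multivariateGaussian
        (Matrix.toEuclideanLin (H t) (ω.1 t) +
          Matrix.toEuclideanLin (1 - H t) (S.shift ω.2 t)) (QV t)

end Source

end

end JointNRDF

open JointNRDF

namespace JointNRDF

set_option linter.unusedSectionVars false

/-! ### Positive semidefinite matrices -/

section Matrices

open Matrix Filter
open scoped Topology

variable {ι : Type*} [Fintype ι] [DecidableEq ι]

/-! The joint NRDF and both infima are compared with the infimum of `∑ t, gaussRate (S.predCov G t)
(G t)` over admissible families `G`, by an achievability bound and a converse.

Achievability. In innovation form the realization feeds the prediction error `X_t - A Y_{t-1}` into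
a Gaussian channel. The gain equations make the channel output and the remaining error `X_t - Y_t`
uncorrelated, hence independent (`map_channel`). By induction on time the prediction error is then
independent of the past reproductions with covariance `Σ⁻_t` (`indepLaw_prediction`), and each stage
is a copy of `estimateLaw`: an estimate plus an independent error, paired with the estimate. The
divergence of this law from the product of its marginals is the stage rate (`klDiv_estimateLaw`),
and the chain rule bounds the information of whole paths by the sum of the stage rates
(`klDiv_path_le`).

Converse. A feasible law need not be Gaussian. Let `v_t = E[X_t | Y^t]`, with error covariances `G`.
Causality makes the source increment independent of the past of both processes, so the prediction
error `X_t - A v_{t-1}` has second moments `S.predCov G t`; orthogonality of the error to functions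
of `Y^t` gives `G t ⪯ S.predCov G t` and bounds the traces by the distortions. The information is
bounded below by the easy half of the Donsker–Varadhan formula (`ofReal_integral_le_klDiv`). The
test function is the sum over `t` of the logarithms of the density ratio of `N(v_t, G_t)` to `N(A
v_{t-1}, Σ⁻_t)`, evaluated at `x_t`. For each fixed `y` its exponential has mean one under the
source law, by a filtering recursion (`IsGaussMarkov.lintegral_prod_logRatio`), while its mean under
the joint law depends only on second moments and equals the sum of the rates.

Singular covariances have no densities. The converse is therefore applied after adding to the source
an independent Gauss–Markov noise with the same transition matrices and scalar covariances
(`exists_regularizing_noise`), which by data processing does not increase the information; the noise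
is then sent to zero. The regularized rates `regRate` tend to `gaussRate`, whatever the ranks
(`tendsto_regRate`).

An optimal realization exists because `gaussRate` is a supremum of continuous regularized rates,
hence lower semicontinuous, and the set of admissible families is compact. -/

omit [DecidableEq ι] in
lemma posSemidef_mul_mul_transpose {κ : Type*} [Fintype κ] {Q : Matrix ι ι ℝ} (hQ : Q.PosSemidef)
    (B : Matrix κ ι ℝ) : (B * Q * Bᵀ).PosSemidef := by
  simpa using hQ.mul_mul_conjTranspose_same B

omit [Fintype ι] [DecidableEq ι] in
lemma transpose_eq_of_posSemidef {Q : Matrix ι ι ℝ} (hQ : Q.PosSemidef) : Qᵀ = Q := by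
  simpa using hQ.isHermitian.eq

omit [Fintype ι] in
lemma posSemidef_smul_one {η : ℝ} (hη : 0 ≤ η) : (η • (1 : Matrix ι ι ℝ)).PosSemidef :=
  Matrix.PosSemidef.one.smul hη

omit [Fintype ι] in
lemma posDef_add_smul_one {Q : Matrix ι ι ℝ} (hQ : Q.PosSemidef) {η : ℝ} (hη : 0 < η) :
    (Q + η • 1).PosDef :=
  (Matrix.PosDef.one.smul hη).posSemidef_add hQ

omit [DecidableEq ι] in
/-- The kernel of a positive semidefinite matrix is contained in that of a smaller one. -/
lemma mul_eq_zero_of_le {T D M : Matrix ι ι ℝ} (hD : D.PosSemidef) (hTD : (T - D).PosSemidef)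
    (h : T * M = 0) : D * M = 0 := by
  ext i j
  have key : D *ᵥ (fun k => M k j) = 0 := by
    have hT : T *ᵥ (fun k => M k j) = 0 := by
      ext k; simpa [Matrix.mul_apply, mulVec, dotProduct] using congrFun (congrFun h k) j
    rw [← hD.dotProduct_mulVec_zero_iff]
    have h1 := hD.dotProduct_mulVec_nonneg fun k => M k j
    have h2 := hTD.dotProduct_mulVec_nonneg fun k => M k j
    rw [sub_mulVec, hT, dotProduct_sub, dotProduct_zero] at h2
    linarith
  simpa [Matrix.mul_apply, mulVec, dotProduct] using congrFun key i

/-- Symmetric square root `S` of a positive semidefinite matrix, its pseudoinverse `R`, and the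
orthogonal projection `P` onto the common range. -/
lemma exists_sqrt_pinv {T : Matrix ι ι ℝ} (hT : T.PosSemidef) :
    ∃ S R P : Matrix ι ι ℝ, Sᵀ = S ∧ Rᵀ = R ∧ Pᵀ = P ∧ S * S = T ∧ S * R = P ∧ R * S = P ∧
      P * S = S ∧ S * P = S ∧ R * P = R ∧ P * R = R ∧ P * P = P := by
  obtain ⟨U, hUU, hspec⟩ : ∃ U : Matrix ι ι ℝ, Uᵀ * U = 1 ∧
      T = U * diagonal hT.1.eigenvalues * Uᵀ := by
    refine ⟨hT.1.eigenvectorUnitary.1, ?_, ?_⟩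
    · have := Unitary.coe_star_mul_self hT.1.eigenvectorUnitary
      rwa [star_eq_conjTranspose, conjTranspose_eq_transpose_of_trivial] at this
    · have := hT.1.spectral_theorem
      rw [Unitary.conjStarAlgAut_apply, star_eq_conjTranspose,
        conjTranspose_eq_transpose_of_trivial] at this
      exact this
  have hmul : ∀ a b : ι → ℝ, (U * diagonal a * Uᵀ) * (U * diagonal b * Uᵀ) =
      U * diagonal (fun i => a i * b i) * Uᵀ := by
    intro a b
    calc _ = U * diagonal a * (Uᵀ * U) * diagonal b * Uᵀ := by
          simp only [Matrix.mul_assoc]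
      _ = _ := by rw [hUU, Matrix.mul_one, Matrix.mul_assoc U, diagonal_mul_diagonal]
  have hsymm : ∀ a : ι → ℝ, (U * diagonal a * Uᵀ)ᵀ = U * diagonal a * Uᵀ := by
    intro a
    simp [transpose_mul, Matrix.mul_assoc]
  have hcongr : ∀ a b : ι → ℝ, (∀ i, a i = b i) →
      U * diagonal a * Uᵀ = U * diagonal b * Uᵀ := fun a b h => by rw [funext h]
  set s : ι → ℝ := fun i => √(hT.1.eigenvalues i) with hs
  -- Since `0⁻¹ = 0`, inverting the entries of `s` gives the pseudoinverse, and `s i * (s i)⁻¹` is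
  -- the indicator of the nonzero eigenvalues.
  refine ⟨U * diagonal s * Uᵀ, U * diagonal (fun i => (s i)⁻¹) * Uᵀ,
    U * diagonal (fun i => s i * (s i)⁻¹) * Uᵀ, hsymm _, hsymm _, hsymm _, ?_, hmul _ _, ?_, ?_, ?_,
    ?_, ?_, ?_⟩
  · rw [hmul]
    conv_rhs => rw [hspec]
    exact hcongr _ _ fun i => Real.mul_self_sqrt (hT.eigenvalues_nonneg i)
  all_goals
    rw [hmul]
    refine hcongr _ _ fun i => ?_
    by_cases h : s i = 0
    · simp [h]
    · field_simp

section Pinv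

variable {T S P D : Matrix ι ι ℝ}

/-- `T` annihilates `1 - P`, so every smaller `D` does too: a reduction of `T` lives on the range of
`T`. -/
lemma mul_proj_eq_of_le (hST : S * S = T) (hSP : S * P = S)
    (hD : D.PosSemidef) (hTD : (T - D).PosSemidef) : D * P = D := by
  have h : T * (1 - P) = 0 := by
    rw [← hST, Matrix.mul_assoc, Matrix.mul_sub S, Matrix.mul_one, hSP, sub_self, Matrix.mul_zero]
  have := mul_eq_zero_of_le hD hTD h
  rw [Matrix.mul_sub, Matrix.mul_one, sub_eq_zero] at this
  exact this.symm

lemma proj_mul_eq_of_le (hP : Pᵀ = P) (hST : S * S = T) (hSP : S * P = S)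
    (hD : D.PosSemidef) (hTD : (T - D).PosSemidef) : P * D = D := by
  have := congrArg transpose (mul_proj_eq_of_le hST hSP hD hTD)
  rwa [transpose_mul, hP, transpose_eq_of_posSemidef hD] at this

omit [DecidableEq ι] in
lemma posSemidef_of_idempotent (hP : Pᵀ = P) (hPP : P * P = P) : P.PosSemidef := by
  have := posSemidef_self_mul_conjTranspose P
  rwa [conjTranspose_eq_transpose_of_trivial, hP, hPP] at this

lemma one_sub_mul_one_sub (hPP : P * P = P) : (1 - P) * (1 - P) = 1 - P := by
  have : (1 - P) * (1 - P) = 1 - P - P + P * P := by noncomm_ring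
  rw [this, hPP]; abel

lemma one_sub_posSemidef_of_idempotent (hP : Pᵀ = P) (hPP : P * P = P) : (1 - P).PosSemidef :=
  posSemidef_of_idempotent (by rw [transpose_sub, transpose_one, hP]) (one_sub_mul_one_sub hPP)

end Pinv

/-- The Gaussian forward channel: a gain and a noise covariance exist for every reduction `D` of the
covariance `T`. -/
lemma exists_gain {T D : Matrix ι ι ℝ} (hD : D.PosSemidef) (hTD : (T - D).PosSemidef) :
    ∃ H : Matrix ι ι ℝ, H * T = D ∧ D = T * Hᵀ ∧ (H * T - H * T * Hᵀ).PosSemidef := by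
  have hT : T.PosSemidef := by simpa using hD.add hTD
  obtain ⟨S, R, P, hS, hR, hP, hST, hSR, hRS, hPS, hSP, hRP, hPR, hPP⟩ := exists_sqrt_pinv hT
  have hDP := mul_proj_eq_of_le hST hSP hD hTD
  have hPD := proj_mul_eq_of_le hP hST hSP hD hTD
  have hTsymm := transpose_eq_of_posSemidef hT
  have hDsymm := transpose_eq_of_posSemidef hD
  have h1 : D * R * R * T = D := by
    calc D * R * R * T = D * ((R * (R * S)) * S) := by rw [← hST]; simp only [Matrix.mul_assoc]
      _ = D := by rw [hRS, hRP, hRS, hDP]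
  have h2 : (D * R * R)ᵀ = R * R * D := by
    simp only [transpose_mul, hR, hDsymm, Matrix.mul_assoc]
  -- `R * R` is the pseudoinverse of `T`, so the gain is `D T⁺`.
  refine ⟨D * R * R, h1, ?_, ?_⟩
  · have := congrArg transpose h1
    rw [transpose_mul, hTsymm, hDsymm] at this
    exact this.symm
  · rw [h1, h2]
    -- `M` is the whitened reduction. The noise covariance is `S (M - M²) S`, so it suffices that `0
    -- ⪯ M ⪯ 1`, where `1 - M` splits into the whitening of `T - D` and the projection onto the
    -- kernel of `T`.
    obtain ⟨M, hM⟩ : ∃ M, M = R * D * R := ⟨_, rfl⟩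
    have hMpsd : M.PosSemidef := by
      have := posSemidef_mul_mul_transpose hD R
      rwa [hR, ← hM] at this
    have hMsymm := transpose_eq_of_posSemidef hMpsd
    have hSMS : S * M * S = D := by
      calc S * M * S = (S * R) * D * (R * S) := by rw [hM]; simp only [Matrix.mul_assoc]
        _ = D := by rw [hSR, hRS, hPD, hDP]
    have hMM : S * (M * M) * S = D * (R * R * D) := by
      calc S * (M * M) * S = (S * R) * D * (R * R) * (D * (R * S)) := by
            rw [hM]; simp only [Matrix.mul_assoc]
        _ = D * (R * R * D) := by rw [hSR, hRS, hPD, hDP, Matrix.mul_assoc]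
    have h1M : (1 - M).PosSemidef := by
      have h3 : (R * (T - D) * R).PosSemidef := by
        have := posSemidef_mul_mul_transpose hTD R
        rwa [hR] at this
      have h7 : R * T * R = P := by
        calc R * T * R = (R * S) * (S * R) := by rw [← hST]; simp only [Matrix.mul_assoc]
          _ = P := by rw [hRS, hSR, hPP]
      have h8 : 1 - M = R * (T - D) * R + (1 - P) := by
        rw [Matrix.mul_sub, Matrix.sub_mul, h7, hM]; abel
      rw [h8]; exact h3.add (one_sub_posSemidef_of_idempotent hP hPP)
    have h9 : (M - M * M).PosSemidef := by
      have ha := posSemidef_mul_mul_transpose hMpsd (1 - M)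
      have hb := posSemidef_mul_mul_transpose h1M M
      rw [transpose_sub, transpose_one, hMsymm] at ha
      rw [hMsymm] at hb
      have : M - M * M = (1 - M) * M * (1 - M) + M * (1 - M) * M := by noncomm_ring
      rw [this]; exact ha.add hb
    have h10 := posSemidef_mul_mul_transpose h9 S
    rwa [hS, Matrix.mul_sub, Matrix.sub_mul, hSMS, hMM] at h10

omit [DecidableEq ι] in
/-- If `0 ≤ G ≤ T` have the same rank then they have the same kernel. -/
lemma mulVec_eq_zero_of_rank_eq {T G : Matrix ι ι ℝ} (hG : G.PosSemidef)
    (hTG : (T - G).PosSemidef) (hr : G.rank = T.rank) {x : ι → ℝ} (hx : G *ᵥ x = 0) :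
    T *ᵥ x = 0 := by
  have hle : LinearMap.ker T.mulVecLin ≤ LinearMap.ker G.mulVecLin := by
    intro y hy
    rw [LinearMap.mem_ker, mulVecLin_apply] at hy ⊢
    rw [← hG.dotProduct_mulVec_zero_iff]
    have h1 := hG.dotProduct_mulVec_nonneg y
    have h2 := hTG.dotProduct_mulVec_nonneg y
    rw [sub_mulVec, hy, dotProduct_sub, dotProduct_zero] at h2
    linarith
  have h1 := LinearMap.finrank_range_add_finrank_ker T.mulVecLin
  have h2 := LinearMap.finrank_range_add_finrank_ker G.mulVecLin
  have h3 : Module.finrank ℝ (LinearMap.ker T.mulVecLin) =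
      Module.finrank ℝ (LinearMap.ker G.mulVecLin) := by
    rw [Matrix.rank, Matrix.rank] at hr
    omega
  have := Submodule.eq_of_le_of_finrank_eq hle h3
  have hx' : x ∈ LinearMap.ker G.mulVecLin := by simpa using hx
  rw [← this] at hx'
  simpa using hx'

omit [DecidableEq ι] in
-- A smaller positive semidefinite matrix has a larger kernel.
lemma rank_le_of_le {T G : Matrix ι ι ℝ} (hG : G.PosSemidef) (hTG : (T - G).PosSemidef) :
    G.rank ≤ T.rank := by
  have hle : LinearMap.ker T.mulVecLin ≤ LinearMap.ker G.mulVecLin := by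
    intro y hy
    rw [LinearMap.mem_ker, mulVecLin_apply] at hy ⊢
    rw [← hG.dotProduct_mulVec_zero_iff]
    have h1 := hG.dotProduct_mulVec_nonneg y
    have h2 := hTG.dotProduct_mulVec_nonneg y
    rw [sub_mulVec, hy, dotProduct_sub, dotProduct_zero] at h2
    linarith
  have h1 := LinearMap.finrank_range_add_finrank_ker T.mulVecLin
  have h2 := LinearMap.finrank_range_add_finrank_ker G.mulVecLin
  have h3 := Submodule.finrank_mono hle
  rw [Matrix.rank, Matrix.rank]
  omega

/-- Whitening: if `0 ≤ G ≤ T` have the same rank, then `G` is the image under a square root `S` of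
`T` of a positive definite `K ≤ 1`, and `det (T + η) / det (G + η)` tends to `1 / det K`. -/
lemma exists_whitening {T G : Matrix ι ι ℝ} (hG : G.PosSemidef) (hTG : (T - G).PosSemidef)
    (hr : G.rank = T.rank) :
    ∃ S K : Matrix ι ι ℝ, K.PosDef ∧ (1 - K).PosSemidef ∧ S * 1 * Sᵀ = T ∧ S * K * Sᵀ = G ∧
      Tendsto (fun η : ℝ => (T + η • 1).det / (G + η • 1).det) (𝓝[>] 0) (𝓝 (K.det)⁻¹) := by
  have hT : T.PosSemidef := by simpa using hG.add hTG
  obtain ⟨S, R, P, hS, hR, hP, hST, hSR, hRS, hPS, hSP, hRP, hPR, hPP⟩ := exists_sqrt_pinv hT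
  have hGP := mul_proj_eq_of_le hST hSP hG hTG
  have hPG := proj_mul_eq_of_le hP hST hSP hG hTG
  have hTP : T * P = T := by rw [← hST, Matrix.mul_assoc, hSP]
  have h1P := one_sub_posSemidef_of_idempotent hP hPP
  have hRTR : R * T * R = P := by
    calc R * T * R = (R * S) * (S * R) := by rw [← hST]; simp only [Matrix.mul_assoc]
      _ = P := by rw [hRS, hSR, hPP]
  have hRGR : (R * G * R).PosSemidef := by
    have := posSemidef_mul_mul_transpose hG R
    rwa [hR] at this
  -- Whiten `G` on the range of `T` and put the identity on the kernel of `T`, so that the result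
  -- can be definite.
  have hK : (R * G * R + (1 - P)).PosSemidef := hRGR.add h1P
  obtain ⟨K, hKdef⟩ : ∃ K, K = R * G * R + (1 - P) := ⟨_, rfl⟩
  rw [← hKdef] at hK
  have hSKS : S * K * S = G := by
    have : S * K * S = (S * R) * G * (R * S) + (S - S * P) * S := by
      rw [hKdef]; noncomm_ring
    rw [this, hSR, hRS, hPG, hGP, hSP, sub_self, Matrix.zero_mul, add_zero]
  -- A null vector `x` of `K` satisfies `(1 - P) x = 0` and `G (R x) = 0`. Equality of ranks turns
  -- the latter into `T (R x) = 0`, whence `P x = R T R x = 0` and `x = 0`.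
  have hKpos : K.PosDef := by
    refine PosDef.of_dotProduct_mulVec_pos hK.isHermitian fun x hx => ?_
    refine lt_of_le_of_ne (hK.dotProduct_mulVec_nonneg x) fun h0 => hx ?_
    have ha := hRGR.dotProduct_mulVec_nonneg x
    have hb := h1P.dotProduct_mulVec_nonneg x
    rw [hKdef, add_mulVec, dotProduct_add] at h0
    have hb0 := (h1P.dotProduct_mulVec_zero_iff x).1 (by linarith)
    have ha0 : star (R *ᵥ x) ⬝ᵥ G *ᵥ (R *ᵥ x) = 0 := by
      have : star x ⬝ᵥ (R * G * R) *ᵥ x = star (R *ᵥ x) ⬝ᵥ G *ᵥ (R *ᵥ x) := by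
        rw [star_mulVec, conjTranspose_eq_transpose_of_trivial, hR, ← dotProduct_mulVec,
          mulVec_mulVec, mulVec_mulVec, Matrix.mul_assoc]
      rw [← this]; linarith
    have hc := mulVec_eq_zero_of_rank_eq hG hTG hr ((hG.dotProduct_mulVec_zero_iff _).1 ha0)
    have hd : P *ᵥ x = 0 := by
      have : P *ᵥ x = R *ᵥ (T *ᵥ (R *ᵥ x)) := by
        rw [mulVec_mulVec, mulVec_mulVec, ← hRTR]
      rw [this, hc, mulVec_zero]
    rw [sub_mulVec, one_mulVec, hd, sub_zero] at hb0
    exact hb0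
  refine ⟨S, K, hKpos, ?_, by rw [Matrix.mul_one, hS, hST], by rw [hS, hSKS], ?_⟩
  · have h3 := posSemidef_mul_mul_transpose hTG R
    rw [hR, Matrix.mul_sub, Matrix.sub_mul, hRTR] at h3
    have : 1 - K = P - R * G * R := by rw [hKdef]; abel
    rwa [this]
  · -- split off the kernel of `T`
    have hfac : ∀ M : Matrix ι ι ℝ, M * P = M → ∀ η : ℝ,
        M + η • 1 = (M + η • P + (1 - P)) * (P + η • (1 - P)) := by
      intro M hM η
      have : (M + η • P + (1 - P)) * (P + η • (1 - P)) = M * P + η • (P * P)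
          + (P - P * P) + η • (M - M * P) + η • (η • (P - P * P)) + η • ((1 - P) * (1 - P)) := by
        simp only [Matrix.add_mul, Matrix.mul_add, Matrix.sub_mul, Matrix.mul_sub, Matrix.mul_smul,
          Matrix.smul_mul, Matrix.one_mul, Matrix.mul_one]
        module
      rw [this, one_sub_mul_one_sub hPP, hM, hPP]
      simp only [sub_self, smul_zero, add_zero, smul_sub]
      abel
    -- With the identity put on the kernel, `T` and `G` are both congruent, through `S + (1 - P)`,
    -- to `1` and `K`; so their determinants have quotient `1 / det K`.
    have hTG1 : (S + (1 - P)) * (S + (1 - P)) = T + (1 - P) := by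
      have : (S + (1 - P)) * (S + (1 - P)) =
          S * S + (S - S * P) + (S - P * S) + (1 - P) * (1 - P) := by noncomm_ring
      rw [this, hSP, hPS, one_sub_mul_one_sub hPP, hST]; abel
    have hG1 : (S + (1 - P)) * K * (S + (1 - P)) = G + (1 - P) := by
      have : (S + (1 - P)) * K * (S + (1 - P)) = S * K * S + (S - S * P) * (1 - P)
          + S * R * G * (R - R * P) + (1 - P) * (S - P * S) + (R - P * R) * G * R * S
          + (R - P * R) * G * R * (1 - P) + (1 - P) * (1 - P) * (1 - P) := by
        rw [hKdef]; noncomm_ring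
      rw [this, hSKS, hSP, hRP, hPR, hPS, one_sub_mul_one_sub hPP, one_sub_mul_one_sub hPP]
      simp only [sub_self, Matrix.zero_mul, Matrix.mul_zero, add_zero]
    have hdet : (G + (1 - P)).det = (T + (1 - P)).det * K.det := by
      rw [← hG1, ← hTG1]; simp only [det_mul]; ring
    have hT1 : (T + (1 - P)).det ≠ 0 := by
      have hposdef : (T + (1 - P)).PosDef := by
        refine PosDef.of_dotProduct_mulVec_pos (hT.add h1P).isHermitian fun x hx => ?_
        refine lt_of_le_of_ne ((hT.add h1P).dotProduct_mulVec_nonneg x) fun h0 => hx ?_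
        have ha := hT.dotProduct_mulVec_nonneg x
        have hb := h1P.dotProduct_mulVec_nonneg x
        rw [add_mulVec, dotProduct_add] at h0
        have hb0 := (h1P.dotProduct_mulVec_zero_iff x).1 (by linarith)
        have ha0 := (hT.dotProduct_mulVec_zero_iff x).1 (by linarith)
        have hd : P *ᵥ x = 0 := by
          have : P = R * R * T := by
            calc P = R * (R * S) * S := by rw [hRS, hRP, hRS]
              _ = R * R * T := by rw [← hST]; simp only [Matrix.mul_assoc]
          rw [this, ← mulVec_mulVec, ha0, mulVec_zero]
        rw [sub_mulVec, one_mulVec, hd, sub_zero] at hb0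
        exact hb0
      exact hposdef.det_pos.ne'
    have hlim : Tendsto (fun η : ℝ => (T + η • P + (1 - P)).det / (G + η • P + (1 - P)).det)
        (𝓝[>] 0) (𝓝 (K.det)⁻¹) := by
      have hc : ∀ M : Matrix ι ι ℝ, Tendsto (fun η : ℝ => (M + η • P + (1 - P)).det) (𝓝[>] 0)
          (𝓝 (M + (1 - P)).det) := by
        intro M
        have : Continuous fun η : ℝ => (M + η • P + (1 - P)).det := by
          apply Continuous.matrix_det; fun_prop
        have h := (this.tendsto 0).mono_left (nhdsWithin_le_nhds (s := Set.Ioi 0))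
        simpa using h
      have h := (hc T).div (hc G) (by rw [hdet]; exact mul_ne_zero hT1 hKpos.det_pos.ne')
      rw [hdet, div_mul_cancel_left₀ hT1] at h
      exact h
    refine hlim.congr' ?_
    filter_upwards [self_mem_nhdsWithin] with η hη
    rw [hfac T hTP, hfac G hGP, det_mul, det_mul, mul_div_mul_right]
    -- The common factor cancelled from the quotient is invertible: its inverse is explicit.
    have h2 : (P + η • (1 - P)) * (P + η⁻¹ • (1 - P)) = 1 := by
      have hη' : η ≠ 0 := (Set.mem_Ioi.1 hη).ne'
      have : (P + η • (1 - P)) * (P + η⁻¹ • (1 - P)) = P * P + η⁻¹ • (P - P * P)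
          + η • (P - P * P) + (η * η⁻¹) • ((1 - P) * (1 - P)) := by
        simp only [Matrix.add_mul, Matrix.mul_add, Matrix.sub_mul, Matrix.mul_sub, Matrix.mul_smul,
          Matrix.smul_mul, Matrix.one_mul, Matrix.mul_one]
        module
      rw [this, one_sub_mul_one_sub hPP, hPP, mul_inv_cancel₀ hη']
      simp
    exact fun h0 => by simpa [h0] using congrArg det h2

/-- The regularized rate `(1/2) log (|T + η| / |G + η|)`. -/
noncomputable def regRate (η : ℝ) (T G : Matrix ι ι ℝ) : ℝ :=
  1 / 2 * Real.log ((T + η • 1).det / (G + η • 1).det)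

/-- In an eigenbasis the determinant is the product of the `λ + η`. The zero eigenvalues give the
power of `η`, the others a factor `q` whose value at `0` is the pseudodeterminant. This is how ranks
and pseudodeterminants come to govern the limit of `regRate`. -/
lemma exists_det_add_smul_eq {M : Matrix ι ι ℝ} (hM : M.PosSemidef) :
    ∃ q : ℝ → ℝ, Continuous q ∧ q 0 = pseudoDet M ∧ 0 < pseudoDet M ∧
      ∀ η : ℝ, (M + η • 1).det = η ^ (Fintype.card ι - M.rank) * q η := by
  classical
  set l := hM.1.eigenvalues with hl
  have hp : pseudoDet M = ∏ i with l i ≠ 0, l i := by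
    rw [pseudoDet, hM.1.roots_charpoly_eq_eigenvalues, Multiset.filter_map, Finset.prod]
    congr 1
  refine ⟨fun η => ∏ i with l i ≠ 0, (l i + η), by fun_prop, by simp [hp], ?_, fun η => ?_⟩
  · rw [hp]
    refine Finset.prod_pos fun i hi => ?_
    exact lt_of_le_of_ne (hM.eigenvalues_nonneg i) (Ne.symm (Finset.mem_filter.1 hi).2)
  · have h1 : (M + η • 1).det = ∏ i, (l i + η) := by
      have h := Matrix.eval_charpoly M (-η)
      rw [hM.1.charpoly_eq, Polynomial.eval_prod] at h
      -- The determinant is the characteristic polynomial at `-η` up to the sign `(-1) ^ card ι`,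
      -- which is distributed over the eigenvalue factors.
      have h2 : M + η • 1 = -(Matrix.scalar ι (-η) - M) := by
        rw [Matrix.scalar_apply, ← Matrix.smul_one_eq_diagonal]; module
      rw [h2, Matrix.det_neg, ← h, ← Finset.card_univ, ← Finset.prod_const,
          ← Finset.prod_mul_distrib]
      refine Finset.prod_congr rfl fun i _ => ?_
      simp [hl]
    rw [h1, ← Finset.prod_filter_mul_prod_filter_not Finset.univ (fun i => l i ≠ 0), mul_comm]
    congr 1
    have h3 : ∏ i with ¬ l i ≠ 0, (l i + η) = ∏ i with ¬ l i ≠ 0, η :=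
      Finset.prod_congr rfl fun i hi => by
        have := (Finset.mem_filter.1 hi).2
        rw [not_not] at this
        rw [this, zero_add]
    rw [h3, Finset.prod_const]
    congr 1
    have h4 : M.rank = (Finset.univ.filter fun i => l i ≠ 0).card := by
      rw [hM.1.rank_eq_card_non_zero_eigs, Fintype.card_subtype]
    have h5 := Finset.card_filter_add_card_filter_not (s := Finset.univ) (fun i => l i ≠ 0)
    rw [h4, ← Finset.card_univ]
    omega

lemma rank_eq_of_det_ne_zero {M : Matrix ι ι ℝ} (h : M.det ≠ 0) : M.rank = Fintype.card ι :=
  Matrix.rank_of_isUnit M ((Matrix.isUnit_iff_isUnit_det M).2 (isUnit_iff_ne_zero.2 h))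

lemma pseudoDet_eq_det {M : Matrix ι ι ℝ} (hM : M.PosSemidef) (h : M.det ≠ 0) :
    pseudoDet M = M.det := by
  obtain ⟨q, -, hq0, -, hq⟩ := exists_det_add_smul_eq hM
  have := hq 0
  rw [rank_eq_of_det_ne_zero h, Nat.sub_self, pow_zero, one_mul, zero_smul, add_zero] at this
  rw [← hq0, this]

lemma det_ne_zero_of_rank_eq {M : Matrix ι ι ℝ} (hM : M.PosSemidef) (h : M.rank = Fintype.card ι) :
    M.det ≠ 0 := by
  obtain ⟨q, -, hq0, hpos, hq⟩ := exists_det_add_smul_eq hM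
  have := hq 0
  rw [h, Nat.sub_self, pow_zero, one_mul, zero_smul, add_zero] at this
  rw [this, hq0]
  exact hpos.ne'

/-- For nonsingular matrices pseudodeterminants are determinants, so one formula covers both finite
branches of the definition. -/
lemma gaussRate_of_rank_eq {T G : Matrix ι ι ℝ} (hG : G.PosSemidef) (hTG : (T - G).PosSemidef)
    (hr : G.rank = T.rank) :
    gaussRate T G = ENNReal.ofReal (1 / 2 * Real.log (pseudoDet T / pseudoDet G)) := by
  rw [gaussRate]
  split_ifs with h
  · have hT : T.PosSemidef := by simpa using hG.add hTG
    rw [pseudoDet_eq_det hG h, pseudoDet_eq_det hT]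
    exact det_ne_zero_of_rank_eq hT (by rw [← hr, rank_eq_of_det_ne_zero h])
  · rfl

lemma gaussRate_of_rank_ne {T G : Matrix ι ι ℝ} (hG : G.PosSemidef) (hTG : (T - G).PosSemidef)
    (hr : G.rank ≠ T.rank) : gaussRate T G = ⊤ := by
  rw [gaussRate, if_neg, if_neg hr]
  rw [not_not]
  by_contra h
  have h1 := rank_eq_of_det_ne_zero h
  have h2 := rank_le_of_le hG hTG
  have h3 := T.rank_le_card_width
  omega

/-- The rate of a stage is the limit of the regularized rates. -/
lemma tendsto_regRate {T G : Matrix ι ι ℝ} (hG : G.PosSemidef) (hTG : (T - G).PosSemidef) :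
    Tendsto (fun η => ENNReal.ofReal (regRate η T G)) (𝓝[>] 0) (𝓝 (gaussRate T G)) := by
  have hT : T.PosSemidef := by simpa using hG.add hTG
  obtain ⟨qT, hqTc, hqT0, hpT, hqT⟩ := exists_det_add_smul_eq hT
  obtain ⟨qG, hqGc, hqG0, hpG, hqG⟩ := exists_det_add_smul_eq hG
  have hle := rank_le_of_le hG hTG
  have hcard : T.rank ≤ Fintype.card ι := T.rank_le_card_width
  have hlim : Tendsto (fun η => qT η / qG η) (𝓝[>] 0) (𝓝 (pseudoDet T / pseudoDet G)) := by
    have h := ((hqTc.tendsto 0).div (hqGc.tendsto 0) (by rw [hqG0]; exact hpG.ne')).mono_left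
      (nhdsWithin_le_nhds (s := Set.Ioi 0))
    rwa [hqT0, hqG0] at h
  by_cases hr : G.rank = T.rank
  · rw [gaussRate_of_rank_eq hG hTG hr]
    refine ENNReal.tendsto_ofReal (Tendsto.const_mul _ ?_)
    refine Tendsto.log ?_ (div_pos hpT hpG).ne'
    refine hlim.congr' ?_
    filter_upwards [self_mem_nhdsWithin] with η hη
    rw [hqT, hqG, hr, mul_div_mul_left]
    exact pow_ne_zero _ (Set.mem_Ioi.1 hη).ne'
  · rw [gaussRate_of_rank_ne hG hTG hr]
    refine ENNReal.tendsto_ofReal_atTop.comp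
      (Tendsto.const_mul_atTop (show (0 : ℝ) < 1 / 2 by norm_num) ?_)
    refine Real.tendsto_log_atTop.comp ?_
    -- Every unit of rank lost contributes a factor `η⁻¹`, so the determinant quotient is `(η ^ (k +
    -- 1))⁻¹` times a factor with positive limit.
    obtain ⟨k, hk⟩ : ∃ k, T.rank - G.rank = k + 1 := ⟨T.rank - G.rank - 1, by omega⟩
    have h1 : Tendsto (fun η : ℝ => (η ^ (k + 1))⁻¹) (𝓝[>] 0) atTop := by
      refine tendsto_inv_nhdsGT_zero.comp (tendsto_nhdsWithin_iff.2 ⟨?_, ?_⟩)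
      · have : Tendsto (fun η : ℝ => η ^ (k + 1)) (𝓝 0) (𝓝 (0 ^ (k + 1))) :=
          (continuous_pow (k + 1)).tendsto 0
        rw [zero_pow (Nat.succ_ne_zero k)] at this
        exact this.mono_left nhdsWithin_le_nhds
      · filter_upwards [self_mem_nhdsWithin] with η hη
        exact pow_pos (Set.mem_Ioi.1 hη) _
    refine (h1.atTop_mul_pos (div_pos hpT hpG) hlim).congr' ?_
    filter_upwards [self_mem_nhdsWithin] with η hη
    have hη0 : η ≠ 0 := (Set.mem_Ioi.1 hη).ne'
    have h2 : Fintype.card ι - G.rank = (Fintype.card ι - T.rank) + (k + 1) := by omega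
    rw [hqT, hqG, h2, pow_add η _ (k + 1), mul_assoc, mul_div_mul_left _ _ (pow_ne_zero _ hη0),
      div_mul_eq_div_div_swap]
    ring

/-- With a nonsingular covariance the noise covariance of the channel is `G - G T⁻¹ G`. -/
lemma noise_eq_of_isUnit {T G H : Matrix ι ι ℝ} (hT : IsUnit T) (h1 : H * T = T - G)
    (h2 : T - G = T * Hᵀ) : H * T - H * T * Hᵀ = G - G * T⁻¹ * G := by
  have hdet := (Matrix.isUnit_iff_isUnit_det T).1 hT
  have h3 : Hᵀ = 1 - T⁻¹ * G := by
    calc Hᵀ = T⁻¹ * (T * Hᵀ) := by rw [Matrix.nonsing_inv_mul_cancel_left _ _ hdet]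
      _ = 1 - T⁻¹ * G := by rw [← h2, Matrix.mul_sub, Matrix.nonsing_inv_mul _ hdet]
  rw [h1, h3, Matrix.mul_sub, Matrix.mul_one, Matrix.sub_mul,
      Matrix.mul_nonsing_inv_cancel_left _ _ hdet,
    Matrix.mul_assoc]
  abel

end Matrices

/-! ### Gaussian measures on Euclidean space -/

section Gaussian

open Matrix
open scoped Topology

variable {ι κ : Type*} [Fintype ι] [DecidableEq ι] [Fintype κ] [DecidableEq κ]

lemma measurable_toEuclideanLin (M : Matrix κ ι ℝ) : Measurable (toEuclideanLin M) :=
  (LinearMap.continuous_of_finiteDimensional _).measurable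

lemma multivariateGaussian_eq_map_add (m : EuclideanSpace ℝ ι) (Q : Matrix ι ι ℝ) :
    multivariateGaussian m Q = (multivariateGaussian 0 Q).map (fun x => m + x) := by
  rw [multivariateGaussian, multivariateGaussian, Measure.map_map (by fun_prop) (by fun_prop)]
  congr 1
  ext x
  simp

lemma charFunDual_multivariateGaussian {Q : Matrix ι ι ℝ} (hQ : Q.PosSemidef)
    (m : EuclideanSpace ℝ ι) {L : StrongDual ℝ (EuclideanSpace ℝ ι)} {a : EuclideanSpace ℝ ι}
    (hL : ∀ x, L x = inner ℝ a x) :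
    charFunDual (multivariateGaussian m Q) L =
      Complex.exp ((inner ℝ a m : ℝ) * Complex.I - (a.ofLp ⬝ᵥ Q *ᵥ a.ofLp : ℝ) / 2) := by
  have : L = InnerProductSpace.toDualMap ℝ _ a := by
    ext x; simp [hL]
  rw [this, ← charFun_eq_charFunDual_toDualMap, charFun_multivariateGaussian hQ]

lemma inner_toEuclideanLin (M : Matrix κ ι ℝ) (a : EuclideanSpace ℝ κ) (x : EuclideanSpace ℝ ι) :
    inner ℝ a (toEuclideanLin M x) = inner ℝ (toEuclideanLin Mᵀ a) x := by
  simp only [EuclideanSpace.inner_eq_star_dotProduct, toLpLin_apply, star_trivial]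
  rw [mulVec_transpose, dotProduct_comm, dotProduct_mulVec, dotProduct_comm]

lemma transpose_mulVec_dotProduct {μ : Type*} [Fintype μ] (B : Matrix κ ι ℝ) (C : Matrix μ ι ℝ)
    (Q : Matrix ι ι ℝ) (a : κ → ℝ) (b : μ → ℝ) :
    (Bᵀ *ᵥ a) ⬝ᵥ Q *ᵥ (Cᵀ *ᵥ b) = a ⬝ᵥ (B * Q * Cᵀ) *ᵥ b := by
  rw [mulVec_transpose, mulVec_mulVec, ← dotProduct_mulVec, mulVec_mulVec, Matrix.mul_assoc]

/-- The image of a pair of independent centred Gaussian vectors under a linear map which makes the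
two components uncorrelated. -/
lemma map_prod_multivariateGaussian {α β : Type*} [Fintype α] [DecidableEq α] [Fintype β]
    [DecidableEq β] {T : Matrix ι ι ℝ} {V : Matrix κ κ ℝ}
    {D : Matrix α α ℝ} {G : Matrix β β ℝ} (hT : T.PosSemidef) (hV : V.PosSemidef)
    (hD : D.PosSemidef) (hG : G.PosSemidef) (B₁ : Matrix α ι ℝ) (C₁ : Matrix α κ ℝ)
    (B₂ : Matrix β ι ℝ) (C₂ : Matrix β κ ℝ) (h₁₁ : B₁ * T * B₁ᵀ + C₁ * V * C₁ᵀ = D)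
    (h₂₂ : B₂ * T * B₂ᵀ + C₂ * V * C₂ᵀ = G) (h₁₂ : B₁ * T * B₂ᵀ + C₁ * V * C₂ᵀ = 0) :
    ((multivariateGaussian 0 T).prod (multivariateGaussian 0 V)).map
      (fun p => (toEuclideanLin B₁ p.1 + toEuclideanLin C₁ p.2,
        toEuclideanLin B₂ p.1 + toEuclideanLin C₂ p.2)) =
      (multivariateGaussian 0 D).prod (multivariateGaussian 0 G) := by
  have hlin : (fun p : EuclideanSpace ℝ ι × EuclideanSpace ℝ κ =>
      (toEuclideanLin B₁ p.1 + toEuclideanLin C₁ p.2,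
        toEuclideanLin B₂ p.1 + toEuclideanLin C₂ p.2)) =
      LinearMap.toContinuousLinearMap
        (((toEuclideanLin B₁).coprod (toEuclideanLin C₁)).prod
          ((toEuclideanLin B₂).coprod (toEuclideanLin C₂))) := by
    ext p <;> simp
  have : IsProbabilityMeasure (((multivariateGaussian 0 T).prod (multivariateGaussian 0 V)).map
      (fun p => (toEuclideanLin B₁ p.1 + toEuclideanLin C₁ p.2,
        toEuclideanLin B₂ p.1 + toEuclideanLin C₂ p.2))) := by
    rw [hlin]
    exact Measure.isProbabilityMeasure_map (ContinuousLinearMap.measurable _).aemeasurable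
  refine Measure.ext_of_charFunDual ?_
  ext L
  rw [hlin, charFunDual_map, charFunDual_prod, charFunDual_prod]
  -- Riesz vectors `a`, `b` of the two components of `L`. Pulled back to the sources, `L` has Riesz
  -- vectors `B₁ᵀ a + B₂ᵀ b` and `C₁ᵀ a + C₂ᵀ b`. It remains to compare quadratic forms, where `h₁₂`
  -- removes the cross terms.
  obtain ⟨a, ha⟩ : ∃ a : EuclideanSpace ℝ α, ∀ x, L (x, 0) = inner ℝ a x :=
    ⟨(InnerProductSpace.toDual ℝ _).symm (L.comp (ContinuousLinearMap.inl ℝ _ _)), fun x => by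
      simp⟩
  obtain ⟨b, hb⟩ : ∃ b : EuclideanSpace ℝ β, ∀ x, L (0, x) = inner ℝ b x :=
    ⟨(InnerProductSpace.toDual ℝ _).symm (L.comp (ContinuousLinearMap.inr ℝ _ _)), fun x => by
      simp⟩
  have hL : ∀ x y, L (x, y) = inner ℝ a x + inner ℝ b y := by
    intro x y
    rw [← ha, ← hb, ← map_add]; simp
  have hι : ∀ x : EuclideanSpace ℝ ι, L (toEuclideanLin B₁ x, toEuclideanLin B₂ x) =
      inner ℝ (toEuclideanLin B₁ᵀ a + toEuclideanLin B₂ᵀ b) x := fun x => by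
    rw [hL, inner_toEuclideanLin, inner_toEuclideanLin, inner_add_left]
  have hκ : ∀ x : EuclideanSpace ℝ κ, L (toEuclideanLin C₁ x, toEuclideanLin C₂ x) =
      inner ℝ (toEuclideanLin C₁ᵀ a + toEuclideanLin C₂ᵀ b) x := fun x => by
    rw [hL, inner_toEuclideanLin, inner_toEuclideanLin, inner_add_left]
  rw [charFunDual_multivariateGaussian hT 0 (a := toEuclideanLin B₁ᵀ a + toEuclideanLin B₂ᵀ b),
    charFunDual_multivariateGaussian hV 0 (a := toEuclideanLin C₁ᵀ a + toEuclideanLin C₂ᵀ b),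
    charFunDual_multivariateGaussian hD 0 (a := a),
    charFunDual_multivariateGaussian hG 0 (a := b), ← Complex.exp_add, ← Complex.exp_add]
  · congr 1
    simp only [inner_zero_right, Complex.ofReal_zero, zero_mul, zero_sub]
    rw [← neg_add, ← neg_add, ← add_div, ← add_div, ← Complex.ofReal_add, ← Complex.ofReal_add]
    congr 3
    have h₂₁ : B₂ * T * B₁ᵀ + C₂ * V * C₁ᵀ = 0 := by
      have := congrArg transpose h₁₂
      simpa [transpose_mul, Matrix.mul_assoc, transpose_eq_of_posSemidef hT,
        transpose_eq_of_posSemidef hV] using this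
    simp only [WithLp.ofLp_add, toLpLin_apply, mulVec_add, add_dotProduct, dotProduct_add,
      transpose_mulVec_dotProduct]
    rw [← h₁₁, ← h₂₂]
    have e1 : a.ofLp ⬝ᵥ (B₁ * T * B₂ᵀ) *ᵥ b.ofLp + a.ofLp ⬝ᵥ (C₁ * V * C₂ᵀ) *ᵥ b.ofLp = 0 := by
      rw [← dotProduct_add, ← add_mulVec, h₁₂]; simp
    have e2 : b.ofLp ⬝ᵥ (B₂ * T * B₁ᵀ) *ᵥ a.ofLp + b.ofLp ⬝ᵥ (C₂ * V * C₁ᵀ) *ᵥ a.ofLp = 0 := by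
      rw [← dotProduct_add, ← add_mulVec, h₂₁]; simp
    simp only [add_mulVec, dotProduct_add]
    linarith
  · intro x; simpa using hb x
  · intro x; simpa using ha x
  · intro x
    rw [← hκ]; simp
  · intro x
    rw [← hι]; simp

lemma map_add_multivariateGaussian {α : Type*} [Fintype α] [DecidableEq α] {T : Matrix ι ι ℝ}
    {V : Matrix κ κ ℝ} (hT : T.PosSemidef) (hV : V.PosSemidef) (B : Matrix α ι ℝ)
    (C : Matrix α κ ℝ) :
    ((multivariateGaussian 0 T).prod (multivariateGaussian 0 V)).map
      (fun p => toEuclideanLin B p.1 + toEuclideanLin C p.2) =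
      multivariateGaussian 0 (B * T * Bᵀ + C * V * Cᵀ) := by
  -- The second component takes values in `ℝ^0`, which makes the decorrelation hypothesis void.
  have h := map_prod_multivariateGaussian hT hV
    ((posSemidef_mul_mul_transpose hT B).add (posSemidef_mul_mul_transpose hV C))
    (Matrix.PosSemidef.zero (n := Fin 0) (R := ℝ)) B C 0 0 rfl (by simp) (by simp)
  have h' := congrArg (Measure.map Prod.fst) h
  rw [Measure.map_map measurable_fst, ← Measure.fst, Measure.fst_prod] at h'
  · exact h'
  · have := measurable_toEuclideanLin B
    have := measurable_toEuclideanLin C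
    have := measurable_toEuclideanLin (0 : Matrix (Fin 0) ι ℝ)
    have := measurable_toEuclideanLin (0 : Matrix (Fin 0) κ ℝ)
    fun_prop

lemma map_toEuclideanLin_multivariateGaussian {Q : Matrix ι ι ℝ} (hQ : Q.PosSemidef)
    (B : Matrix κ ι ℝ) : (multivariateGaussian 0 Q).map (toEuclideanLin B) =
      multivariateGaussian 0 (B * Q * Bᵀ) := by
  have h := map_add_multivariateGaussian hQ hQ B (0 : Matrix κ ι ℝ)
  have h' : (fun p : EuclideanSpace ℝ ι × EuclideanSpace ℝ ι =>
      toEuclideanLin B p.1 + toEuclideanLin (0 : Matrix κ ι ℝ) p.2) =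
      toEuclideanLin B ∘ Prod.fst := by ext p; simp
  rw [h', ← Measure.map_map (measurable_toEuclideanLin B) measurable_fst, ← Measure.fst,
    Measure.fst_prod] at h
  simpa using h

/-- Joint law of a centred Gaussian vector with covariance `T` and an estimate with error covariance
`G`: the sum of the estimate and an independent error, paired with the estimate. -/
noncomputable def estimateLaw (T G : Matrix ι ι ℝ) :
    Measure (EuclideanSpace ℝ ι × EuclideanSpace ℝ ι) :=
  ((multivariateGaussian 0 (T - G)).prod (multivariateGaussian 0 G)).map
    fun p => (p.1 + p.2, p.1)

instance (T G : Matrix ι ι ℝ) : IsProbabilityMeasure (estimateLaw T G) :=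
  Measure.isProbabilityMeasure_map (by fun_prop)

section Channel

variable {T G H : Matrix ι ι ℝ}

/-- In a channel satisfying the gain equations, the estimate `w = H u + v` and the error `u - w` are
independent. -/
lemma map_channel (hG : G.PosSemidef) (hTG : (T - G).PosSemidef) (h1 : H * T = T - G)
    (h2 : T - G = T * Hᵀ) (hV : (H * T - H * T * Hᵀ).PosSemidef) :
    ((multivariateGaussian 0 T).prod (multivariateGaussian 0 (H * T - H * T * Hᵀ))).map
      (fun p => (toEuclideanLin H p.1 + p.2, p.1 - (toEuclideanLin H p.1 + p.2))) =
      (multivariateGaussian 0 (T - G)).prod (multivariateGaussian 0 G) := by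
  have hT : T.PosSemidef := by simpa using hG.add hTG
  -- The estimate is `H u + v` and the error `(1 - H) u - v`; the noise covariance `H T - H T Hᵀ` is
  -- exactly what cancels their cross covariance.
  convert map_prod_multivariateGaussian hT hV hTG hG H 1 (1 - H) (-1) ?_ ?_ ?_ using 3 with p
  · simp only [map_sub, map_neg, toLpLin_one, LinearMap.sub_apply, LinearMap.neg_apply,
      LinearMap.id_apply, Prod.mk.injEq, true_and]
    abel
  · rw [Matrix.one_mul, transpose_one, Matrix.mul_one, h1]; abel
  · rw [transpose_sub, transpose_one, transpose_neg, transpose_one]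
    have : (1 - H) * T * (1 - Hᵀ) + -1 * (H * T - H * T * Hᵀ) * -1 = T - T * Hᵀ := by noncomm_ring
    rw [this, ← h2]; abel
  · rw [transpose_sub, transpose_one, transpose_neg, transpose_one]
    have : H * T * (1 - Hᵀ) + 1 * (H * T - H * T * Hᵀ) * -1 = 0 := by noncomm_ring
    exact this

lemma map_channel_eq_estimateLaw (hG : G.PosSemidef) (hTG : (T - G).PosSemidef)
    (h1 : H * T = T - G) (h2 : T - G = T * Hᵀ) (hV : (H * T - H * T * Hᵀ).PosSemidef) :
    ((multivariateGaussian 0 T).prod (multivariateGaussian 0 (H * T - H * T * Hᵀ))).map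
      (fun p => (p.1, toEuclideanLin H p.1 + p.2)) = estimateLaw T G := by
  rw [estimateLaw, ← map_channel hG hTG h1 h2 hV, Measure.map_map (by fun_prop)]
  · congr 1
    ext p <;> simp
  · have := measurable_toEuclideanLin H
    fun_prop

end Channel

lemma map_fst_estimateLaw {T G : Matrix ι ι ℝ} (hG : G.PosSemidef) (hTG : (T - G).PosSemidef) :
    (estimateLaw T G).map Prod.fst = multivariateGaussian 0 T := by
  rw [estimateLaw, Measure.map_map (by fun_prop) (by fun_prop)]
  have h := map_add_multivariateGaussian hTG hG (1 : Matrix ι ι ℝ) 1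
  simp only [toLpLin_one, LinearMap.id_apply, Matrix.one_mul, transpose_one, Matrix.mul_one,
    sub_add_cancel] at h
  exact h

lemma map_snd_estimateLaw (T G : Matrix ι ι ℝ) :
    (estimateLaw T G).map Prod.snd = multivariateGaussian 0 (T - G) := by
  rw [estimateLaw, Measure.map_map (by fun_prop) (by fun_prop)]
  exact Measure.fst_prod

end Gaussian

/-! ### Gaussian densities -/

section Density

open Matrix
open scoped Topology

variable {ι : Type*} [Fintype ι] [DecidableEq ι]

/-- Logarithm of the density at `x` of the centred Gaussian measure with covariance `Q`. -/
noncomputable def gaussLog (Q : Matrix ι ι ℝ) (x : EuclideanSpace ℝ ι) : ℝ :=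
  -(1 / 2) * (Fintype.card ι * Real.log (2 * Real.pi) + Real.log Q.det + x.ofLp ⬝ᵥ Q⁻¹ *ᵥ x.ofLp)

lemma continuous_gaussLog (Q : Matrix ι ι ℝ) : Continuous (gaussLog Q) := by
  unfold gaussLog
  have : Continuous fun x : EuclideanSpace ℝ ι => x.ofLp ⬝ᵥ Q⁻¹ *ᵥ x.ofLp := by
    simp only [dotProduct, mulVec]
    fun_prop
  fun_prop

@[fun_prop]
lemma measurable_gaussLog (Q : Matrix ι ι ℝ) : Measurable (gaussLog Q) :=
  (continuous_gaussLog Q).measurable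

/-- Both sides have the same characteristic function, by the Fourier transform of `exp (-‖x‖² / 2)`.
-/
lemma stdGaussian_eq_withDensity :
    stdGaussian (EuclideanSpace ℝ ι) =
      volume.withDensity fun x => ENNReal.ofReal (Real.exp (gaussLog (1 : Matrix ι ι ℝ) x)) := by
  have hexp : ∀ x : EuclideanSpace ℝ ι, Real.exp (gaussLog (1 : Matrix ι ι ℝ) x) =
      (2 * Real.pi) ^ (-(Fintype.card ι : ℝ) / 2) * Real.exp (-(1 / 2) * ‖x‖ ^ 2) := by
    intro x
    rw [gaussLog, inv_one, one_mulVec, det_one, Real.log_one, add_zero, mul_add, Real.exp_add,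
      Real.rpow_def_of_pos (by positivity)]
    congr 1
    · congr 1; ring
    · rw [EuclideanSpace.real_norm_sq_eq, dotProduct]
      simp_rw [pow_two]
  have hmeas : Measurable fun x : EuclideanSpace ℝ ι =>
      ENNReal.ofReal (Real.exp (gaussLog (1 : Matrix ι ι ℝ) x)) := by fun_prop
  have hcexp : ∀ x t : EuclideanSpace ℝ ι,
      (ENNReal.ofReal (Real.exp (gaussLog (1 : Matrix ι ι ℝ) x))).toReal •
        Complex.exp ((inner ℝ x t : ℝ) * Complex.I) =
      ((2 * Real.pi) ^ (-(Fintype.card ι : ℝ) / 2) : ℝ) *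
        Complex.exp (-(1 / 2 : ℂ) * (‖x‖ : ℂ) ^ 2 + Complex.I * (inner ℝ t x : ℝ)) := by
    intro x t
    rw [ENNReal.toReal_ofReal (Real.exp_pos _).le, hexp, Complex.exp_add, real_inner_comm,
      Complex.real_smul, Complex.ofReal_mul, Complex.ofReal_exp]
    push_cast
    ring_nf
  have hint : Integrable (fun x => Real.exp (gaussLog (1 : Matrix ι ι ℝ) x)) := by
    have h := (GaussianFourier.integrable_cexp_neg_mul_sq_norm_add (V := EuclideanSpace ℝ ι)
      (b := 1 / 2) (by norm_num) 0 0).re.const_mul ((2 * Real.pi) ^ (-(Fintype.card ι : ℝ) / 2))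
    refine h.congr (Filter.Eventually.of_forall fun x => ?_)
    simp only [hexp]
    congr 1
    have : (-(1 / 2 : ℂ) * (‖x‖ : ℂ) ^ 2 + 0 * ((inner ℝ (0 : EuclideanSpace ℝ ι) x : ℝ) : ℂ)) =
        ((-(1 / 2) * ‖x‖ ^ 2 : ℝ) : ℂ) := by push_cast; ring
    rw [this, ← Complex.ofReal_exp]
    exact (Complex.ofReal_re _).symm
  have : IsFiniteMeasure (volume.withDensity fun x : EuclideanSpace ℝ ι =>
      ENNReal.ofReal (Real.exp (gaussLog (1 : Matrix ι ι ℝ) x))) :=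
    isFiniteMeasure_withDensity_ofReal hint.2
  refine Measure.ext_of_charFun ?_
  ext t
  rw [charFun_stdGaussian, charFun_apply, integral_withDensity_eq_integral_toReal_smul hmeas
    (by simp)]
  simp_rw [hcexp]
  rw [integral_const_mul, GaussianFourier.integral_cexp_neg_mul_sq_norm_add (by norm_num)]
  rw [finrank_euclideanSpace, ← mul_assoc]
  have h2 : (((2 * Real.pi) ^ (-(Fintype.card ι : ℝ) / 2) : ℝ) : ℂ) *
      ((Real.pi : ℂ) / (1 / 2)) ^ ((Fintype.card ι : ℂ) / 2) = 1 := by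
    have : ((Real.pi : ℂ) / (1 / 2)) = ((2 * Real.pi : ℝ) : ℂ) := by push_cast; ring
    rw [this]
    have h3 : ((Fintype.card ι : ℂ) / 2) = (((Fintype.card ι : ℝ) / 2 : ℝ) : ℂ) :=
        by push_cast; ring
    rw [h3, ← Complex.ofReal_cpow (by positivity), ← Complex.ofReal_mul,
      ← Real.rpow_add (by positivity)]
    simp [neg_div]
  rw [h2, one_mul]
  congr 1
  rw [Complex.I_sq]; ring

/-- Change of variables `x ↦ m + S x` from the standard Gaussian, with `S` the symmetric square root
of `Q` and `(det S)² = det Q`. -/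
lemma multivariateGaussian_eq_withDensity (m : EuclideanSpace ℝ ι) {Q : Matrix ι ι ℝ}
    (hQ : Q.PosDef) : multivariateGaussian m Q =
      volume.withDensity fun x => ENNReal.ofReal (Real.exp (gaussLog Q (x - m))) := by
  obtain ⟨S, -, -, hS, -, -, hSS, -⟩ := exists_sqrt_pinv hQ.posSemidef
  have hdetQ : Q.det = S.det * S.det := by rw [← hSS, det_mul]
  have hS0 : S.det ≠ 0 := fun h => hQ.det_pos.ne' (by rw [hdetQ, h, zero_mul])
  have hSu : IsUnit S.det := isUnit_iff_ne_zero.2 hS0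
  have hmap : multivariateGaussian m Q =
      (stdGaussian (EuclideanSpace ℝ ι)).map (fun x => m + toEuclideanLin S x) := by
    rw [multivariateGaussian_eq_map_add, ← multivariateGaussian_zero_one]
    have := map_toEuclideanLin_multivariateGaussian (Matrix.PosSemidef.one (n := ι) (R := ℝ)) S
    rw [Matrix.mul_one, hS, hSS] at this
    rw [← this, Measure.map_map (by fun_prop) (measurable_toEuclideanLin S)]
    rfl
  have hmeasS := measurable_toEuclideanLin S
  have hdet : LinearMap.det (toEuclideanLin S) ≠ 0 := by rwa [LinearMap.det_toLpLin]
  refine Measure.ext_of_lintegral _ fun F hF => ?_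
  rw [hmap, lintegral_map hF (by fun_prop), stdGaussian_eq_withDensity,
    lintegral_withDensity_eq_lintegral_mul _ (by fun_prop) (by fun_prop),
    lintegral_withDensity_eq_lintegral_mul _ (by fun_prop) hF]
  have hvol : (volume : Measure (EuclideanSpace ℝ ι)) =
      ENNReal.ofReal |S.det| • volume.map (fun x => m + toEuclideanLin S x) := by
    have h1 : volume.map (fun x => m + toEuclideanLin S x) =
        (volume.map (toEuclideanLin S)).map (fun x => m + x) := by
      rw [Measure.map_map (by fun_prop) hmeasS]; rfl
    rw [h1, Measure.map_linearMap_addHaar_eq_smul_addHaar _ hdet, Measure.map_smul,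
      (measurePreserving_add_left volume m).map_eq, smul_smul, LinearMap.det_toLpLin,
      ← ENNReal.ofReal_mul (abs_nonneg _), ← abs_mul, mul_inv_cancel₀ hS0]
    simp
  conv_rhs => rw [hvol]
  rw [lintegral_smul_measure, lintegral_map (by fun_prop) (by fun_prop), smul_eq_mul,
    ← lintegral_const_mul _ (by fun_prop)]
  refine lintegral_congr fun x => ?_
  simp only [Pi.mul_apply]
  rw [← mul_assoc, ← ENNReal.ofReal_mul (abs_nonneg _)]
  congr 2
  rw [← Real.exp_log (abs_pos.2 hS0), ← Real.exp_add]
  congr 1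
  rw [gaussLog, gaussLog, hdetQ, Real.log_mul hS0 hS0, Real.log_abs, add_sub_cancel_left, inv_one,
    one_mulVec, det_one, Real.log_one]
  have : (toEuclideanLin S x).ofLp ⬝ᵥ Q⁻¹ *ᵥ (toEuclideanLin S x).ofLp = x.ofLp ⬝ᵥ x.ofLp := by
    have h := transpose_mulVec_dotProduct Sᵀ Sᵀ Q⁻¹ x.ofLp x.ofLp
    rw [transpose_transpose, hS, ← hSS, Matrix.mul_inv_rev, ← Matrix.mul_assoc,
        mul_nonsing_inv _ hSu,
      Matrix.one_mul, nonsing_inv_mul _ hSu, one_mulVec] at h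
    rw [toLpLin_apply, ← hSS, Matrix.mul_inv_rev]
    exact h
  rw [this]
  ring

/-- Change of measure between two nondegenerate Gaussian measures. -/
lemma multivariateGaussian_withDensity (m m' : EuclideanSpace ℝ ι) {Q Q' : Matrix ι ι ℝ}
    (hQ : Q.PosDef) (hQ' : Q'.PosDef) :
    (multivariateGaussian m Q).withDensity
      (fun x => ENNReal.ofReal (Real.exp (gaussLog Q' (x - m') - gaussLog Q (x - m)))) =
      multivariateGaussian m' Q' := by
  rw [multivariateGaussian_eq_withDensity m hQ, multivariateGaussian_eq_withDensity m' hQ',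
    ← withDensity_mul _ (by fun_prop) (by fun_prop)]
  congr 1
  ext x
  rw [Pi.mul_apply, ← ENNReal.ofReal_mul (Real.exp_pos _).le, ← Real.exp_add]
  congr 2
  ring

variable {Ω : Type*} [MeasurableSpace Ω] {μ : Measure Ω} [IsProbabilityMeasure μ]

/-- The expected logarithm of a Gaussian density only depends on second moments. -/
lemma integral_gaussLog {Q : Matrix ι ι ℝ} (hQ : Q.PosDef) {ξ : Ω → EuclideanSpace ℝ ι}
    (hint : ∀ i j, Integrable (fun ω => ξ ω i * ξ ω j) μ)
    (hcov : ∀ i j, ∫ ω, ξ ω i * ξ ω j ∂μ = Q i j) :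
    Integrable (fun ω => gaussLog Q (ξ ω)) μ ∧
      ∫ ω, gaussLog Q (ξ ω) ∂μ =
        -(1 / 2) * (Fintype.card ι * Real.log (2 * Real.pi) + Real.log Q.det + Fintype.card ι) := by
  obtain ⟨c, hc⟩ : ∃ c : ι → ι → ℝ, ∀ i j, c i j = Q⁻¹ i j := ⟨_, fun _ _ => rfl⟩
  have hq : (fun ω => (ξ ω).ofLp ⬝ᵥ Q⁻¹ *ᵥ (ξ ω).ofLp) =
      fun ω => ∑ i, ∑ j, c i j * (ξ ω i * ξ ω j) := by
    ext ω
    simp only [dotProduct, mulVec, Finset.mul_sum, hc]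
    exact Finset.sum_congr rfl fun i _ => Finset.sum_congr rfl fun j _ => by ring
  have hi : Integrable (fun ω => (ξ ω).ofLp ⬝ᵥ Q⁻¹ *ᵥ (ξ ω).ofLp) μ := by
    rw [hq]
    exact integrable_finsetSum _ fun i _ => integrable_finsetSum _ fun j _ => (hint i j).const_mul _
  have hv : ∫ ω, (ξ ω).ofLp ⬝ᵥ Q⁻¹ *ᵥ (ξ ω).ofLp ∂μ = Fintype.card ι := by
    rw [hq, integral_finsetSum _ fun i _ =>
      integrable_finsetSum _ fun j _ => (hint i j).const_mul _]
    have h1 : ∀ i, ∫ ω, ∑ j, c i j * (ξ ω i * ξ ω j) ∂μ = ∑ j, c i j * Q i j := by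
      intro i
      rw [integral_finsetSum _ fun j _ => (hint i j).const_mul _]
      exact Finset.sum_congr rfl fun j _ => by rw [integral_const_mul, hcov]
    -- The expected quadratic form is the trace of `Q⁻¹ Q`, the dimension.
    have h : (Q⁻¹ * Qᵀ).trace = Fintype.card ι := by
      rw [transpose_eq_of_posSemidef hQ.posSemidef,
        nonsing_inv_mul _ (isUnit_iff_ne_zero.2 hQ.det_pos.ne'), trace_one]
    rw [← h, Finset.sum_congr rfl fun i _ => h1 i]
    simp [trace, Matrix.mul_apply, hc]
  refine ⟨((integrable_const _).add hi).const_mul _, ?_⟩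
  unfold gaussLog
  rw [integral_const_mul, integral_add (integrable_const _) hi, hv]
  simp

end Density

/-! ### Divergence bounds -/

section Divergence

variable {α β : Type*} [MeasurableSpace α] [MeasurableSpace β]

/-- The easy half of the Donsker–Varadhan formula. -/
lemma ofReal_integral_le_klDiv {μ ν : Measure α} [IsProbabilityMeasure μ] [IsProbabilityMeasure ν]
    {f : α → ℝ} (hf : Measurable f) (hfμ : Integrable f μ)
    (hν : ∫⁻ x, ENNReal.ofReal (Real.exp (f x)) ∂ν ≤ 1) :
    ENNReal.ofReal (∫ x, f x ∂μ) ≤ klDiv μ ν := by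
  by_cases h : klDiv μ ν = ⊤
  · rw [h]; exact le_top
  obtain ⟨hac, hllr⟩ := klDiv_ne_top_iff.1 h
  have hexp : Integrable (fun x => Real.exp (f x)) ν := by
    refine ⟨by fun_prop, ?_⟩
    rw [hasFiniteIntegral_iff_ofReal (Filter.Eventually.of_forall fun x => (Real.exp_pos _).le)]
    exact hν.trans_lt ENNReal.one_lt_top
  have hle : ∫ x, Real.exp (f x) ∂ν ≤ 1 := by
    rw [integral_eq_lintegral_of_nonneg_ae (Filter.Eventually.of_forall fun x =>
        (Real.exp_pos _).le)
      (by fun_prop)]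
    exact ENNReal.toReal_le_of_le_ofReal zero_le_one (by simpa using hν)
  have hpos : 0 < ∫ x, Real.exp (f x) ∂ν := integral_exp_pos hexp
  have := isProbabilityMeasure_tilted hexp
  -- Tilting `ν` by `f` gives a probability measure. Nonnegativity of the divergence of `μ` from it
  -- reads `∫ f dμ ≤ KL(μ, ν) + log ∫ exp f dν`, and the last logarithm is at most zero.
  have h1 := integral_llr_tilted_right hac hfμ hexp hllr
  have h2 := integral_llr_add_sub_measure_univ_nonneg (hac.trans (absolutelyContinuous_tilted hexp))
    (integrable_llr_tilted_right hac hfμ hllr hexp)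
  have h3 := Real.log_nonpos hpos.le hle
  have h4 := toReal_klDiv_of_measure_eq hac (by simp)
  simp only [probReal_univ] at h2
  refine ENNReal.ofReal_le_of_le_toReal ?_
  rw [h4]
  linarith

lemma klDiv_withDensity_exp {μ ν : Measure α} [IsProbabilityMeasure μ] [IsProbabilityMeasure ν]
    {f : α → ℝ} (hf : Measurable f) (hfμ : Integrable f μ)
    (h : μ = ν.withDensity fun x => ENNReal.ofReal (Real.exp (f x))) :
    klDiv μ ν = ENNReal.ofReal (∫ x, f x ∂μ) := by
  have hac : μ ≪ ν := by rw [h]; exact withDensity_absolutelyContinuous _ _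
  have hllr : llr μ ν =ᵐ[μ] f := by
    refine hac.ae_eq ?_
    have h1 := Measure.rnDeriv_withDensity ν (f := fun x => ENNReal.ofReal (Real.exp (f x)))
      (by fun_prop)
    rw [← h] at h1
    filter_upwards [h1] with x hx
    rw [llr, hx, ENNReal.toReal_ofReal (Real.exp_pos _).le, Real.log_exp]
  have hi : Integrable (llr μ ν) μ := hfμ.congr hllr.symm
  rw [← ENNReal.ofReal_toReal (klDiv_ne_top hac hi), toReal_klDiv_of_measure_eq hac (by simp),
    integral_congr_ae hllr]

lemma klDiv_prod_right (μ ν : Measure α) [IsFiniteMeasure μ] [IsFiniteMeasure ν] (ρ : Measure β)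
    [IsProbabilityMeasure ρ] : klDiv (μ.prod ρ) (ν.prod ρ) = klDiv μ ν := by
  rw [← Measure.compProd_const, ← Measure.compProd_const]
  exact klDiv_compProd_left μ ν _

end Divergence

/-! ### The divergence of one Gaussian stage -/

section Stage

open Matrix Filter
open scoped Topology

variable {ι : Type*} [Fintype ι] [DecidableEq ι]

lemma memLp_multivariateGaussian (Q : Matrix ι ι ℝ) (i : ι) :
    MemLp (fun x : EuclideanSpace ℝ ι => x i) 2 (multivariateGaussian 0 Q) :=
  (IsGaussian.memLp_two_id (μ := multivariateGaussian 0 Q)).continuousLinearMap_comp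
    (EuclideanSpace.proj (𝕜 := ℝ) i)

lemma integral_eval_multivariateGaussian (Q : Matrix ι ι ℝ) (i : ι) :
    ∫ x, x i ∂(multivariateGaussian (0 : EuclideanSpace ℝ ι) Q) = 0 := by
  have h := (EuclideanSpace.proj (𝕜 := ℝ) i).integral_comp_comm
    (IsGaussian.integrable_id (μ := multivariateGaussian (0 : EuclideanSpace ℝ ι) Q))
  simp only [id_eq, integral_id_multivariateGaussian] at h
  simpa using h

lemma integrable_mul_multivariateGaussian (Q : Matrix ι ι ℝ) (i j : ι) :
    Integrable (fun x : EuclideanSpace ℝ ι => x i * x j) (multivariateGaussian 0 Q) :=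
  (memLp_multivariateGaussian Q i).integrable_mul (memLp_multivariateGaussian Q j)

lemma integral_mul_multivariateGaussian {Q : Matrix ι ι ℝ} (hQ : Q.PosSemidef) (i j : ι) :
    ∫ x, x i * x j ∂(multivariateGaussian (0 : EuclideanSpace ℝ ι) Q) = Q i j := by
  have h := covariance_eval_multivariateGaussian (μ := (0 : EuclideanSpace ℝ ι)) hQ i j
  rw [covariance, integral_eval_multivariateGaussian, integral_eval_multivariateGaussian] at h
  simpa using h

variable {T G : Matrix ι ι ℝ}

lemma measurable_logRatio (T G : Matrix ι ι ℝ) :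
    Measurable fun p : EuclideanSpace ℝ ι × EuclideanSpace ℝ ι =>
      gaussLog G (p.1 - p.2) - gaussLog T p.1 := by
  fun_prop

/-- Only the separate laws of `u` and `e` enter, since each log density integrates to a constant;
the dimension and `2π` terms cancel. -/
lemma integral_logRatio {Ω : Type*} [MeasurableSpace Ω] {μ : Measure Ω} [IsProbabilityMeasure μ]
    (hT : T.PosDef) (hG : G.PosDef) {u e : Ω → EuclideanSpace ℝ ι} (hu : Measurable u)
    (he : Measurable e) (hu' : μ.map u = multivariateGaussian 0 T)
    (he' : μ.map e = multivariateGaussian 0 G) :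
    Integrable (fun ω => gaussLog G (e ω) - gaussLog T (u ω)) μ ∧
      ∫ ω, gaussLog G (e ω) - gaussLog T (u ω) ∂μ = 1 / 2 * Real.log (T.det / G.det) := by
  have key : ∀ {Q : Matrix ι ι ℝ} {ξ : Ω → EuclideanSpace ℝ ι}, Q.PosDef → Measurable ξ →
      μ.map ξ = multivariateGaussian 0 Q → Integrable (fun ω => gaussLog Q (ξ ω)) μ ∧
      ∫ ω, gaussLog Q (ξ ω) ∂μ =
        -(1 / 2) * (Fintype.card ι * Real.log (2 * Real.pi) + Real.log Q.det + Fintype.card ι) := by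
    intro Q ξ hQ hξ hξ'
    refine integral_gaussLog hQ (fun i j => ?_) (fun i j => ?_)
    · have := integrable_mul_multivariateGaussian Q i j
      rw [← hξ'] at this
      exact this.comp_measurable hξ
    · rw [← integral_mul_multivariateGaussian hQ.posSemidef i j, ← hξ',
        integral_map hξ.aemeasurable (by fun_prop)]
  obtain ⟨h1, h2⟩ := key hT hu hu'
  obtain ⟨h3, h4⟩ := key hG he he'
  refine ⟨h3.sub h1, ?_⟩
  rw [integral_sub h3 h1, h2, h4, Real.log_div hT.det_pos.ne' hG.det_pos.ne']
  ring

lemma lintegral_exp_logRatio (hT : T.PosDef) (hG : G.PosDef) (m w : EuclideanSpace ℝ ι) :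
    ∫⁻ x, ENNReal.ofReal (Real.exp (gaussLog G (x - w) - gaussLog T (x - m)))
      ∂(multivariateGaussian m T) = 1 := by
  have h := congrArg (fun ρ => ρ Set.univ) (multivariateGaussian_withDensity m w hT hG)
  simpa using h

/-- Divergence of the joint law of a Gaussian vector and its estimate, bounded below after adding
noise to the vector. -/
lemma regRate_le_klDiv_estimateLaw (hG : G.PosSemidef) (hTG : (T - G).PosSemidef) {η : ℝ}
    (hη : 0 < η) : ENNReal.ofReal (regRate η T G) ≤
      klDiv (estimateLaw T G)
        ((multivariateGaussian 0 T).prod (multivariateGaussian 0 (T - G))) := by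
  have hT : T.PosSemidef := by simpa using hG.add hTG
  have hTη := posDef_add_smul_one hT hη
  have hGη := posDef_add_smul_one hG hη
  have hsum : ∀ {Q : Matrix ι ι ℝ}, Q.PosSemidef →
      ((multivariateGaussian 0 Q).prod (multivariateGaussian 0 (η • (1 : Matrix ι ι ℝ)))).map
        (fun p => p.1 + p.2) = multivariateGaussian 0 (Q + η • 1) := by
    intro Q hQ
    have h := map_add_multivariateGaussian hQ (posSemidef_smul_one (ι := ι) hη.le)
      (1 : Matrix ι ι ℝ) 1
    simpa using h
  set N := multivariateGaussian 0 (η • (1 : Matrix ι ι ℝ)) with hN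
  set g : (EuclideanSpace ℝ ι × EuclideanSpace ℝ ι) × EuclideanSpace ℝ ι →
    EuclideanSpace ℝ ι × EuclideanSpace ℝ ι := fun p => (p.1.1 + p.2, p.1.2) with hg
  have hgm : Measurable g := by fun_prop
  -- The noise is added to the first component under both laws. It does not change the divergence as
  -- an extra independent coordinate, and adding it up is data processing.
  have hν : (((multivariateGaussian 0 T).prod (multivariateGaussian 0 (T - G))).prod N).map g =
      (multivariateGaussian 0 (T + η • 1)).prod (multivariateGaussian 0 (T - G)) := by
    refine Measure.ext_of_lintegral _ fun F hF => ?_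
    rw [lintegral_map hF hgm, lintegral_prod _ (by fun_prop), lintegral_prod_symm _ (by fun_prop),
      lintegral_prod_symm _ (by fun_prop)]
    refine lintegral_congr fun w => ?_
    rw [← hsum hT, lintegral_map (by fun_prop) (by fun_prop), lintegral_prod _ (by fun_prop)]
  have hJ1 : ((estimateLaw T G).prod N).map (fun p => p.1.1 + p.2) =
      multivariateGaussian 0 (T + η • 1) := by
    rw [← hsum hT, ← map_fst_estimateLaw hG hTG]
    have h := Measure.map_prod_map (estimateLaw T G) N (f := Prod.fst) (g := id) measurable_fst
      measurable_id
    rw [Measure.map_id] at h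
    rw [h, Measure.map_map (by fun_prop) (by fun_prop)]
    rfl
  have hJ2 : ((estimateLaw T G).prod N).map (fun p => p.1.1 + p.2 - p.1.2) =
      multivariateGaussian 0 (G + η • 1) := by
    have h0 : (estimateLaw T G).map (fun p => p.1 - p.2) = multivariateGaussian 0 G := by
      rw [estimateLaw, Measure.map_map (by fun_prop) (by fun_prop)]
      have : (fun p : EuclideanSpace ℝ ι × EuclideanSpace ℝ ι => p.1 - p.2) ∘
          (fun p => (p.1 + p.2, p.1)) = Prod.snd := by ext p; simp
      rw [this]; exact Measure.snd_prod
    rw [← hsum hG, ← h0]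
    have h := Measure.map_prod_map (estimateLaw T G) N (f := fun p => p.1 - p.2) (g := id)
      (by fun_prop) measurable_id
    rw [Measure.map_id] at h
    rw [h, Measure.map_map (by fun_prop) (by fun_prop)]
    congr 1
    ext p
    simp only [Function.comp_apply, Prod.map, id]
    abel_nf
  have hle := klDiv_map_le ((estimateLaw T G).prod N)
    (((multivariateGaussian 0 T).prod (multivariateGaussian 0 (T - G))).prod N) hgm
  rw [klDiv_prod_right, hν] at hle
  refine le_trans ?_ hle
  have : IsProbabilityMeasure (((estimateLaw T G).prod N).map g) :=
    Measure.isProbabilityMeasure_map hgm.aemeasurable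
  obtain ⟨hi, hv⟩ := integral_logRatio (μ := (estimateLaw T G).prod N) hTη hGη
    (u := fun p => p.1.1 + p.2) (e := fun p => p.1.1 + p.2 - p.1.2) (by fun_prop) (by fun_prop)
    hJ1 hJ2
  have hm := measurable_logRatio (T + η • 1) (G + η • 1)
  -- The test function is the log ratio of `N(w, G + η)` to `N(0, T + η)`; for every fixed `w` its
  -- exponential integrates to one.
  have h := ofReal_integral_le_klDiv (μ := ((estimateLaw T G).prod N).map g)
    (ν := (multivariateGaussian 0 (T + η • 1)).prod (multivariateGaussian 0 (T - G))) hm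
    ((integrable_map_measure hm.aestronglyMeasurable hgm.aemeasurable).2 hi) ?_
  · rw [integral_map hgm.aemeasurable hm.aestronglyMeasurable] at h
    simp only [hg] at h
    rwa [hv] at h
  · rw [lintegral_prod_symm _ (by fun_prop)]
    have h1 := fun w => lintegral_exp_logRatio hTη hGη 0 w
    simp only [sub_zero] at h1
    simp [h1]

/-- Given the estimate `w` the vector is `N(w, K)`, which for definite `K` has a density against
`N(0, 1)`. So the log density of the joint law is explicit, and `integral_logRatio` integrates it.
-/
lemma klDiv_estimateLaw_one {K : Matrix ι ι ℝ} (hK : K.PosDef) (h1K : (1 - K).PosSemidef) :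
    klDiv (estimateLaw 1 K) ((multivariateGaussian 0 1).prod (multivariateGaussian 0 (1 - K))) =
      ENNReal.ofReal (1 / 2 * Real.log (K.det)⁻¹) := by
  have hm := measurable_logRatio 1 K
  have h2 : (estimateLaw 1 K).map (fun p => p.1 - p.2) = multivariateGaussian 0 K := by
    rw [estimateLaw, Measure.map_map (by fun_prop) (by fun_prop)]
    have : (fun p : EuclideanSpace ℝ ι × EuclideanSpace ℝ ι => p.1 - p.2) ∘
        (fun p => (p.1 + p.2, p.1)) = Prod.snd := by ext p; simp
    rw [this]; exact Measure.snd_prod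
  obtain ⟨hi, hv⟩ := integral_logRatio (μ := estimateLaw 1 K) Matrix.PosDef.one hK measurable_fst
    (e := fun p => p.1 - p.2) (by fun_prop) (map_fst_estimateLaw hK.posSemidef h1K) h2
  rw [klDiv_withDensity_exp hm hi, hv, det_one, one_div]
  · simp
  · refine Measure.ext_of_lintegral _ fun F hF => ?_
    rw [lintegral_withDensity_eq_lintegral_mul _ (by fun_prop) hF, estimateLaw,
      lintegral_map hF (by fun_prop), lintegral_prod _ (by fun_prop),
      lintegral_prod_symm _ (by fun_prop)]
    refine lintegral_congr fun w => ?_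
    have h := multivariateGaussian_withDensity 0 w Matrix.PosDef.one hK
    have h3 := multivariateGaussian_eq_map_add w K
    calc ∫⁻ e, F (w + e, w) ∂(multivariateGaussian 0 K)
        = ∫⁻ x, F (x, w) ∂(multivariateGaussian w K) := by
          rw [h3, lintegral_map (by fun_prop) (by fun_prop)]
      _ = _ := by
          rw [← h, lintegral_withDensity_eq_lintegral_mul _ (by fun_prop) (by fun_prop)]
          simp

/-- Divergence of the joint law of a Gaussian vector and its estimate. -/
theorem klDiv_estimateLaw (hG : G.PosSemidef) (hTG : (T - G).PosSemidef) :
    klDiv (estimateLaw T G) ((multivariateGaussian 0 T).prod (multivariateGaussian 0 (T - G))) =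
      gaussRate T G := by
  have hlim := tendsto_regRate hG hTG
  -- For `≤`, if the ranks agree, the law is the image of the whitened `estimateLaw 1 K` under `S`
  -- in both components, and data processing applies. For `≥`, the regularized lower bounds pass to
  -- the limit.
  refine le_antisymm ?_ (le_of_tendsto hlim ?_)
  · by_cases hr : G.rank = T.rank
    · obtain ⟨S, K, hK, h1K, hT, hG', hdet⟩ := exists_whitening hG hTG hr
      have hrate : gaussRate T G = ENNReal.ofReal (1 / 2 * Real.log (K.det)⁻¹) := by
        refine tendsto_nhds_unique hlim (ENNReal.tendsto_ofReal (Tendsto.const_mul _ ?_))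
        exact hdet.log (inv_ne_zero hK.det_pos.ne')
      rw [hrate, ← klDiv_estimateLaw_one hK h1K]
      have hD : S * (1 - K) * Sᵀ = T - G := by
        rw [Matrix.mul_sub, Matrix.sub_mul, hT, hG']
      have hSm := measurable_toEuclideanLin S
      have e1 := map_toEuclideanLin_multivariateGaussian (Matrix.PosSemidef.one (n := ι) (R := ℝ)) S
      have e2 := map_toEuclideanLin_multivariateGaussian hK.posSemidef S
      have e3 := map_toEuclideanLin_multivariateGaussian h1K S
      rw [hT] at e1; rw [hG'] at e2; rw [hD] at e3
      have hJ : (estimateLaw 1 K).map (Prod.map (toEuclideanLin S) (toEuclideanLin S)) =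
          estimateLaw T G := by
        rw [estimateLaw, estimateLaw, ← e2, ← e3, Measure.map_prod_map _ _ hSm hSm,
          Measure.map_map (by fun_prop) (by fun_prop), Measure.map_map (by fun_prop) (by fun_prop)]
        congr 1
        ext p <;> simp
      rw [← hJ, ← e1, ← e3, Measure.map_prod_map _ _ hSm hSm]
      exact klDiv_map_le _ _ (hSm.prodMap hSm)
    · rw [gaussRate_of_rank_ne hG hTG hr]; exact le_top
  · filter_upwards [self_mem_nhdsWithin] with η hη
    exact regRate_le_klDiv_estimateLaw hG hTG hη

lemma regRate_le_gaussRate (hG : G.PosSemidef) (hTG : (T - G).PosSemidef) {η : ℝ} (hη : 0 < η) :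
    ENNReal.ofReal (regRate η T G) ≤ gaussRate T G :=
  klDiv_estimateLaw hG hTG ▸ regRate_le_klDiv_estimateLaw hG hTG hη

end Stage

/-! ### Independence with a prescribed law -/

section IndepLaw

variable {Ω α β γ δ : Type*} [MeasurableSpace Ω] [MeasurableSpace α] [MeasurableSpace β]
  [MeasurableSpace γ] [MeasurableSpace δ]

/-- Under `μ`, the variable `g` has law `ρ` and is independent of `f`. -/
structure IndepLaw (μ : Measure Ω) (f : Ω → α) (g : Ω → β) (ρ : Measure β) : Prop where
  measurable_left : Measurable f
  measurable_right : Measurable g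
  map_prod : μ.map (fun ω => (f ω, g ω)) = (μ.map f).prod ρ

namespace IndepLaw

variable {μ : Measure Ω} [IsProbabilityMeasure μ] {f : Ω → α} {g : Ω → β} {h : Ω → γ}
  {ρ : Measure β} [IsProbabilityMeasure ρ] {σ : Measure γ} [IsProbabilityMeasure σ]

lemma map_right (H : IndepLaw μ f g ρ) : μ.map g = ρ := by
  have := H.measurable_left
  have := H.measurable_right
  have := Measure.isProbabilityMeasure_map (μ := μ) H.measurable_left.aemeasurable
  have h := congrArg (Measure.map Prod.snd) H.map_prod
  rw [Measure.map_map measurable_snd (by fun_prop), ← Measure.snd, Measure.snd_prod] at h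
  exact h

lemma indepFun (H : IndepLaw μ f g ρ) : IndepFun f g μ := by
  rw [indepFun_iff_map_prod_eq_prod_map_map H.measurable_left.aemeasurable
    H.measurable_right.aemeasurable, H.map_prod, H.map_right]

lemma comp_left (H : IndepLaw μ f g ρ) {φ : α → δ} (hφ : Measurable φ) :
    IndepLaw μ (fun ω => φ (f ω)) g ρ := by
  have hf := H.measurable_left
  have hg := H.measurable_right
  refine ⟨hφ.comp hf, hg, ?_⟩
  have := Measure.isProbabilityMeasure_map (μ := μ) hf.aemeasurable
  have h := congrArg (Measure.map (Prod.map φ id)) H.map_prod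
  rw [Measure.map_map (by fun_prop) (by fun_prop), ← Measure.map_prod_map _ _ hφ measurable_id,
    Measure.map_map hφ hf, Measure.map_id] at h
  exact h

lemma comp_right (H : IndepLaw μ f g ρ) {φ : β → δ} (hφ : Measurable φ) :
    IndepLaw μ f (fun ω => φ (g ω)) (ρ.map φ) := by
  have hf := H.measurable_left
  have hg := H.measurable_right
  refine ⟨hf, hφ.comp hg, ?_⟩
  have := Measure.isProbabilityMeasure_map (μ := μ) hf.aemeasurable
  have h := congrArg (Measure.map (Prod.map id φ)) H.map_prod
  rw [Measure.map_map (by fun_prop) (by fun_prop), ← Measure.map_prod_map _ _ measurable_id hφ,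
    Measure.map_id] at h
  exact h

lemma pair (H : IndepLaw μ f g ρ) (H' : IndepLaw μ (fun ω => (f ω, g ω)) h σ) :
    IndepLaw μ f (fun ω => (g ω, h ω)) (ρ.prod σ) := by
  have hf := H.measurable_left
  have hg := H.measurable_right
  have hh := H'.measurable_right
  have := Measure.isProbabilityMeasure_map (μ := μ) hf.aemeasurable
  refine ⟨hf, by fun_prop, ?_⟩
  have h1 := congrArg (Measure.map MeasurableEquiv.prodAssoc) H'.map_prod
  rw [H.map_prod, (measurePreserving_prodAssoc _ _ _).map_eq,
    Measure.map_map (MeasurableEquiv.measurable _) (by fun_prop)] at h1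
  exact h1

/-- With `pair`, the chain rule for independence: a variable can be moved between the two sides by
reassociating the product law. -/
lemma unpair (H : IndepLaw μ f (fun ω => (g ω, h ω)) (ρ.prod σ)) (hg : Measurable g)
    (hh : Measurable h) : IndepLaw μ (fun ω => (f ω, g ω)) h σ := by
  have hf := H.measurable_left
  have := Measure.isProbabilityMeasure_map (μ := μ) hf.aemeasurable
  have h2 := (H.comp_right measurable_fst).map_prod
  have h3 : (ρ.prod σ).map Prod.fst = ρ := Measure.fst_prod
  rw [h3] at h2
  refine ⟨by fun_prop, hh, ?_⟩
  have h1 := congrArg (Measure.map MeasurableEquiv.prodAssoc.symm) H.map_prod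
  rw [((measurePreserving_prodAssoc _ _ _).symm _).map_eq,
    Measure.map_map (MeasurableEquiv.measurable _) (by fun_prop)] at h1
  rw [h2, ← h1]
  rfl

lemma const (c : α) (hg : Measurable g) (hρ : μ.map g = ρ) :
    IndepLaw μ (fun _ => c) g ρ := by
  refine ⟨measurable_const, hg, ?_⟩
  rw [Measure.map_const, measure_univ, one_smul, Measure.dirac_prod, ← hρ,
    Measure.map_map (by fun_prop) hg]
  rfl

/-- Resampling a variable leaves the measure unchanged. -/
lemma of_resample {r : Ω × β → Ω} (hr : Measurable r) (hμ : (μ.prod ρ).map r = μ)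
    (hf : Measurable f) (hg : Measurable g) (hfr : ∀ ω b, f (r (ω, b)) = f ω)
    (hgr : ∀ ω b, g (r (ω, b)) = b) : IndepLaw μ f g ρ := by
  refine ⟨hf, hg, ?_⟩
  conv_lhs => rw [← hμ]
  rw [Measure.map_map (by fun_prop) hr]
  have h := Measure.map_prod_map μ ρ hf measurable_id
  rw [Measure.map_id] at h
  rw [h]
  congr 1
  ext ⟨ω, b⟩ <;> simp [hfr, hgr]

/-- An extra independent coordinate may join the conditioning side: freeze it by Fubini and use `H`.
-/
lemma prod_right (H : IndepLaw μ f g ρ) (ν : Measure δ) [IsProbabilityMeasure ν] :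
    IndepLaw (μ.prod ν) (fun p => (f p.1, p.2)) (fun p => g p.1) ρ := by
  have hf := H.measurable_left
  have hg := H.measurable_right
  have := Measure.isProbabilityMeasure_map (μ := μ) hf.aemeasurable
  refine ⟨by fun_prop, by fun_prop, ?_⟩
  refine Measure.ext_of_lintegral _ fun F hF => ?_
  have h1 : (μ.prod ν).map (fun p => (f p.1, p.2)) = (μ.map f).prod ν := by
    have h := Measure.map_prod_map μ ν hf measurable_id
    rw [Measure.map_id] at h
    exact h.symm
  rw [lintegral_map hF (by fun_prop), lintegral_prod_symm _ (by fun_prop), h1,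
    lintegral_prod _ (by fun_prop), lintegral_prod_symm _ (by fun_prop)]
  refine lintegral_congr fun d => ?_
  have h2 := congrArg (fun τ => ∫⁻ z, F ((z.1, d), z.2) ∂τ) H.map_prod
  rw [lintegral_map (by fun_prop) (by fun_prop), lintegral_prod _ (by fun_prop)] at h2
  exact h2

lemma map_iff {μ' : Measure δ} {r : δ → Ω} (hr : Measurable r) (hμ : μ'.map r = μ)
    (hf : Measurable f) (hg : Measurable g) :
    IndepLaw μ f g ρ ↔ IndepLaw μ' (fun d => f (r d)) (fun d => g (r d)) ρ := by
  have h1 : μ.map f = μ'.map (fun d => f (r d)) := by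
    rw [← hμ, Measure.map_map hf hr]; rfl
  have h2 : μ.map (fun ω => (f ω, g ω)) = μ'.map (fun d => (f (r d), g (r d))) := by
    rw [← hμ, Measure.map_map (by fun_prop) hr]; rfl
  refine ⟨fun H => ⟨hf.comp hr, hg.comp hr, ?_⟩, fun H => ⟨hf, hg, ?_⟩⟩
  · rw [← h1, ← h2, H.map_prod]
  · rw [h1, h2, H.map_prod]

end IndepLaw

lemma indepLaw_fst_snd (μ : Measure α) [IsProbabilityMeasure μ] (ρ : Measure β)
    [IsProbabilityMeasure ρ] : IndepLaw (μ.prod ρ) Prod.fst Prod.snd ρ := by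
  have h : (μ.prod ρ).map Prod.fst = μ := Measure.fst_prod
  refine ⟨measurable_fst, measurable_snd, ?_⟩
  rw [h]
  exact Measure.map_id

/-- Supplies the invariance hypothesis of `IndepLaw.of_resample` for product measures; it is checked
on boxes. -/
lemma map_update_pi {ι : Type*} [Fintype ι] [DecidableEq ι] {E : ι → Type*}
    [∀ i, MeasurableSpace (E i)] (μ : ∀ i, Measure (E i)) [∀ i, IsProbabilityMeasure (μ i)]
    (i : ι) : ((Measure.pi μ).prod (μ i)).map (fun p => Function.update p.1 i p.2) =
      Measure.pi μ := by
  have hm : Measurable fun p : (∀ j, E j) × E i => Function.update p.1 i p.2 := measurable_update'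
  refine (Measure.pi_eq fun s hs => ?_).symm
  rw [Measure.map_apply hm (MeasurableSet.univ_pi hs)]
  have : (fun p : (∀ j, E j) × E i => Function.update p.1 i p.2) ⁻¹' Set.univ.pi s =
      (Set.univ.pi (Function.update s i Set.univ)) ×ˢ s i := by
    ext p
    simp only [Set.mem_preimage, Set.mem_pi, Set.mem_univ, true_implies, Set.mem_prod]
    constructor
    · intro h
      refine ⟨fun j => ?_, by simpa using h i⟩
      by_cases hj : j = i
      · subst hj; simp
      · have := h j
        rwa [Function.update_of_ne hj] at this ⊢
    · rintro ⟨h1, h2⟩ j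
      by_cases hj : j = i
      · subst hj; simpa using h2
      · have := h1 j
        rwa [Function.update_of_ne hj] at this ⊢
  rw [this, Measure.prod_prod, Measure.pi_pi, ← Finset.mul_prod_erase _ _ (Finset.mem_univ i),
    ← Finset.mul_prod_erase Finset.univ (fun j => μ j (s j)) (Finset.mem_univ i),
    Function.update_self, measure_univ, one_mul, mul_comm]
  congr 1
  refine Finset.prod_congr rfl fun j hj => ?_
  rw [Function.update_of_ne (Finset.ne_of_mem_erase hj)]

end IndepLaw

/-! ### Truncated paths and Gauss–Markov laws -/

section Paths

open Matrix

variable {m p₁ p₂ q₁ q₂ : ℕ}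

/-- The first `k` entries of a path, continued by zero. -/
def trunc (k : ℕ) (y : Path m p₁ p₂) : Path m p₁ p₂ := fun s => if (s : ℕ) < k then y s else 0

lemma trunc_apply_of_lt {k : ℕ} (y : Path m p₁ p₂) {s : Fin (m + 1)} (h : (s : ℕ) < k) :
    trunc k y s = y s := if_pos h

@[fun_prop]
lemma measurable_trunc (k : ℕ) : Measurable (trunc k : Path m p₁ p₂ → Path m p₁ p₂) := by
  refine measurable_pi_iff.2 fun s => ?_
  unfold trunc
  split_ifs <;> fun_prop

@[simp] lemma trunc_zero (y : Path m p₁ p₂) : trunc 0 y = 0 := by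
  ext s; simp [trunc]

lemma trunc_of_le {k : ℕ} (h : m + 1 ≤ k) (y : Path m p₁ p₂) : trunc k y = y := by
  ext s; simp [trunc, show (s : ℕ) < k by omega]

lemma trunc_succ (k : Fin (m + 1)) (y : Path m p₁ p₂) :
    trunc ((k : ℕ) + 1) y = Function.update (trunc k y) k (y k) := by
  funext s
  by_cases h : s = k
  · subst h; simp [trunc]
  · rw [Function.update_of_ne h]
    have : (s : ℕ) ≠ k := fun h' => h (Fin.ext h')
    simp only [trunc, show ((s : ℕ) < k + 1 ↔ (s : ℕ) < k) by omega]

lemma trunc_congr {k : ℕ} {y y' : Path m p₁ p₂} (h : ∀ s : Fin (m + 1), (s : ℕ) < k → y s = y' s) :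
    trunc k y = trunc k y' := by
  funext s
  unfold trunc
  split_ifs with hs
  · exact h s hs
  · rfl

lemma trunc_trunc (k : ℕ) (y : Path m p₁ p₂) : trunc k (trunc k y) = trunc k y :=
  trunc_congr fun _ hs => trunc_apply_of_lt y hs

/-- The law of a Gauss–Markov process with transition matrices `A`, initial covariance `Q₀` and
noise covariances `Q`. -/
structure IsGaussMarkov (A : Fin m → Mat p₁ p₂ p₁ p₂) (Q₀ : Mat p₁ p₂ p₁ p₂)
    (Q : Fin m → Mat p₁ p₂ p₁ p₂) (P : Measure (Path m p₁ p₂)) : Prop where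
  init : P.map (fun x => x 0) = multivariateGaussian 0 Q₀
  step : ∀ i : Fin m, IndepLaw P (trunc (i + 1))
    (fun x => x i.succ - toEuclideanLin (A i) (x i.castSucc)) (multivariateGaussian 0 (Q i))

variable (S : Source m p₁ p₂ q₁ q₂)

namespace Source

lemma path_succ (x : Vec p₁ p₂) (w : Fin m → Vec q₁ q₂) (i : Fin m) :
    S.path x w i.succ = toEuclideanLin (S.A i) (S.path x w i.castSucc) +
      toEuclideanLin (S.B i) (w i) := by
  simp [path]

lemma path_congr {x : Vec p₁ p₂} {w w' : Fin m → Vec q₁ q₂} (t : Fin (m + 1))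
    (h : ∀ j : Fin m, (j : ℕ) < t → w j = w' j) : S.path x w t = S.path x w' t := by
  induction t using Fin.induction with
  | zero => rfl
  | succ i ih =>
    rw [path_succ, path_succ, ih fun j hj => h j (by simp at hj ⊢; omega), h i (by simp)]

/-- The covariance of the noise `B W` of a transition. -/
def noiseCov (i : Fin m) : Mat p₁ p₂ p₁ p₂ := S.B i * S.QW i * (S.B i)ᵀ

lemma noiseCov_posSemidef (i : Fin m) : (S.noiseCov i).PosSemidef :=
  posSemidef_mul_mul_transpose (S.posW i) _

/-- The states at times up to `i.castSucc` use only the noises with index below `i`, so resampling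
`w i` leaves this history unchanged. -/
lemma isGaussMarkov_law : IsGaussMarkov S.A S.QX S.noiseCov S.law := by
  have hA : ∀ i, Measurable (toEuclideanLin (S.A i)) := fun i => measurable_toEuclideanLin _
  have hB : ∀ i, Measurable (toEuclideanLin (S.B i)) := fun i => measurable_toEuclideanLin _
  refine ⟨?_, fun i => ?_⟩
  · rw [law, Measure.map_map (by fun_prop) S.measurable_path]
    exact Measure.fst_prod
  · rw [IndepLaw.map_iff (μ := S.law) S.measurable_path rfl (measurable_trunc _)
      (by have := hA i; fun_prop)]
    have h : IndepLaw ((multivariateGaussian 0 S.QX).prod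
        (Measure.pi fun i => multivariateGaussian 0 (S.QW i)))
        (fun u => trunc (i + 1) (S.path u.1 u.2)) (fun u => u.2 i)
        (multivariateGaussian 0 (S.QW i)) := by
      refine IndepLaw.of_resample (r := fun p => (p.1.1, Function.update p.1.2 i p.2)) ?_ ?_
        (by have := S.measurable_path; fun_prop) (by fun_prop) ?_ ?_
      · exact Measurable.prodMk (by fun_prop) (measurable_update'.comp
          ((measurable_snd.comp measurable_fst).prodMk measurable_snd))
      · have h1 := (measurePreserving_prodAssoc (multivariateGaussian 0 S.QX)
          (Measure.pi fun i => multivariateGaussian 0 (S.QW i))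
          (multivariateGaussian 0 (S.QW i))).map_eq
        have h2 := map_update_pi (fun i => multivariateGaussian 0 (S.QW i)) i
        have hu : Measurable fun p : (Fin m → Vec q₁ q₂) × Vec q₁ q₂ =>
            Function.update p.1 i p.2 := measurable_update'
        have h3 := Measure.map_prod_map (multivariateGaussian 0 S.QX)
          ((Measure.pi fun i => multivariateGaussian 0 (S.QW i)).prod
          (multivariateGaussian 0 (S.QW i))) measurable_id hu
        rw [h2, Measure.map_id, ← h1, Measure.map_map (by fun_prop)
          (MeasurableEquiv.measurable _)] at h3
        exact h3.symm
      · rintro ⟨x, w⟩ b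
        refine trunc_congr fun s hs => S.path_congr s fun j hj => ?_
        exact Function.update_of_ne (fun h => by subst h; simp at hs; omega) _ _
      · rintro ⟨x, w⟩ b
        simp
    have h' := h.comp_right (hB i)
    rw [map_toEuclideanLin_multivariateGaussian (S.posW i)] at h'
    convert h' using 2 with u
    · rw [path_succ, add_sub_cancel_left]
    · rfl

end Source

end Paths

/-! ### The realization -/

section Realization

open Matrix

variable {m p₁ p₂ q₁ q₂ : ℕ}

namespace Source

variable (S : Source m p₁ p₂ q₁ q₂)

lemma shift_zero (y : Path m p₁ p₂) : S.shift y 0 = 0 := rfl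

lemma shift_succ (y : Path m p₁ p₂) (i : Fin m) :
    S.shift y i.succ = toEuclideanLin (S.A i) (y i.castSucc) := rfl

lemma shift_congr {y y' : Path m p₁ p₂} (t : Fin (m + 1))
    (h : ∀ s : Fin (m + 1), (s : ℕ) < t → y s = y' s) : S.shift y t = S.shift y' t := by
  induction t using Fin.cases with
  | zero => rfl
  | succ i => rw [shift_succ, shift_succ, h _ (by simp)]

lemma shift_trunc (y : Path m p₁ p₂) (t : Fin (m + 1)) : S.shift (trunc t y) t = S.shift y t :=
  S.shift_congr t fun _ hs => trunc_apply_of_lt y hs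

@[fun_prop]
lemma measurable_shift (t : Fin (m + 1)) : Measurable fun y : Path m p₁ p₂ => S.shift y t := by
  induction t using Fin.cases with
  | zero => exact measurable_const
  | succ i => exact (measurable_toEuclideanLin _).comp (measurable_pi_apply _)

variable (H : Fin (m + 1) → Mat p₁ p₂ p₁ p₂)

lemma reproduction_apply (x v : Path m p₁ p₂) (t : Fin (m + 1)) :
    S.reproduction H x v t = toEuclideanLin (H t) (x t) +
      toEuclideanLin (1 - H t) (S.shift (S.reproduction H x v) t) + v t := by
  induction t using Fin.cases with
  | zero => simp [reproduction, shift_zero]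
  | succ i => rw [shift_succ]; simp only [reproduction, Fin.induction_succ]

/-- The innovation form: after subtracting the prediction `A Y_{t-1}`, the reproduction is the
output of the channel `H_t` applied to the prediction error. -/
lemma reproduction_eq_shift_add (x v : Path m p₁ p₂) (t : Fin (m + 1)) :
    S.reproduction H x v t = S.shift (S.reproduction H x v) t +
      (toEuclideanLin (H t) (x t - S.shift (S.reproduction H x v) t) + v t) := by
  conv_lhs => rw [reproduction_apply]
  rw [map_sub, map_sub, toLpLin_one]
  simp only [LinearMap.sub_apply, LinearMap.id_apply]
  abel

lemma reproduction_congr {x x' v v' : Path m p₁ p₂} (t : Fin (m + 1))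
    (hx : ∀ s : Fin (m + 1), (s : ℕ) ≤ t → x s = x' s)
    (hv : ∀ s : Fin (m + 1), (s : ℕ) ≤ t → v s = v' s) :
    S.reproduction H x v t = S.reproduction H x' v' t := by
  induction t using Fin.induction with
  | zero => rw [reproduction_apply, reproduction_apply, hx _ le_rfl, hv _ le_rfl]; rfl
  | succ i ih =>
    rw [reproduction_apply, reproduction_apply S H x', hx _ le_rfl, hv _ le_rfl, shift_succ,
      shift_succ, ih (fun s hs => hx s (by simp at hs ⊢; omega))
        (fun s hs => hv s (by simp at hs ⊢; omega))]

/-- The law of the source path and the noises of the realization. -/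
noncomputable def noiseLaw (QV : Fin (m + 1) → Mat p₁ p₂ p₁ p₂) :
    Measure (Path m p₁ p₂ × Path m p₁ p₂) :=
  S.law.prod (Measure.pi fun t => multivariateGaussian 0 (QV t))

variable (QV : Fin (m + 1) → Mat p₁ p₂ p₁ p₂)

instance : IsProbabilityMeasure (S.noiseLaw QV) := by
  unfold noiseLaw; infer_instance

/-- The reproduction as a random path. -/
noncomputable abbrev rep (u : Path m p₁ p₂ × Path m p₁ p₂) : Path m p₁ p₂ :=
    S.reproduction H u.1 u.2

@[fun_prop]
lemma measurable_rep : Measurable (S.rep H) := S.measurable_reproduction H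

lemma jointLaw_eq : S.jointLaw H QV = (S.noiseLaw QV).map fun u => (u.1, S.rep H u) := rfl

/-- Resampling the noise at time `t` preserves the product law and, by `h`, does not change `f`. -/
lemma indepLaw_noise {α : Type*} [MeasurableSpace α] (t : Fin (m + 1))
    {f : Path m p₁ p₂ × Path m p₁ p₂ → α} (hf : Measurable f)
    (h : ∀ x v w, f (x, Function.update v t w) = f (x, v)) :
    IndepLaw (S.noiseLaw QV) f (fun u => u.2 t) (multivariateGaussian 0 (QV t)) := by
  refine IndepLaw.of_resample (r := fun p => (p.1.1, Function.update p.1.2 t p.2)) ?_ ?_ hf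
    (by fun_prop) (fun ω b => h _ _ _) (fun ω b => by simp)
  · exact Measurable.prodMk (by fun_prop) (measurable_update'.comp
      ((measurable_snd.comp measurable_fst).prodMk measurable_snd))
  · have h1 := (measurePreserving_prodAssoc S.law
      (Measure.pi fun t => multivariateGaussian 0 (QV t)) (multivariateGaussian 0 (QV t))).map_eq
    have h2 := map_update_pi (fun t => multivariateGaussian 0 (QV t)) t
    have hu : Measurable fun p : Path m p₁ p₂ × Vec p₁ p₂ => Function.update p.1 t p.2 :=
      measurable_update'
    have h3 := Measure.map_prod_map S.law ((Measure.pi fun t => multivariateGaussian 0 (QV t)).prod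
      (multivariateGaussian 0 (QV t))) measurable_id hu
    rw [h2, Measure.map_id, ← h1, Measure.map_map (by fun_prop)
      (MeasurableEquiv.measurable _)] at h3
    exact h3.symm

lemma indepLaw_increment (i : Fin m) :
    IndepLaw (S.noiseLaw QV) (fun u => (trunc (i + 1) u.1, u.2))
      (fun u => u.1 i.succ - toEuclideanLin (S.A i) (u.1 i.castSucc))
      (multivariateGaussian 0 (S.noiseCov i)) :=
  (S.isGaussMarkov_law.step i).prod_right _

lemma trunc_rep_update {k : ℕ} {t : Fin (m + 1)} (hk : k ≤ t) (x v : Path m p₁ p₂)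
    (w : Vec p₁ p₂) : trunc k (S.rep H (x, Function.update v t w)) = trunc k (S.rep H (x, v)) := by
  refine trunc_congr fun s hs => S.reproduction_congr H s (fun _ _ => rfl) fun r hr => ?_
  exact Function.update_of_ne (fun h => by subst h; omega) _ _

lemma rep_trunc {t : Fin (m + 1)} {k : ℕ} (hk : (t : ℕ) < k) (x v : Path m p₁ p₂) :
    S.rep H (trunc k x, v) t = S.rep H (x, v) t :=
  S.reproduction_congr H t (fun s hs => trunc_apply_of_lt x (by omega)) fun _ _ => rfl

lemma trunc_rep_trunc {k l : ℕ} (hk : k ≤ l) (x v : Path m p₁ p₂) :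
    trunc k (S.rep H (trunc l x, v)) = trunc k (S.rep H (x, v)) :=
  trunc_congr fun _ hs => S.rep_trunc H (lt_of_lt_of_le hs hk) x v

/-- The history including time `t` is a function of the earlier history and the innovation, which is
how independence is carried to the next time. -/
lemma trunc_succ_rep (t : Fin (m + 1)) (u : Path m p₁ p₂ × Path m p₁ p₂) :
    trunc (t + 1) (S.rep H u) = Function.update (trunc t (S.rep H u)) t
      (S.shift (trunc t (S.rep H u)) t + (S.rep H u t - S.shift (S.rep H u) t)) := by
  rw [trunc_succ, shift_trunc, add_sub_cancel]

variable {H QV} {G : Fin (m + 1) → Mat p₁ p₂ p₁ p₂}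

lemma predCov_zero : S.predCov G 0 = S.QX := rfl

lemma predCov_succ (i : Fin m) : S.predCov G i.succ =
    S.A i * G i.castSucc * (S.A i)ᵀ + S.noiseCov i := rfl

lemma predCov_posSemidef (hG : ∀ t, (G t).PosSemidef) (t : Fin (m + 1)) :
    (S.predCov G t).PosSemidef := by
  induction t using Fin.cases with
  | zero => exact S.posX
  | succ i =>
    exact (posSemidef_mul_mul_transpose (hG _) _).add (S.noiseCov_posSemidef i)

/-- `0 ⪯ Σ_t ⪯ Σ⁻_t` at all times. -/
structure IsReduction (G : Fin (m + 1) → Mat p₁ p₂ p₁ p₂) : Prop where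
  pos : ∀ t, (G t).PosSemidef
  le : ∀ t, (S.predCov G t - G t).PosSemidef

lemma IsErrorCov.isReduction {S : Source m p₁ p₂ q₁ q₂} {Δ₁ Δ₂ : ℝ} (hG : S.IsErrorCov Δ₁ Δ₂ G) :
    S.IsReduction G := ⟨hG.pos, hG.le⟩

section Channel

variable {S} (hG : S.IsReduction G) (hH : S.IsChannel G H QV)

include hG hH

/-- If the prediction error is independent of the past reproductions, then so is the pair of the
prediction error and the innovation. -/
lemma indepLaw_prediction_noise {t : Fin (m + 1)}
    (h : IndepLaw (S.noiseLaw QV) (fun u => trunc t (S.rep H u))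
      (fun u => u.1 t - S.shift (S.rep H u) t) (multivariateGaussian 0 (S.predCov G t))) :
    IndepLaw (S.noiseLaw QV) (fun u => trunc t (S.rep H u))
      (fun u => (u.1 t - S.shift (S.rep H u) t, u.2 t))
      ((multivariateGaussian 0 (S.predCov G t)).prod (multivariateGaussian 0
        (H t * S.predCov G t - H t * S.predCov G t * (H t)ᵀ))) := by
  rw [← hH.noise t]
  refine h.pair (S.indepLaw_noise QV t (by fun_prop) fun x v w => ?_)
  have := S.trunc_rep_update H le_rfl x v w (t := t)
  rw [this, ← S.shift_trunc, this, S.shift_trunc]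

/-- The prediction error is independent of the past reproductions. -/
lemma indepLaw_prediction (t : Fin (m + 1)) :
    IndepLaw (S.noiseLaw QV) (fun u => trunc t (S.rep H u))
      (fun u => u.1 t - S.shift (S.rep H u) t) (multivariateGaussian 0 (S.predCov G t)) := by
  induction t using Fin.induction with
  | zero =>
    have h0 : (S.noiseLaw QV).map (fun u => u.1 0) = multivariateGaussian 0 S.QX := by
      rw [← S.isGaussMarkov_law.init, noiseLaw]
      have : (fun u : Path m p₁ p₂ × Path m p₁ p₂ => u.1 0) = (fun x => x 0) ∘ Prod.fst := rfl
      rw [this, ← Measure.map_map (by fun_prop) measurable_fst, ← Measure.fst, Measure.fst_prod]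
    simp only [Fin.val_zero, trunc_zero, shift_zero, sub_zero]
    exact IndepLaw.const _ (by fun_prop) h0
  | succ i ih =>
    have h1 := (indepLaw_prediction_noise hG hH ih).comp_right (φ := fun p =>
      (toEuclideanLin (H i.castSucc) p.1 + p.2, p.1 - (toEuclideanLin (H i.castSucc) p.1 + p.2)))
      (by have := measurable_toEuclideanLin (H i.castSucc); fun_prop)
    -- The channel turns prediction error and noise into innovation and error, independent of each
    -- other and jointly of the past.
    rw [map_channel (hG.pos _) (hG.le _) (hH.gain _) (hH.gain_symm _)
      (by rw [← hH.noise]; exact hH.noise_pos _)] at h1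
    have hw : ∀ u, toEuclideanLin (H i.castSucc) (u.1 i.castSucc -
        S.shift (S.rep H u) i.castSucc) + u.2 i.castSucc =
        S.rep H u i.castSucc - S.shift (S.rep H u) i.castSucc := by
      intro u
      rw [eq_sub_iff_add_eq, add_comm]
      exact (S.reproduction_eq_shift_add H u.1 u.2 i.castSucc).symm
    simp only [hw] at h1
    -- Absorb the innovation into the past: the error becomes independent of the reproductions up to
    -- and including the present.
    have h2 := (h1.unpair (by fun_prop) (by fun_prop)).comp_left (φ := fun p =>
      Function.update p.1 i.castSucc (S.shift p.1 i.castSucc + p.2))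
      (measurable_update'.comp (by fun_prop : Measurable fun p : Path m p₁ p₂ × Vec p₁ p₂ =>
        (p.1, S.shift p.1 i.castSucc + p.2)))
    have h3 : IndepLaw (S.noiseLaw QV) (fun u => trunc (i.succ : ℕ) (S.rep H u))
        (fun u => u.1 i.castSucc - S.rep H u i.castSucc)
        (multivariateGaussian 0 (G i.castSucc)) := by
      convert h2 using 2 with u u
      · exact S.trunc_succ_rep H i.castSucc u
      · exact (sub_sub_sub_cancel_right _ _ _).symm
    -- The next source increment is independent of the past states and of all channel noises, hence
    -- of the past reproductions together with the error.
    have h4 := (S.indepLaw_increment QV i).comp_left (φ := fun u =>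
      (trunc (i.succ : ℕ) (S.rep H u), u.1 i.castSucc - S.rep H u i.castSucc)) (by fun_prop)
    have h5 : ∀ u : Path m p₁ p₂ × Path m p₁ p₂,
        (trunc (i.succ : ℕ) (S.rep H (trunc (i + 1) u.1, u.2)),
          trunc (i + 1) u.1 i.castSucc - S.rep H (trunc (i + 1) u.1, u.2) i.castSucc) =
        (trunc (i.succ : ℕ) (S.rep H u), u.1 i.castSucc - S.rep H u i.castSucc) := by
      intro u
      rw [S.trunc_rep_trunc H (by simp), trunc_apply_of_lt _ (by simp), S.rep_trunc H (by simp)]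
    simp only [h5] at h4
    -- The next prediction error is `A` applied to the error plus the increment, with covariance `A
    -- Σ Aᵀ + B Q_W Bᵀ`.
    have h6 := (h3.pair h4).comp_right (φ := fun p => toEuclideanLin (S.A i) p.1 +
      toEuclideanLin 1 p.2) (by
        have := measurable_toEuclideanLin (S.A i)
        have := measurable_toEuclideanLin (1 : Mat p₁ p₂ p₁ p₂)
        fun_prop)
    rw [map_add_multivariateGaussian (hG.pos _) (S.noiseCov_posSemidef i), Matrix.one_mul,
      transpose_one, Matrix.mul_one, ← S.predCov_succ] at h6
    convert h6 using 2 with u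
    rw [toLpLin_one, LinearMap.id_apply, map_sub, shift_succ]
    exact (sub_add_sub_cancel' _ _ _).symm

/-- The pair of the prediction error and the innovation is independent of the past
reproductions. -/
lemma indepLaw_stage (t : Fin (m + 1)) :
    IndepLaw (S.noiseLaw QV) (fun u => trunc t (S.rep H u))
      (fun u => (u.1 t - S.shift (S.rep H u) t, S.rep H u t - S.shift (S.rep H u) t))
      (estimateLaw (S.predCov G t) (G t)) := by
  have h1 := (indepLaw_prediction_noise hG hH (indepLaw_prediction hG hH t)).comp_right
    (φ := fun p =>
    (p.1, toEuclideanLin (H t) p.1 + p.2))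
    (by have := measurable_toEuclideanLin (H t); fun_prop)
  rw [map_channel_eq_estimateLaw (hG.pos _) (hG.le _) (hH.gain _) (hH.gain_symm _)
      (by rw [← hH.noise]; exact hH.noise_pos _)] at h1
  convert h1 using 3 with u
  rw [sub_eq_iff_eq_add, add_comm]
  exact S.reproduction_eq_shift_add H u.1 u.2 t

lemma indepLaw_innovation (t : Fin (m + 1)) :
    IndepLaw (S.noiseLaw QV) (fun u => trunc t (S.rep H u))
      (fun u => S.rep H u t - S.shift (S.rep H u) t)
      (multivariateGaussian 0 (S.predCov G t - G t)) := by
  have h := (indepLaw_stage hG hH t).comp_right measurable_snd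
  rwa [map_snd_estimateLaw] at h

/-- The error is independent of the reproductions up to the present. -/
lemma indepLaw_error (t : Fin (m + 1)) :
    IndepLaw (S.noiseLaw QV) (fun u => trunc (t + 1) (S.rep H u))
      (fun u => u.1 t - S.rep H u t) (multivariateGaussian 0 (G t)) := by
  have h1 := (indepLaw_stage hG hH t).comp_right (φ := fun p => (p.2, p.1 - p.2)) (by fun_prop)
  have h2 : (estimateLaw (S.predCov G t) (G t)).map (fun p => (p.2, p.1 - p.2)) =
      (multivariateGaussian 0 (S.predCov G t - G t)).prod (multivariateGaussian 0 (G t)) := by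
    rw [estimateLaw, Measure.map_map (by fun_prop) (by fun_prop)]
    convert Measure.map_id using 2
    ext p <;> simp
  rw [h2] at h1
  have h3 := (h1.unpair (by fun_prop) (by fun_prop)).comp_left (φ := fun p =>
      Function.update p.1 t (S.shift p.1 t + p.2))
      (measurable_update'.comp (by fun_prop : Measurable fun p : Path m p₁ p₂ × Vec p₁ p₂ =>
        (p.1, S.shift p.1 t + p.2)))
  convert h3 using 2 with u u
  · exact S.trunc_succ_rep H t u
  · exact (sub_sub_sub_cancel_right _ _ _).symm

end Channel

end Source

end Realization

/-! ### Conditional laws given an independent noise -/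

section NoiseKernel

variable {Ω Ω' α β γ : Type*} [MeasurableSpace Ω] [MeasurableSpace Ω'] [MeasurableSpace α]
  [MeasurableSpace β] [MeasurableSpace γ]

/-- The kernel `x ↦ law of F (x, v)` for `v` of law `N`. -/
noncomputable def noiseKernel (F : α × γ → β) (N : Measure γ) : Kernel α β :=
  (Kernel.id ×ₖ Kernel.const α N).map F

instance {F : α × γ → β} {N : Measure γ} [IsProbabilityMeasure N] :
    IsFiniteKernel (noiseKernel F N) := by
  unfold noiseKernel; infer_instance

lemma noiseKernel_apply {F : α × γ → β} (hF : Measurable F) (N : Measure γ)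
    [IsProbabilityMeasure N] (x : α) : noiseKernel F N x = N.map fun v => F (x, v) := by
  rw [noiseKernel, Kernel.map_apply _ hF, Kernel.prod_apply, Kernel.id_apply, Kernel.const_apply,
    Measure.dirac_prod, Measure.map_map hF (by fun_prop)]
  rfl

lemma isMarkovKernel_noiseKernel {F : α × γ → β} (hF : Measurable F) (N : Measure γ)
    [IsProbabilityMeasure N] : IsMarkovKernel (noiseKernel F N) := by
  unfold noiseKernel; exact Kernel.IsMarkovKernel.map _ hF

/-- Fubini for the independent pair `(Z, V)`: conditioning on `Z` freezes the first argument of `F`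
and leaves the law of `V` unchanged. -/
lemma map_eq_compProd_noiseKernel {ν : Measure Ω'} [IsProbabilityMeasure ν] {Z : Ω' → α}
    {V : Ω' → γ} {N : Measure γ} [IsProbabilityMeasure N] (h : IndepLaw ν Z V N)
    {F : α × γ → β} (hF : Measurable F) :
    ν.map (fun u => (Z u, F (Z u, V u))) = (ν.map Z).compProd (noiseKernel F N) := by
  have hZ := h.measurable_left
  have hV := h.measurable_right
  refine Measure.ext_of_lintegral _ fun f hf => ?_
  have h1 : ν.map (fun u => (Z u, F (Z u, V u))) =
      (ν.map (fun u => (Z u, V u))).map (fun p => (p.1, F p)) := by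
    rw [Measure.map_map (by fun_prop) (by fun_prop)]; rfl
  rw [h1, h.map_prod, lintegral_map hf (by fun_prop), lintegral_prod _ (by fun_prop),
    Measure.lintegral_compProd hf]
  refine lintegral_congr fun x => ?_
  rw [noiseKernel_apply hF, lintegral_map (by fun_prop) (by fun_prop)]

lemma condDistrib_eq_noiseKernel [StandardBorelSpace β] [Nonempty β] {ν : Measure Ω'}
    [IsProbabilityMeasure ν] {μ : Measure Ω} [IsFiniteMeasure μ] {r : Ω' → Ω} (hr : Measurable r)
    (hμ : μ = ν.map r) {X : Ω → α} (hX : Measurable X) {Y : Ω → β} (hY : Measurable Y) {V : Ω' → γ}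
    {N : Measure γ} [IsProbabilityMeasure N]
    (h : IndepLaw ν (fun u => X (r u)) V N) {F : α × γ → β} (hF : Measurable F)
    (hYF : ∀ u, Y (r u) = F (X (r u), V u)) :
    condDistrib Y X μ =ᵐ[μ.map X] noiseKernel F N := by
  refine condDistrib_ae_eq_of_measure_eq_compProd X hY.aemeasurable ?_
  rw [hμ, Measure.map_map (by fun_prop) hr, Measure.map_map hX hr]
  have h1 := map_eq_compProd_noiseKernel h hF
  simp only [← hYF] at h1
  exact h1

/-- Conditioning fixes the measurable part `a` and replaces the independent part `e` by its mean. -/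
lemma condExp_add_of_indepLaw {m' mΩ : MeasurableSpace Ω} {E : Type*}
    [NormedAddCommGroup E] [NormedSpace ℝ E] [CompleteSpace E]
    [MeasurableSpace E] [BorelSpace E] [SecondCountableTopology E] {μ : Measure Ω}
    [IsProbabilityMeasure μ] {f : Ω → α} {e a X : Ω → E} {ρ : Measure E} [IsProbabilityMeasure ρ]
    (h : IndepLaw μ f e ρ) (hm : m' ≤ MeasurableSpace.comap f inferInstance)
    (ha : StronglyMeasurable[m'] a) (hai : Integrable a μ) (hei : Integrable e μ)
    (he : ∫ ω, e ω ∂μ = 0) (hX : ∀ ω, X ω = a ω + e ω) : condExp m' μ X =ᵐ[μ] a := by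
  have hm0 : m' ≤ mΩ := hm.trans h.measurable_left.comap_le
  have hXa : X = a + e := funext hX
  have hind : Indep (MeasurableSpace.comap e inferInstance) m' μ :=
    indep_of_indep_of_le_right ((IndepFun_iff_Indep _ _ _).1 h.indepFun.symm) hm
  have h2 := condExp_indep_eq (μ := μ) h.measurable_right.comap_le hm0
    (comap_measurable e).stronglyMeasurable hind
  have h3 := condExp_add hai hei m'
  rw [hXa]
  filter_upwards [h2, h3] with ω h2 h3
  rw [h3, Pi.add_apply, h2, he, add_zero, condExp_of_stronglyMeasurable hm0 ha hai]

/-- If `Y` is a function of `X` and an independent noise, and `φ Y` depends on `X` only through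
`π X`, then `φ Y` has the same conditional law given `X` and given `π X`. -/
lemma condDistrib_comp_eq {α' δ : Type*} [MeasurableSpace α'] [MeasurableSpace δ]
    [StandardBorelSpace β] [Nonempty β] {P : Measure α} [IsProbabilityMeasure P] {N : Measure γ}
    [IsProbabilityMeasure N] {R : α × γ → δ} (hR : Measurable R) {φ : δ → β} (hφ : Measurable φ)
    {π : α → α'} (hπ : Measurable π) {F : α' × γ → β} (hF : Measurable F)
    (hFR : ∀ x v, F (π x, v) = φ (R (x, v))) :
    ∀ᵐ ω ∂((P.prod N).map fun u => (u.1, R u)),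
      condDistrib (fun ω => φ ω.2) (fun ω => ω.1) ((P.prod N).map fun u => (u.1, R u)) ω.1 =
      condDistrib (fun ω => φ ω.2) (fun ω => π ω.1) ((P.prod N).map fun u => (u.1, R u))
        (π ω.1) := by
  have hind : IndepLaw (P.prod N) (fun u => u.1) (fun u => u.2) N := indepLaw_fst_snd P N
  have hm : Measurable fun u => (u.1, R u) := by fun_prop
  have hF' : Measurable fun u => φ (R u) := by fun_prop
  have : IsProbabilityMeasure ((P.prod N).map fun u => (u.1, R u)) :=
    Measure.isProbabilityMeasure_map hm.aemeasurable
  have h1 := condDistrib_eq_noiseKernel hm rfl (X := fun ω => ω.1) measurable_fst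
    (Y := fun ω => φ ω.2) (hφ.comp measurable_snd) hind hF' fun u => rfl
  have h2 := condDistrib_eq_noiseKernel hm rfl (X := fun ω => π ω.1) (hπ.comp measurable_fst)
    (Y := fun ω => φ ω.2) (hφ.comp measurable_snd) (hind.comp_left hπ) hF
    fun u => (hFR _ _).symm
  filter_upwards [ae_of_ae_map measurable_fst.aemeasurable h1,
    ae_of_ae_map (f := fun ω : α × δ => π ω.1) (hπ.comp measurable_fst).aemeasurable h2]
    with ω h1 h2
  rw [h1, h2, noiseKernel_apply hF', noiseKernel_apply hF]
  simp_rw [hFR]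

end NoiseKernel

/-! ### Extension of partial paths -/

section Extend

variable {m p₁ p₂ : ℕ}

open Classical in
/-- Extension by zero of a family indexed by a set of times. -/
noncomputable def extendPath (s : Set (Fin (m + 1))) (y : s → Vec p₁ p₂) : Path m p₁ p₂ := fun t =>
  if h : t ∈ s then y ⟨t, h⟩ else 0

lemma extendPath_apply {s : Set (Fin (m + 1))} (y : s → Vec p₁ p₂) {t : Fin (m + 1)} (h : t ∈ s) :
    extendPath s y t = y ⟨t, h⟩ := dif_pos h

@[fun_prop]
lemma measurable_extendPath (s : Set (Fin (m + 1))) :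
    Measurable (extendPath s : (s → Vec p₁ p₂) → Path m p₁ p₂) := by
  refine measurable_pi_iff.2 fun t => ?_
  unfold extendPath
  split_ifs <;> fun_prop

end Extend

/-! ### Moments of variables with a given Gaussian law -/

section GaussianMoments

lemma integrable_of_map_eq {Ω : Type*} [MeasurableSpace Ω] {μ : Measure Ω} {ι : Type*} [Fintype ι]
    [DecidableEq ι] {e : Ω → EuclideanSpace ℝ ι} (he : Measurable e) {Q : Matrix ι ι ℝ}
    (h : μ.map e = multivariateGaussian 0 Q) : Integrable e μ ∧ ∫ ω, e ω ∂μ = 0 := by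
  have h1 := IsGaussian.integrable_id (μ := multivariateGaussian (0 : EuclideanSpace ℝ ι) Q)
  have h2 := integral_id_multivariateGaussian (μ := (0 : EuclideanSpace ℝ ι)) (S := Q)
  rw [← h] at h1 h2
  rw [integral_map he.aemeasurable (by fun_prop)] at h2
  exact ⟨(integrable_map_measure (by fun_prop) he.aemeasurable).1 h1, h2⟩

lemma integral_mul_of_map_eq {Ω : Type*} [MeasurableSpace Ω] {μ : Measure Ω} {ι : Type*} [Fintype ι]
    [DecidableEq ι] {e : Ω → EuclideanSpace ℝ ι} (he : Measurable e) {Q : Matrix ι ι ℝ}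
    (hQ : Q.PosSemidef) (h : μ.map e = multivariateGaussian 0 Q) (i j : ι) :
    Integrable (fun ω => e ω i * e ω j) μ ∧ ∫ ω, e ω i * e ω j ∂μ = Q i j := by
  have h1 := integrable_mul_multivariateGaussian Q i j
  have h2 := integral_mul_multivariateGaussian hQ i j
  rw [← h] at h1 h2
  rw [integral_map he.aemeasurable (by fun_prop)] at h2
  exact ⟨(integrable_map_measure (by fun_prop) he.aemeasurable).1 h1, h2⟩

end GaussianMoments

/-! ### Properties of the realization -/

section RealizationLaw

open Matrix

variable {m p₁ p₂ q₁ q₂ : ℕ} {S : Source m p₁ p₂ q₁ q₂}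

lemma IsGaussMarkov.memLp {A : Fin m → Mat p₁ p₂ p₁ p₂} {Q₀ : Mat p₁ p₂ p₁ p₂}
    {Q : Fin m → Mat p₁ p₂ p₁ p₂} {P : Measure (Path m p₁ p₂)} [IsProbabilityMeasure P]
    (h : IsGaussMarkov A Q₀ Q P) (t : Fin (m + 1)) : MemLp (fun x => x t) 2 P := by
  have key : ∀ {Q : Mat p₁ p₂ p₁ p₂} {g : Path m p₁ p₂ → Vec p₁ p₂}, Measurable g →
      P.map g = multivariateGaussian 0 Q → MemLp g 2 P := by
    intro Q g hg hgQ
    have h1 := IsGaussian.memLp_two_id (μ := multivariateGaussian (0 : Vec p₁ p₂) Q)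
    rw [← hgQ, memLp_map_measure_iff (by fun_prop) hg.aemeasurable] at h1
    exact h1
  induction t using Fin.induction with
  | zero => exact key (by fun_prop) h.init
  | succ i ih =>
    have h1 := key (h.step i).measurable_right (h.step i).map_right
    have h2 := ih.continuousLinearMap_comp (LinearMap.toContinuousLinearMap (toEuclideanLin (A i)))
    refine (h1.add h2).congr_norm (measurable_pi_apply _).aestronglyMeasurable
        (Filter.Eventually.of_forall fun x => ?_)
    simp

namespace Source

variable {G H QV : Fin (m + 1) → Mat p₁ p₂ p₁ p₂}

lemma measurable_pairRep : Measurable fun u : Path m p₁ p₂ × Path m p₁ p₂ => (u.1, S.rep H u) := by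
  fun_prop

lemma map_fst_jointLaw : (S.jointLaw H QV).map Prod.fst = S.law := by
  rw [jointLaw_eq, Measure.map_map measurable_fst measurable_pairRep]
  exact Measure.fst_prod

lemma memLp_jointLaw (t : Fin (m + 1)) : MemLp (fun ω => ω.1 t) 2 (S.jointLaw H QV) := by
  have h := S.isGaussMarkov_law.memLp t
  rw [← map_fst_jointLaw (H := H) (QV := QV),
    memLp_map_measure_iff (g := fun x : Path m p₁ p₂ => x t)
      (measurable_pi_apply _).aestronglyMeasurable
      measurable_fst.aemeasurable] at h
  exact h

/-- Connects the σ-algebra of `Y^t` with truncated paths: indices `s ≤ t` are the entries kept by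
`trunc (t + 1)`. -/
lemma comap_sigmaY_le (t : Fin (m + 1)) :
    (sigmaY t : MeasurableSpace (Path m p₁ p₂ × Path m p₁ p₂)) ≤
    MeasurableSpace.comap (fun ω => trunc (t + 1) ω.2) inferInstance := by
  have : (fun (ω : Path m p₁ p₂ × Path m p₁ p₂) (s : Set.Iic t) => ω.2 s) =
      (fun y (s : Set.Iic t) => y s) ∘ fun ω => trunc (t + 1) ω.2 := by
    ext ω s : 2
    have hs := s.2
    exact (trunc_apply_of_lt _ (Nat.lt_succ_of_le hs)).symm
  rw [sigmaY, this, ← MeasurableSpace.comap_comp]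
  exact MeasurableSpace.comap_mono (Measurable.comap_le (by fun_prop))

lemma measurable_sigmaY {s t : Fin (m + 1)} (h : s ≤ t) :
    Measurable[sigmaY t] fun ω : Path m p₁ p₂ × Path m p₁ p₂ => ω.2 s :=
  (measurable_pi_apply (⟨s, h⟩ : Set.Iic t)).comp
    (comap_measurable fun (ω : Path m p₁ p₂ × Path m p₁ p₂) (r : Set.Iic t) => ω.2 r)

section Channel

variable (hG : S.IsReduction G) (hH : S.IsChannel G H QV)

include hG hH

lemma indepLaw_error_jointLaw (t : Fin (m + 1)) :
    IndepLaw (S.jointLaw H QV) (fun ω => trunc (t + 1) ω.2) (fun ω => ω.1 t - ω.2 t)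
      (multivariateGaussian 0 (G t)) :=
  (IndepLaw.map_iff (μ := S.jointLaw H QV)
    (f := fun ω : Path m p₁ p₂ × Path m p₁ p₂ => trunc (t + 1) ω.2)
    (g := fun ω => ω.1 t - ω.2 t) measurable_pairRep rfl (by fun_prop) (by fun_prop)).2
    (indepLaw_error hG hH t)

lemma indepLaw_prediction_jointLaw (t : Fin (m + 1)) :
    IndepLaw (S.jointLaw H QV) (fun ω => trunc t ω.2) (fun ω => ω.1 t - S.shift ω.2 t)
      (multivariateGaussian 0 (S.predCov G t)) :=
  (IndepLaw.map_iff (μ := S.jointLaw H QV) (f := fun ω : Path m p₁ p₂ × Path m p₁ p₂ => trunc t ω.2)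
    (g := fun ω => ω.1 t - S.shift ω.2 t) measurable_pairRep rfl (by fun_prop) (by fun_prop)).2
    (indepLaw_prediction hG hH t)

/-- `X_t` is `Y_t` plus a centred error independent of `Y^t`. -/
lemma estimate_jointLaw (t : Fin (m + 1)) :
    estimate (S.jointLaw H QV) t t =ᵐ[S.jointLaw H QV] fun ω => ω.2 t := by
  have h := indepLaw_error_jointLaw hG hH t
  obtain ⟨hi, h0⟩ := integrable_of_map_eq h.measurable_right h.map_right
  refine condExp_add_of_indepLaw h (comap_sigmaY_le t) (measurable_sigmaY le_rfl).stronglyMeasurable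
    ?_ hi h0 fun ω => by simp
  exact (((memLp_jointLaw (S := S) (H := H) (QV := QV) t).integrable one_le_two).sub hi).congr
    (ae_of_all _ fun ω => sub_sub_cancel _ _)

/-- `X_{t+1}` is `A Y_t` plus the prediction error, which is centred and independent of `Y^t`. -/
lemma estimate_pred_jointLaw (i : Fin m) :
    estimate (S.jointLaw H QV) i.succ i.castSucc =ᵐ[S.jointLaw H QV]
      fun ω => S.shift ω.2 i.succ := by
  have h := indepLaw_prediction_jointLaw hG hH i.succ
  obtain ⟨hi, h0⟩ := integrable_of_map_eq h.measurable_right h.map_right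
  refine condExp_add_of_indepLaw h (comap_sigmaY_le i.castSucc) ?_ ?_ hi h0 fun ω => by simp
  · exact ((measurable_toEuclideanLin (S.A i)).comp
      (measurable_sigmaY (le_refl i.castSucc))).stronglyMeasurable
  · exact (((memLp_jointLaw (S := S) (H := H) (QV := QV) i.succ).integrable one_le_two).sub
      hi).congr (ae_of_all _ fun ω => sub_sub_cancel _ _)

lemma errorCov_jointLaw (t : Fin (m + 1)) : errorCov (S.jointLaw H QV) t t = G t := by
  have h := indepLaw_error_jointLaw hG hH t
  ext i j
  rw [errorCov, of_apply,
    ← (integral_mul_of_map_eq h.measurable_right (hG.pos t) h.map_right i j).2]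
  refine integral_congr_ae ?_
  filter_upwards [estimate_jointLaw hG hH t] with ω hω
  rw [hω]; rfl

lemma errorCov_pred_jointLaw (i : Fin m) :
    errorCov (S.jointLaw H QV) i.succ i.castSucc = S.predCov G i.succ := by
  have h := indepLaw_prediction_jointLaw hG hH i.succ
  ext a b
  rw [errorCov, of_apply, ← (integral_mul_of_map_eq h.measurable_right
    (S.predCov_posSemidef hG.pos _) h.map_right a b).2]
  refine integral_congr_ae ?_
  filter_upwards [estimate_pred_jointLaw hG hH i] with ω hω
  rw [hω]; rfl

omit hG hH in
-- The reproductions up to a time are a function of the states up to that time and of noises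
-- independent of the whole source path, so conditioning on later states changes nothing.
lemma isCausal_jointLaw : IsCausal (S.jointLaw H QV) := by
  intro t
  have hR : Measurable fun p : (Set.Iic t.castSucc → Vec p₁ p₂) × Path m p₁ p₂ =>
      S.reproduction H (extendPath _ p.1) p.2 :=
    Measurable.comp (g := S.rep H)
      (f := fun p : (Set.Iic t.castSucc → Vec p₁ p₂) × Path m p₁ p₂ => (extendPath _ p.1, p.2))
      (S.measurable_rep H) (((measurable_extendPath _).comp measurable_fst).prodMk measurable_snd)
  have hr : Measurable fun (y : Path m p₁ p₂) (s : Set.Iic t.castSucc) => y s :=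
    measurable_pi_iff.2 fun s => measurable_pi_apply _
  have hF : Measurable fun (p : (Set.Iic t.castSucc → Vec p₁ p₂) × Path m p₁ p₂)
      (s : Set.Iic t.castSucc) => S.reproduction H (extendPath _ p.1) p.2 s := hr.comp hR
  have hFR : ∀ x v : Path m p₁ p₂, (fun s : Set.Iic t.castSucc =>
      S.reproduction H (extendPath (Set.Iic t.castSucc) fun s => x s) v s) =
      fun s : Set.Iic t.castSucc => S.reproduction H x v s := by
    intro x v
    ext s : 1
    refine S.reproduction_congr H s (fun r hr => ?_) fun _ _ => rfl
    have h : r ∈ Set.Iic t.castSucc := Set.mem_Iic.2 (le_trans (Fin.le_def.2 hr) s.2)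
    exact extendPath_apply _ h
  exact condDistrib_comp_eq (P := S.law) (N := Measure.pi fun t => multivariateGaussian 0 (QV t))
    (S.measurable_reproduction H) hr hr hF hFR

omit hG hH in
-- `Y_t` is the stated mean plus `V_t`, and `V_t` is independent of `(X^t, Y^{t-1})`.
lemma hasGaussianTestChannel_jointLaw : S.HasGaussianTestChannel H QV (S.jointLaw H QV) := by
  intro t
  set F : ((Set.Iic t → Vec p₁ p₂) × (Set.Iio t → Vec p₁ p₂)) × Vec p₁ p₂ → Vec p₁ p₂ :=
    fun p => (toEuclideanLin (H t) (p.1.1 ⟨t, Set.self_mem_Iic⟩) +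
      toEuclideanLin (1 - H t) (S.shift (extendPath _ p.1.2) t)) + p.2 with hF
  have hFm : Measurable F := by
    have := measurable_toEuclideanLin (H t)
    have := measurable_toEuclideanLin (1 - H t)
    fun_prop
  have hshift : ∀ y : Path m p₁ p₂,
      S.shift (extendPath (Set.Iio t) fun s => y s) t = S.shift y t := fun y =>
    S.shift_congr t fun s hs => extendPath_apply _ (Fin.lt_def.2 hs)
  have hind := S.indepLaw_noise QV t (f := fun u =>
    ((fun s => u.1 s : Set.Iic t → Vec p₁ p₂), (fun s => S.rep H u s : Set.Iio t → Vec p₁ p₂)))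
    (by fun_prop) (by
      intro x v w
      ext s : 2
      · rfl
      · have h := congrFun (S.trunc_rep_update H le_rfl x v w (t := t)) s
        rwa [trunc_apply_of_lt _ s.2, trunc_apply_of_lt _ s.2] at h)
  have h := condDistrib_eq_noiseKernel (μ := S.jointLaw H QV) measurable_pairRep rfl
    (X := fun ω => ((fun s => ω.1 s : Set.Iic t → Vec p₁ p₂),
      (fun s => ω.2 s : Set.Iio t → Vec p₁ p₂))) (by fun_prop) (Y := fun ω => ω.2 t)
    (by fun_prop) hind hFm (fun u => by
      simp only [hF, hshift]
      exact S.reproduction_apply H u.1 u.2 t)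
  filter_upwards [ae_of_ae_map (by fun_prop) h] with ω hω
  rw [hω, noiseKernel_apply hFm]
  simp only [hF, hshift]
  exact (multivariateGaussian_eq_map_add _ _).symm

end Channel

/-- The mean squared error of each coordinate is a diagonal entry of `G t`, so the two distortions
are exactly the averaged block traces. -/
lemma isFeasible_jointLaw {Δ₁ Δ₂ : ℝ} (hG : S.IsErrorCov Δ₁ Δ₂ G) (hH : S.IsChannel G H QV) :
    IsFeasible S.law Δ₁ Δ₂ (S.jointLaw H QV) := by
  have hsq : ∀ t i, Integrable (fun ω => (ω.1 t i - ω.2 t i) ^ 2) (S.jointLaw H QV) ∧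
      ∫ ω, (ω.1 t i - ω.2 t i) ^ 2 ∂(S.jointLaw H QV) = G t i i := by
    intro t i
    have h := indepLaw_error_jointLaw hG.isReduction hH t
    have := integral_mul_of_map_eq h.measurable_right (hG.pos t) h.map_right i i
    simpa [pow_two] using this
  refine ⟨map_fst_jointLaw, isCausal_jointLaw, ?_, ?_, ?_, ?_⟩
  · exact (integrable_finsetSum _ fun t _ => integrable_finsetSum _ fun j _ =>
      (hsq t _).1).const_mul _
  · exact (integrable_finsetSum _ fun t _ => integrable_finsetSum _ fun j _ =>
      (hsq t _).1).const_mul _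
  · refine le_trans (le_of_eq ?_) hG.trace₁
    unfold distortion₁
    rw [integral_const_mul, integral_finsetSum _ fun t _ =>
      integrable_finsetSum _ fun j _ => (hsq t _).1]
    congr 1
    refine Finset.sum_congr rfl fun t _ => ?_
    rw [integral_finsetSum _ fun j _ => (hsq t _).1]
    exact Finset.sum_congr rfl fun j _ => (hsq t _).2
  · refine le_trans (le_of_eq ?_) hG.trace₂
    unfold distortion₂
    rw [integral_const_mul, integral_finsetSum _ fun t _ =>
      integrable_finsetSum _ fun j _ => (hsq t _).1]
    congr 1
    refine Finset.sum_congr rfl fun t _ => ?_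
    rw [integral_finsetSum _ fun j _ => (hsq t _).1]
    exact Finset.sum_congr rfl fun j _ => (hsq t _).2

lemma exists_isChannel (hG : S.IsReduction G) : ∃ H QV, S.IsChannel G H QV := by
  have h : ∀ t, ∃ H, H * S.predCov G t = S.predCov G t - G t ∧
      S.predCov G t - G t = S.predCov G t * Hᵀ ∧
      (H * S.predCov G t - H * S.predCov G t * Hᵀ).PosSemidef := fun t =>
    -- Applied with `D = Σ⁻ - Σ`, for which `Σ⁻ - D = Σ`.
    exists_gain (hG.le t) (by simpa using hG.pos t)
  choose H h1 h2 h3 using h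
  exact ⟨H, fun t => H t * S.predCov G t - H t * S.predCov G t * (H t)ᵀ, h1, h2,
    fun t => by rw [h1]; exact hG.le t, fun t => rfl, h3⟩

end Source

end RealizationLaw

/-! ### Divergence of images and compositions -/

section DivergenceMaps

variable {α β γ δ : Type*} [MeasurableSpace α] [MeasurableSpace β] [MeasurableSpace γ]
  [MeasurableSpace δ]

lemma klDiv_map_of_leftInverse (μ ν : Measure α) [IsFiniteMeasure μ] [IsFiniteMeasure ν]
    {f : α → β} {g : β → α} (hf : Measurable f) (hg : Measurable g)
    (h : Function.LeftInverse g f) : klDiv (μ.map f) (ν.map f) = klDiv μ ν := by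
  refine le_antisymm (klDiv_map_le _ _ hf) ?_
  have h1 := klDiv_map_le (μ.map f) (ν.map f) hg
  rwa [Measure.map_map hg hf, Measure.map_map hg hf, h.comp_eq_id, Measure.map_id,
    Measure.map_id] at h1

lemma klDiv_prod_left (μ ν : Measure α) [IsFiniteMeasure μ] [IsFiniteMeasure ν] (ρ : Measure β)
    [IsProbabilityMeasure ρ] : klDiv (ρ.prod μ) (ρ.prod ν) = klDiv μ ν := by
  rw [← klDiv_prod_right μ ν ρ, ← Measure.prod_swap (μ := μ) (ν := ρ),
    ← Measure.prod_swap (μ := ν) (ν := ρ)]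
  exact klDiv_map_of_leftInverse _ _ measurable_swap measurable_swap Prod.swap_leftInverse

/-- Conditional divergence does not increase when the conditioning variable is replaced by a
function of it through which both kernels factor. -/
lemma klDiv_compProd_comap_le [StandardBorelSpace α] [Nonempty α] (ρ : Measure α)
    [IsProbabilityMeasure ρ] {φ : α → β} (hφ : Measurable φ) (K L : Kernel β γ) [IsMarkovKernel K]
    [IsMarkovKernel L] :
    klDiv (ρ.compProd (K.comap φ hφ)) (ρ.compProd (L.comap φ hφ)) ≤
      klDiv ((ρ.map φ).compProd K) ((ρ.map φ).compProd L) := by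
  have := Measure.isProbabilityMeasure_map (μ := ρ) hφ.aemeasurable
  have hκ : (ρ.map φ).compProd (condDistrib id φ ρ) = ρ.map fun a => (φ a, a) :=
    compProd_map_condDistrib aemeasurable_id
  -- Starting from `φ a` and the output of the kernel, regenerate `a` from its conditional law given
  -- `φ a`. This last kernel is the same for `K` and `L`, so it adds no divergence.
  have key : ∀ (K : Kernel β γ) [IsMarkovKernel K],
      (((ρ.map φ).compProd K).compProd ((condDistrib id φ ρ).comap Prod.fst measurable_fst)).map
        (fun p => (p.2, p.1.2)) = ρ.compProd (K.comap φ hφ) := by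
    intro K _
    refine Measure.ext_of_lintegral _ fun f hf => ?_
    rw [lintegral_map hf (by fun_prop), Measure.lintegral_compProd (by fun_prop),
      Measure.lintegral_compProd (by fun_prop), Measure.lintegral_compProd hf]
    simp only [Kernel.comap_apply]
    have h1 : ∀ e, ∫⁻ w, ∫⁻ a, f (a, w) ∂(condDistrib id φ ρ e) ∂(K e) =
        ∫⁻ a, ∫⁻ w, f (a, w) ∂(K e) ∂(condDistrib id φ ρ e) := fun e =>
      lintegral_lintegral_swap (by fun_prop)
    have hm : Measurable fun p : β × α => ∫⁻ w, f (p.2, w) ∂(K p.1) :=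
      Measurable.lintegral_kernel_prod_right' (κ := K.comap Prod.fst measurable_fst)
        (f := fun q : (β × α) × γ => f (q.1.2, q.2)) (by fun_prop)
    simp only [h1]
    have h2 := Measure.lintegral_compProd (μ := ρ.map φ) (κ := condDistrib id φ ρ) hm
    rw [hκ, lintegral_map hm (by fun_prop)] at h2
    exact h2.symm
  rw [← key K, ← key L]
  refine (klDiv_map_le _ _ (by fun_prop)).trans (le_of_eq ?_)
  exact klDiv_compProd_left _ _ _

/-- If the fluctuations of `X` and `Y` around a function of `Z` are independent of `Z`, then the
conditional mutual information of `X` and `Y` is the mutual information of the fluctuations. -/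
lemma condMutualInfo_eq_of_indepLaw {Ω E : Type*} [MeasurableSpace Ω] [MeasurableSpace E]
    [AddGroup E] [MeasurableAdd₂ E] [MeasurableNeg E] [StandardBorelSpace E] [Nonempty E]
    {μ : Measure Ω} [IsProbabilityMeasure μ] {X Y : Ω → E} {Z : Ω → α} (hX : Measurable X)
    (hY : Measurable Y) {a : α → E} (ha : Measurable a) {ρ : Measure (E × E)}
    [IsProbabilityMeasure ρ]
    (h : IndepLaw μ Z (fun ω => (-a (Z ω) + X ω, -a (Z ω) + Y ω)) ρ) :
    condMutualInfo μ X Y Z = klDiv ρ ((ρ.map Prod.fst).prod (ρ.map Prod.snd)) := by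
  have hZ := h.measurable_left
  have := Measure.isProbabilityMeasure_map (μ := μ) hZ.aemeasurable
  have := Measure.isProbabilityMeasure_map (μ := ρ) measurable_fst.aemeasurable
  have := Measure.isProbabilityMeasure_map (μ := ρ) measurable_snd.aemeasurable
  have hF : Measurable fun p : α × E => a p.1 + p.2 := by fun_prop
  have hF₂ : Measurable fun p : α × E × E => (a p.1 + p.2.1, a p.1 + p.2.2) := by fun_prop
  have hΨ : Measurable fun p : α × E × E => (p.1, a p.1 + p.2.1, a p.1 + p.2.2) := by fun_prop
  have hΨ' : Measurable fun p : α × E × E => (p.1, -a p.1 + p.2.1, -a p.1 + p.2.2) :=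
    measurable_fst.prodMk ((by fun_prop : Measurable fun p : α × E × E => -a p.1 + p.2.1).prodMk
      (by fun_prop))
  have := isMarkovKernel_noiseKernel hF (ρ.map Prod.fst)
  have := isMarkovKernel_noiseKernel hF (ρ.map Prod.snd)
  have h1 := condDistrib_eq_noiseKernel measurable_id Measure.map_id.symm hZ hX
    (h.comp_right measurable_fst) hF (fun u => (add_neg_cancel_left (a (Z u)) (X u)).symm)
  have h2 := condDistrib_eq_noiseKernel measurable_id Measure.map_id.symm hZ hY
    (h.comp_right measurable_snd) hF (fun u => (add_neg_cancel_left (a (Z u)) (Y u)).symm)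
  -- The reference law of `condMutualInfo` has the same form as the joint law, with `ρ` replaced by
  -- the product of its marginals; an invertible shift by `a Z` then reduces both to products with
  -- the law of `Z`.
  have h3 : (condDistrib X Z μ).prod (condDistrib Y Z μ) =ᵐ[μ.map Z]
      noiseKernel (fun p : α × E × E => (a p.1 + p.2.1, a p.1 + p.2.2))
        ((ρ.map Prod.fst).prod (ρ.map Prod.snd)) := by
    filter_upwards [h1, h2] with z h1 h2
    rw [Kernel.prod_apply, h1, h2, noiseKernel_apply hF, noiseKernel_apply hF,
      noiseKernel_apply hF₂, Measure.map_prod_map _ _ (by fun_prop) (by fun_prop)]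
    rfl
  have h4 : (μ.map Z).compProd ((condDistrib X Z μ).prod (condDistrib Y Z μ)) =
      ((μ.map Z).prod ((ρ.map Prod.fst).prod (ρ.map Prod.snd))).map
        fun p => (p.1, a p.1 + p.2.1, a p.1 + p.2.2) := by
    rw [Measure.compProd_congr h3]
    have hfst : ((μ.map Z).prod ((ρ.map Prod.fst).prod (ρ.map Prod.snd))).map Prod.fst =
      μ.map Z := Measure.fst_prod
    have := map_eq_compProd_noiseKernel
      (indepLaw_fst_snd (μ.map Z) ((ρ.map Prod.fst).prod (ρ.map Prod.snd))) hF₂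
    rw [hfst] at this
    exact this.symm
  have h5 : μ.map (fun ω => (Z ω, X ω, Y ω)) =
      ((μ.map Z).prod ρ).map fun p => (p.1, a p.1 + p.2.1, a p.1 + p.2.2) := by
    rw [← h.map_prod, Measure.map_map hΨ (hZ.prodMk h.measurable_right)]
    congr 1
    ext ω : 1
    simp
  rw [condMutualInfo, h4, h5, klDiv_map_of_leftInverse _ _ hΨ hΨ', klDiv_prod_left]
  intro p
  simp

lemma map_snd_prod_map {Ω : Type*} [MeasurableSpace Ω]
    {ν : Measure Ω} [IsProbabilityMeasure ν] {P : Measure α} [IsProbabilityMeasure P] {f : Ω → β}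
    (hf : Measurable f) : (ν.prod P).map (fun p => (p.2, f p.1)) = P.prod (ν.map f) := by
  have h := Measure.map_prod_map P ν measurable_id hf
  rw [Measure.map_id] at h
  rw [h, ← Measure.prod_swap (μ := ν) (ν := P), Measure.map_map (by fun_prop) measurable_swap]
  rfl

end DivergenceMaps

/-! ### Information rates of the realization -/

section Rates

open Matrix

variable {m p₁ p₂ q₁ q₂ : ℕ} {S : Source m p₁ p₂ q₁ q₂}
  {G H QV : Fin (m + 1) → Mat p₁ p₂ p₁ p₂}

namespace Source

section Channel

variable (hG : S.IsReduction G) (hH : S.IsChannel G H QV)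

include hG hH

lemma indepLaw_stage_jointLaw (t : Fin (m + 1)) :
    IndepLaw (S.jointLaw H QV) (fun ω => trunc t ω.2)
      (fun ω => (ω.1 t - S.shift ω.2 t, ω.2 t - S.shift ω.2 t))
      (estimateLaw (S.predCov G t) (G t)) :=
  (IndepLaw.map_iff (μ := S.jointLaw H QV) (f := fun ω : Path m p₁ p₂ × Path m p₁ p₂ => trunc t ω.2)
    (g := fun ω => (ω.1 t - S.shift ω.2 t, ω.2 t - S.shift ω.2 t)) measurable_pairRep rfl
    (by fun_prop) (by fun_prop)).2 (indepLaw_stage hG hH t)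

lemma klDiv_stage (t : Fin (m + 1)) :
    klDiv (estimateLaw (S.predCov G t) (G t)) (((estimateLaw (S.predCov G t) (G t)).map
      Prod.fst).prod ((estimateLaw (S.predCov G t) (G t)).map Prod.snd)) =
      gaussRate (S.predCov G t) (G t) := by
  rw [map_fst_estimateLaw (hG.pos t) (hG.le t), map_snd_estimateLaw,
    klDiv_estimateLaw (hG.pos t) (hG.le t)]

/-- Subtracting `A Y_{t-1}` from `X_t` and `Y_t` leaves a pair with law `estimateLaw`, independent
of `Y_{t-1}`. -/
theorem stageInfo_jointLaw (t : Fin (m + 1)) :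
    stageInfo (S.jointLaw H QV) t = gaussRate (S.predCov G t) (G t) := by
  rw [← klDiv_stage hG hH t]
  have hind := indepLaw_stage_jointLaw hG hH t
  induction t using Fin.cases with
  | zero =>
    have h := hind.map_right
    simp only [shift_zero, sub_zero] at h
    have h1 : (S.jointLaw H QV).map (fun ω => ω.1 0) =
        (estimateLaw (S.predCov G 0) (G 0)).map Prod.fst := by
      rw [← h, Measure.map_map (by fun_prop) (by fun_prop)]; rfl
    have h2 : (S.jointLaw H QV).map (fun ω => ω.2 0) =
        (estimateLaw (S.predCov G 0) (G 0)).map Prod.snd := by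
      rw [← h, Measure.map_map (by fun_prop) (by fun_prop)]; rfl
    change mutualInfo _ _ _ = _
    rw [mutualInfo, h1, h2, h]
  | succ i =>
    have hA := measurable_toEuclideanLin (S.A i)
    have h := hind.comp_left (φ := fun y => y i.castSucc) (by fun_prop)
    refine condMutualInfo_eq_of_indepLaw (a := toEuclideanLin (S.A i)) (by fun_prop) (by fun_prop)
      hA ?_
    convert h using 2 with ω ω
    · exact (trunc_apply_of_lt _ (by simp)).symm
    · rw [neg_add_eq_sub, neg_add_eq_sub, shift_succ]

/-- Chain rule, one reproduction at a time. The innovation has conditional law `N(H_t e, QV_t)`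
given the source path and the past reproductions, with `e` the prediction error; under the product
law it is an independent `N(0, Σ⁻_t - Σ_t)`. At the start the history is constant and the divergence
vanishes. -/
lemma klDiv_path_le (k : ℕ) (hk : k ≤ m + 1) :
    klDiv ((S.noiseLaw QV).map fun u => (u.1, trunc k (S.rep H u)))
      (S.law.prod ((S.noiseLaw QV).map fun u => trunc k (S.rep H u))) ≤
      ∑ s ∈ Finset.range k,
        gaussRate (S.predCov G (Fin.ofNat (m + 1) s)) (G (Fin.ofNat (m + 1) s)) := by
  induction k with
  | zero =>
    have h1 : (S.noiseLaw QV).map Prod.fst = S.law := Measure.fst_prod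
    have h2 : (S.noiseLaw QV).map (fun u => (u.1, (0 : Path m p₁ p₂))) =
        S.law.prod (Measure.dirac 0) := by
      rw [Measure.prod_dirac, ← h1, Measure.map_map (by fun_prop) measurable_fst]
      rfl
    simp only [trunc_zero]
    rw [Measure.map_const, measure_univ, one_smul, h2, klDiv_self]
    exact zero_le
  | succ k ih =>
    obtain ⟨t, rfl⟩ : ∃ t : Fin (m + 1), (t : ℕ) = k := ⟨⟨k, hk⟩, rfl⟩
    rw [Finset.sum_range_succ, show Fin.ofNat (m + 1) t = t from Fin.ofNat_val_eq_self t]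
    set ν := S.noiseLaw QV with hν
    set T := S.predCov G t with hT
    set U : (Path m p₁ p₂ × Path m p₁ p₂) × Vec p₁ p₂ → Path m p₁ p₂ × Path m p₁ p₂ := fun p =>
      (p.1.1, Function.update p.1.2 t (S.shift p.1.2 t + p.2)) with hU
    have hUm : Measurable U := (by fun_prop : Measurable fun p :
      (Path m p₁ p₂ × Path m p₁ p₂) × Vec p₁ p₂ => p.1.1).prodMk
        (measurable_update'.comp (by fun_prop : Measurable fun p :
          (Path m p₁ p₂ × Path m p₁ p₂) × Vec p₁ p₂ => (p.1.2, S.shift p.1.2 t + p.2)))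
    have hHt := measurable_toEuclideanLin (H t)
    set φ : Path m p₁ p₂ × Path m p₁ p₂ → Vec p₁ p₂ := fun p => p.1 t - S.shift p.2 t with hφd
    have hφ : Measurable φ := by fun_prop
    have hF : Measurable fun p : Vec p₁ p₂ × Vec p₁ p₂ => toEuclideanLin (H t) p.1 + p.2 := by
      fun_prop
    set K : Kernel (Vec p₁ p₂) (Vec p₁ p₂) := noiseKernel
      (fun p => toEuclideanLin (H t) p.1 + p.2) (multivariateGaussian 0 (QV t)) with hK
    have hKm : IsMarkovKernel K := isMarkovKernel_noiseKernel hF _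
    set L : Kernel (Vec p₁ p₂) (Vec p₁ p₂) :=
      Kernel.const _ (multivariateGaussian 0 (T - G t)) with hL
    set Λ := ν.map (fun u => (u.1, trunc t (S.rep H u))) with hΛ
    have hΛp : IsProbabilityMeasure Λ := Measure.isProbabilityMeasure_map (by fun_prop)
    have hMp : IsProbabilityMeasure (ν.map fun u => trunc t (S.rep H u)) :=
      Measure.isProbabilityMeasure_map (by fun_prop)
    -- Under the joint law the innovation kernel sees the source and the past only through the
    -- prediction error `φ`.
    have h1 : ν.map (fun u => (u.1, trunc ((t : ℕ) + 1) (S.rep H u))) =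
        (Λ.compProd (K.comap φ hφ)).map U := by
      have hind := S.indepLaw_noise QV t (f := fun u => (u.1, trunc t (S.rep H u)))
        (by fun_prop) fun x v w => by rw [S.trunc_rep_update H le_rfl]
      have h := map_eq_compProd_noiseKernel hind
        (F := fun p => toEuclideanLin (H t) (φ p.1) + p.2) (by fun_prop)
      have hKK : noiseKernel (fun p : (Path m p₁ p₂ × Path m p₁ p₂) × Vec p₁ p₂ =>
          toEuclideanLin (H t) (φ p.1) + p.2) (multivariateGaussian 0 (QV t)) =
          K.comap φ hφ := by
        ext1 x
        rw [Kernel.comap_apply, hK, noiseKernel_apply hF, noiseKernel_apply (by fun_prop)]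
      rw [hΛ, ← hKK, ← h, Measure.map_map hUm (by fun_prop)]
      congr 1
      ext u : 1
      simp only [hU, Function.comp_apply, hφd]
      rw [trunc_succ, shift_trunc, ← reproduction_eq_shift_add]
    -- Under the product law the innovation is independent of the past reproductions, so its kernel
    -- is constant.
    have h2 : S.law.prod (ν.map fun u => trunc ((t : ℕ) + 1) (S.rep H u)) =
        ((S.law.prod (ν.map fun u => trunc t (S.rep H u))).compProd (L.comap φ hφ)).map U := by
      have hind := ((indepLaw_innovation hG hH t).prod_right S.law).comp_left measurable_swap
      have h := hind.map_prod
      have hLL : L.comap φ hφ = Kernel.const _ (multivariateGaussian 0 (T - G t)) := by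
        ext1 x; rfl
      rw [hLL, Measure.compProd_const, ← map_snd_prod_map (ν := ν) (P := S.law) (by fun_prop),
        ← map_snd_prod_map (ν := ν) (P := S.law) (by fun_prop)]
      erw [← h]
      rw [Measure.map_map hUm (by fun_prop)]
      congr 1
      ext u : 1
      simp only [hU, Function.comp_apply, Prod.swap]
      rw [← S.trunc_succ_rep]
    rw [h1, h2]
    refine (klDiv_map_le _ _ hUm).trans ?_
    rw [klDiv_compProd_eq_add]
    -- Both kernels factor through `φ`, whose law is `N(0, Σ⁻_t)`, so the conditional divergence
    -- reduces to that of one Gaussian stage.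
    refine add_le_add (ih (by omega)) ((klDiv_compProd_comap_le Λ hφ K L).trans (le_of_eq ?_))
    have h3 : Λ.map φ = multivariateGaussian 0 T := by
      rw [hΛ, Measure.map_map hφ (by fun_prop), ← (indepLaw_prediction hG hH t).map_right]
      congr 1
      ext u : 1
      simp only [Function.comp_apply, hφd, shift_trunc]
    have h4 : (multivariateGaussian 0 T).compProd K = estimateLaw T (G t) := by
      rw [← map_channel_eq_estimateLaw (hG.pos t) (hG.le t) (hH.gain t) (hH.gain_symm t)
        (by rw [← hH.noise]; exact hH.noise_pos t), ← hH.noise]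
      have hfst : ((multivariateGaussian 0 T).prod (multivariateGaussian 0 (QV t))).map Prod.fst =
        multivariateGaussian 0 T := Measure.fst_prod
      have h := map_eq_compProd_noiseKernel
        (indepLaw_fst_snd (multivariateGaussian 0 T) (multivariateGaussian 0 (QV t))) hF
      rw [hfst] at h
      exact h.symm
    rw [h3, h4, hL, Measure.compProd_const, klDiv_estimateLaw (hG.pos t) (hG.le t)]

theorem mutualInfo_jointLaw_le :
    mutualInfo (S.jointLaw H QV) Prod.fst Prod.snd ≤ ∑ t, gaussRate (S.predCov G t) (G t) := by
  have h := klDiv_path_le hG hH (m + 1) le_rfl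
  simp only [trunc_of_le le_rfl] at h
  rw [Finset.sum_range] at h
  simp only [Fin.ofNat_val_eq_self] at h
  refine le_of_eq_of_le ?_ h
  have h1 : (S.jointLaw H QV).map Prod.snd = (S.noiseLaw QV).map (S.rep H) := by
    rw [jointLaw_eq, Measure.map_map measurable_snd measurable_pairRep]; rfl
  rw [mutualInfo, map_fst_jointLaw, h1, ← jointLaw_eq]
  congr 1
  exact Measure.map_id

end Channel

end Source

end Rates

/-! ### Second moments -/

section SecondMoment

open Matrix

variable {Ω Ω' ι κ : Type*} [MeasurableSpace Ω] [MeasurableSpace Ω'] [Fintype ι] [DecidableEq ι]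
  [Fintype κ] [DecidableEq κ] {μ : Measure Ω}

/-- The random vector `ξ` is square integrable and `E[ξ ξᵀ] = M`. -/
structure HasSecondMoment (μ : Measure Ω) (ξ : Ω → EuclideanSpace ℝ ι) (M : Matrix ι ι ℝ) :
    Prop where
  memLp : ∀ i, MemLp (fun ω => ξ ω i) 2 μ
  integral_mul : ∀ i j, ∫ ω, ξ ω i * ξ ω j ∂μ = M i j

lemma toEuclideanLin_eq_sum (A : Matrix κ ι ℝ) (x : EuclideanSpace ℝ ι) (a : κ) :
    toEuclideanLin A x a = ∑ b, A a b * x b := by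
  simp [toLpLin_apply, mulVec, dotProduct]

namespace HasSecondMoment

variable {ξ : Ω → EuclideanSpace ℝ ι} {M : Matrix ι ι ℝ}

lemma of_memLp {ξ : Ω → EuclideanSpace ℝ ι} (h : ∀ i, MemLp (fun ω => ξ ω i) 2 μ) :
    HasSecondMoment μ ξ (of fun i j => ∫ ω, ξ ω i * ξ ω j ∂μ) := ⟨h, fun _ _ => rfl⟩

lemma integrable_mul (h : HasSecondMoment μ ξ M) (i j : ι) :
    Integrable (fun ω => ξ ω i * ξ ω j) μ := (h.memLp i).integrable_mul (h.memLp j)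

lemma of_map_eq (hξ : Measurable ξ) {Q : Matrix ι ι ℝ} (hQ : Q.PosSemidef)
    (h : μ.map ξ = multivariateGaussian 0 Q) : HasSecondMoment μ ξ Q := by
  refine ⟨fun i => ?_, fun i j => (integral_mul_of_map_eq hξ hQ h i j).2⟩
  have h1 := memLp_multivariateGaussian Q i
  rw [← h, memLp_map_measure_iff (g := fun x : EuclideanSpace ℝ ι => x i)
    (by fun_prop) hξ.aemeasurable] at h1
  exact h1

lemma toEuclideanLin (h : HasSecondMoment μ ξ M) (A : Matrix κ ι ℝ) :
    HasSecondMoment μ (fun ω => Matrix.toEuclideanLin A (ξ ω)) (A * M * Aᵀ) := by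
  refine ⟨fun a => ?_, fun a b => ?_⟩
  · simp only [toEuclideanLin_eq_sum]
    exact memLp_finsetSum _ fun c _ => (h.memLp c).const_mul _
  · simp only [toEuclideanLin_eq_sum, Finset.sum_mul_sum]
    have h1 : ∀ c d, Integrable (fun ω => A a c * ξ ω c * (A b d * ξ ω d)) μ := by
      intro c d
      refine ((h.integrable_mul c d).const_mul (A a c * A b d)).congr (ae_of_all _ fun ω => ?_)
      simp only
      ring
    rw [integral_finsetSum _ fun c _ => integrable_finsetSum _ fun d _ => h1 c d]
    simp only [Matrix.mul_apply, Finset.sum_mul, transpose_apply]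
    rw [Finset.sum_comm]
    refine Finset.sum_congr rfl fun c _ => ?_
    rw [integral_finsetSum _ fun d _ => h1 c d]
    refine Finset.sum_congr rfl fun d _ => ?_
    rw [← h.integral_mul c d, mul_right_comm, ← integral_const_mul]
    refine integral_congr_ae (ae_of_all _ fun ω => ?_)
    simp only
    ring

/-- `xᵀ M x` is the second moment of the scalar `xᵀ ξ`; in the proof `xᵀ` is a matrix with one row
indexed by `Unit`. -/
lemma posSemidef (h : HasSecondMoment μ ξ M) : M.PosSemidef := by
  refine PosSemidef.of_dotProduct_mulVec_nonneg ?_ fun x => ?_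
  · ext i j
    simp only [conjTranspose_apply, star_trivial, ← h.integral_mul]
    simp only [mul_comm]
  · have h1 := h.toEuclideanLin (of fun (_ : Unit) i => x i)
    have h2 := h1.integral_mul () ()
    have h3 : star x ⬝ᵥ M *ᵥ x = ((of fun (_ : Unit) i => x i) * M *
        (of fun (_ : Unit) i => x i)ᵀ) () () := by
      simp only [star_trivial, Matrix.mul_apply, transpose_apply, of_apply, dotProduct, mulVec,
        Finset.sum_mul, Finset.mul_sum]
      rw [Finset.sum_comm]
      exact Finset.sum_congr rfl fun _ _ => Finset.sum_congr rfl fun _ _ => by ring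
    rw [h3, ← h2]
    exact integral_nonneg fun ω => mul_self_nonneg _

lemma add_of_orthogonal {ζ : Ω → EuclideanSpace ℝ ι} {Q : Matrix ι ι ℝ}
    (h : HasSecondMoment μ ξ M) (h1 : HasSecondMoment μ ζ Q)
    (hc : ∀ i j, ∫ ω, ξ ω i * ζ ω j ∂μ = 0) :
    HasSecondMoment μ (fun ω => ξ ω + ζ ω) (M + Q) := by
  refine ⟨fun i => (h.memLp i).add (h1.memLp i), fun i j => ?_⟩
  have hci : ∀ i j, Integrable (fun ω => ξ ω i * ζ ω j) μ := fun i j =>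
    (h.memLp i).integrable_mul (h1.memLp j)
  have h4 : ∀ ω, (ξ ω + ζ ω) i * (ξ ω + ζ ω) j =
      ξ ω i * ξ ω j + ζ ω i * ζ ω j + (ξ ω i * ζ ω j + ξ ω j * ζ ω i) := by
    intro ω
    simp only [PiLp.add_apply]
    ring
  simp only [h4]
  rw [integral_add (f := fun ω => ξ ω i * ξ ω j + ζ ω i * ζ ω j)
      (g := fun ω => ξ ω i * ζ ω j + ξ ω j * ζ ω i)
      ((h.integrable_mul i j).add (h1.integrable_mul i j)) ((hci i j).add (hci j i)),
    integral_add (h.integrable_mul i j) (h1.integrable_mul i j), integral_add (hci i j) (hci j i),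
    hc, hc, h.integral_mul, h1.integral_mul, add_zero, add_zero, Matrix.add_apply]

/-- The cross moments vanish because `ζ` is centred and independent; `ξ` need not be centred. -/
lemma add_gaussian [IsProbabilityMeasure μ] {ζ : Ω → EuclideanSpace ℝ ι} {Q : Matrix ι ι ℝ}
    (hQ : Q.PosSemidef) (h : HasSecondMoment μ ξ M)
    (hi : IndepLaw μ ξ ζ (multivariateGaussian 0 Q)) :
    HasSecondMoment μ (fun ω => ξ ω + ζ ω) (M + Q) := by
  have hξ := hi.measurable_left
  have hζ := hi.measurable_right
  refine h.add_of_orthogonal (of_map_eq hζ hQ hi.map_right) fun i j => ?_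
  have h2 := integral_eval_multivariateGaussian Q j
  rw [← hi.map_right, integral_map hζ.aemeasurable (by fun_prop)] at h2
  rw [IndepFun.integral_fun_comp_mul_comp hi.indepFun hξ.aemeasurable hζ.aemeasurable
      (f := fun x => x i) (g := fun x => x j) (by fun_prop) (by fun_prop), h2, mul_zero]

lemma integral_gaussLog [IsProbabilityMeasure μ] (h : HasSecondMoment μ ξ M) (hM : M.PosDef) :
    Integrable (fun ω => gaussLog M (ξ ω)) μ ∧
      ∫ ω, gaussLog M (ξ ω) ∂μ =
        -(1 / 2) * (Fintype.card ι * Real.log (2 * Real.pi) + Real.log M.det + Fintype.card ι) :=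
  JointNRDF.integral_gaussLog hM h.integrable_mul h.integral_mul

lemma comp_fst (h : HasSecondMoment μ ξ M) (ν : Measure Ω') [IsProbabilityMeasure μ]
    [IsProbabilityMeasure ν] :
    HasSecondMoment (μ.prod ν) (fun p => ξ p.1) M := by
  refine ⟨fun i => (h.memLp i).comp_fst ν, fun i j => ?_⟩
  rw [← h.integral_mul i j]
  have := integral_fun_fst (μ := μ) (ν := ν) (fun ω => ξ ω i * ξ ω j)
  simpa using this

end HasSecondMoment

end SecondMoment

/-! ### Sums of independent Gauss-Markov paths -/

section Sums

open Matrix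

lemma IndepLaw.prod {Ω Ω' α α' β β' : Type*} [MeasurableSpace Ω] [MeasurableSpace Ω']
    [MeasurableSpace α] [MeasurableSpace α'] [MeasurableSpace β] [MeasurableSpace β']
    {μ : Measure Ω} [IsProbabilityMeasure μ] {μ' : Measure Ω'} [IsProbabilityMeasure μ']
    {f : Ω → α} {f' : Ω' → α'} {g : Ω → β} {g' : Ω' → β'} {ρ : Measure β} {ρ' : Measure β'}
    [IsProbabilityMeasure ρ] [IsProbabilityMeasure ρ'] (h : IndepLaw μ f g ρ)
    (h' : IndepLaw μ' f' g' ρ') :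
    IndepLaw (μ.prod μ') (fun p => (f p.1, f' p.2)) (fun p => (g p.1, g' p.2)) (ρ.prod ρ') := by
  have hf := h.measurable_left
  have hg := h.measurable_right
  have hf' := h'.measurable_left
  have hg' := h'.measurable_right
  have h1 := (h.prod_right μ').comp_left (φ := fun q => (q.1, f' q.2)) (by fun_prop)
  have h2 := (h'.prod_right μ).comp_left (φ := fun q => ((f q.2, q.1), g q.2)) (by fun_prop)
  have h3 := (IndepLaw.map_iff (μ := μ'.prod μ) (μ' := μ.prod μ') measurable_swap Measure.prod_swap
    h2.measurable_left h2.measurable_right).1 h2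
  exact h1.pair h3

variable {m p₁ p₂ q₁ q₂ : ℕ}

lemma trunc_add (k : ℕ) (x z : Path m p₁ p₂) : trunc k (x + z) = trunc k x + trunc k z := by
  ext s : 1
  simp only [trunc, Pi.add_apply]
  split_ifs <;> simp

/-- Equal transition matrices are what makes the increments of the two paths add up to the increment
of the sum. -/
lemma IsGaussMarkov.add {A : Fin m → Mat p₁ p₂ p₁ p₂} {Q₀ R₀ : Mat p₁ p₂ p₁ p₂}
    {Q R : Fin m → Mat p₁ p₂ p₁ p₂} {P P' : Measure (Path m p₁ p₂)} [IsProbabilityMeasure P]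
    [IsProbabilityMeasure P'] (hP : IsGaussMarkov A Q₀ Q P) (hP' : IsGaussMarkov A R₀ R P')
    (hQ₀ : Q₀.PosSemidef) (hR₀ : R₀.PosSemidef) (hQ : ∀ i, (Q i).PosSemidef)
    (hR : ∀ i, (R i).PosSemidef) :
    IsGaussMarkov A (Q₀ + R₀) (fun i => Q i + R i) ((P.prod P').map fun p => p.1 + p.2) := by
  have hadd : ∀ {Q R : Mat p₁ p₂ p₁ p₂}, Q.PosSemidef → R.PosSemidef →
      ((multivariateGaussian 0 Q).prod (multivariateGaussian 0 R)).map (fun p => p.1 + p.2) =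
        multivariateGaussian 0 (Q + R) := by
    intro Q R hQ hR
    have h := map_add_multivariateGaussian hQ hR (1 : Mat p₁ p₂ p₁ p₂) 1
    simpa only [toLpLin_one, LinearMap.id_apply, Matrix.one_mul, transpose_one,
      Matrix.mul_one] using h
  have hm : Measurable fun p : Path m p₁ p₂ × Path m p₁ p₂ => p.1 + p.2 := by fun_prop
  have := Measure.isProbabilityMeasure_map (μ := P.prod P') hm.aemeasurable
  refine ⟨?_, fun i => ?_⟩
  · rw [Measure.map_map (by fun_prop) hm, ← hadd hQ₀ hR₀, ← hP.init, ← hP'.init,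
      Measure.map_prod_map _ _ (by fun_prop) (by fun_prop), Measure.map_map (by fun_prop)
      (by fun_prop)]
    rfl
  · have hA := measurable_toEuclideanLin (A i)
    have h1 := (((hP.step i).prod (hP'.step i)).comp_left (φ := fun p => p.1 + p.2)
      (by fun_prop)).comp_right (φ := fun p => p.1 + p.2) (by fun_prop)
    rw [hadd (hQ i) (hR i)] at h1
    refine (IndepLaw.map_iff hm rfl (measurable_trunc _) (by fun_prop)).2 ?_
    convert h1 using 2 with p p
    · exact trunc_add _ _ _
    · simp only [Pi.add_apply, map_add]
      abel

/-- Under the law of a Gauss-Markov path, the likelihood ratios which replace the prediction of each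
state by a Gaussian law with a prescribed mean and covariance have total mass one. -/
lemma IsGaussMarkov.lintegral_prod_logRatio {A : Fin m → Mat p₁ p₂ p₁ p₂} {Q₀ : Mat p₁ p₂ p₁ p₂}
    {Q : Fin m → Mat p₁ p₂ p₁ p₂} {P : Measure (Path m p₁ p₂)} [IsProbabilityMeasure P]
    (hP : IsGaussMarkov A Q₀ Q P) (hQ : ∀ i, (Q i).PosSemidef)
    {T G : Fin (m + 1) → Mat p₁ p₂ p₁ p₂} (hT : ∀ t, (T t).PosDef) (hG : ∀ t, (G t).PosDef)
    (h0 : T 0 = Q₀) (hs : ∀ i : Fin m, T i.succ = A i * G i.castSucc * (A i)ᵀ + Q i)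
    {v w : Path m p₁ p₂} (hw0 : w 0 = 0)
    (hws : ∀ i : Fin m, w i.succ = toEuclideanLin (A i) (v i.castSucc)) :
    ∫⁻ x, ∏ t, ENNReal.ofReal (Real.exp (gaussLog (G t) (x t - v t) - gaussLog (T t) (x t - w t)))
      ∂P = 1 := by
  set g : Fin (m + 1) → Vec p₁ p₂ → ℝ≥0∞ := fun t x =>
    ENNReal.ofReal (Real.exp (gaussLog (G t) (x - v t) - gaussLog (T t) (x - w t))) with hg
  have hgm : ∀ t, Measurable (g t) := fun t => by fun_prop
  have hchange : ∀ t (h : Vec p₁ p₂ → ℝ≥0∞), Measurable h →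
      ∫⁻ x, g t x * h x ∂(multivariateGaussian (w t) (T t)) =
        ∫⁻ x, h x ∂(multivariateGaussian (v t) (G t)) := by
    intro t h hh
    rw [← multivariateGaussian_withDensity (w t) (v t) (hT t) (hG t),
      lintegral_withDensity_eq_lintegral_mul _ (hgm t) hh]
    rfl
  -- The filtering invariant: reweighted by the ratios up to time `t`, the state `x t` has law `N(v
  -- t, G t)`.
  have key : ∀ t : Fin (m + 1), ∀ h : Vec p₁ p₂ → ℝ≥0∞, Measurable h →
      ∫⁻ x, (∏ s with s ≤ t, g s (x s)) * h (x t) ∂P =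
        ∫⁻ x, h x ∂(multivariateGaussian (v t) (G t)) := by
    intro t
    induction t using Fin.induction with
    | zero =>
      intro h hh
      rw [← hchange 0 h hh, hw0, h0, ← hP.init, lintegral_map (by fun_prop) (by fun_prop)]
      refine lintegral_congr fun x => ?_
      congr 1
      rw [Finset.prod_filter, Finset.prod_eq_single 0]
      · simp
      · intro s _ hs
        rw [if_neg (by simpa using hs)]
      · simp
    | succ i ih =>
      intro h hh
      have hA := measurable_toEuclideanLin (A i)
      have hstep := (hP.step i).map_prod
      have hprod : ∀ x : Path m p₁ p₂, (∏ s with s ≤ i.succ, g s (x s)) =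
          (∏ s with s ≤ i.castSucc, g s (x s)) * g i.succ (x i.succ) := by
        intro x
        have : (Finset.univ.filter fun s : Fin (m + 1) => s ≤ i.succ) =
            insert i.succ (Finset.univ.filter fun s => s ≤ i.castSucc) := by
          ext s
          simp only [Finset.mem_filter, Finset.mem_univ, true_and, Finset.mem_insert, Fin.ext_iff,
            Fin.le_def, Fin.val_succ, Fin.val_castSucc]
          omega
        rw [this, Finset.prod_insert (by simp [Fin.le_def]), mul_comm]
      set F : Path m p₁ p₂ → ℝ≥0∞ := fun x => ∏ s with s ≤ i.castSucc, g s (x s) with hF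
      have hFm : Measurable F := by fun_prop
      have hFt : ∀ x, F (trunc (i + 1) x) = F x := by
        intro x
        refine Finset.prod_congr rfl fun s hs => ?_
        rw [trunc_apply_of_lt]
        have := (Finset.mem_filter.1 hs).2
        rw [Fin.le_def] at this
        simpa using Nat.lt_succ_of_le this
      have hxt : ∀ x : Path m p₁ p₂, trunc (i + 1) x i.castSucc = x i.castSucc := fun x =>
        trunc_apply_of_lt _ (by simp)
      set k : Vec p₁ p₂ → ℝ≥0∞ := fun x => g i.succ x * h x with hk
      have hkm : Measurable k := by fun_prop
      set L : Vec p₁ p₂ → ℝ≥0∞ := fun a =>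
        ∫⁻ n, k (toEuclideanLin (A i) a + n) ∂(multivariateGaussian 0 (Q i)) with hL
      have hLm : Measurable L := Measurable.lintegral_prod_right'
        (f := fun p : Vec p₁ p₂ × Vec p₁ p₂ =>
        k (toEuclideanLin (A i) p.1 + p.2)) (by fun_prop)
      -- Integrate out the last increment, which is independent of the history; what remains depends
      -- on the history through the earlier ratios and the current state.
      have h1 : ∫⁻ x, (∏ s with s ≤ i.succ, g s (x s)) * h (x i.succ) ∂P =
          ∫⁻ x, F x * L (x i.castSucc) ∂P := by
        have e1 := congrArg (fun τ => ∫⁻ p, F p.1 *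
          k (toEuclideanLin (A i) (p.1 i.castSucc) + p.2) ∂τ) hstep
        rw [lintegral_map (by fun_prop) (by fun_prop), lintegral_prod _ (by fun_prop),
          lintegral_map (by fun_prop) (by fun_prop)] at e1
        simp only [hxt, hFt, add_sub_cancel] at e1
        simp only [hprod, mul_assoc]
        refine e1.trans (lintegral_congr fun x => ?_)
        rw [lintegral_const_mul _ (by fun_prop)]
      rw [h1, ih L hLm, ← hchange _ h hh, hws, hs]
      -- Prediction step: the transition carries `N(v, G)` to `N(A v, A G Aᵀ + Q)`, the law in the
      -- denominator of the next ratio.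
      have h2 := map_add_multivariateGaussian (hG i.castSucc).posSemidef (hQ i) (A i)
        (1 : Mat p₁ p₂ p₁ p₂)
      rw [Matrix.one_mul, transpose_one, Matrix.mul_one] at h2
      rw [multivariateGaussian_eq_map_add (toEuclideanLin (A i) (v i.castSucc)), ← h2,
        multivariateGaussian_eq_map_add (v i.castSucc), lintegral_map hLm (by fun_prop),
        lintegral_map (by fun_prop) (by fun_prop), lintegral_map (by fun_prop) (by
          have := measurable_toEuclideanLin (1 : Mat p₁ p₂ p₁ p₂)
          fun_prop), lintegral_prod _ (by
          have := measurable_toEuclideanLin (1 : Mat p₁ p₂ p₁ p₂)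
          fun_prop)]
      refine lintegral_congr fun x => lintegral_congr fun n => ?_
      simp only [hk, map_add, toLpLin_one, LinearMap.id_apply, add_assoc]
  have h := key (Fin.last m) (fun _ => 1) measurable_const
  simpa [Fin.le_last] using h

end Sums

/-! ### A regularizing noise -/

section Regularization

open Matrix

variable {m p₁ p₂ q₁ q₂ : ℕ}

/-- Cauchy–Schwarz applied to each coordinate of `Aᵀ x`; the scalar is the squared Frobenius norm.
-/
lemma posSemidef_sum_sq_smul_one_sub {ι : Type*} [Fintype ι] [DecidableEq ι] (A : Matrix ι ι ℝ) :
    ((∑ i, ∑ j, A j i ^ 2) • (1 : Matrix ι ι ℝ) - A * Aᵀ).PosSemidef := by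
  refine PosSemidef.of_dotProduct_mulVec_nonneg ?_ fun x => ?_
  · refine IsHermitian.sub ?_ ?_
    · exact (isHermitian_one (n := ι)).smul (by simp [IsSelfAdjoint])
    · simp [IsHermitian, conjTranspose_eq_transpose_of_trivial]
  · have h1 : x ⬝ᵥ (A * Aᵀ) *ᵥ x = ∑ i, (∑ j, A j i * x j) ^ 2 := by
      rw [← mulVec_mulVec, dotProduct_mulVec, ← mulVec_transpose, dotProduct]
      refine Finset.sum_congr rfl fun i _ => ?_
      simp only [mulVec, dotProduct, transpose_apply, pow_two]
    rw [star_trivial, sub_mulVec, dotProduct_sub, smul_mulVec, one_mulVec, dotProduct_smul, h1,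
      smul_eq_mul, Finset.sum_mul, sub_nonneg]
    refine Finset.sum_le_sum fun i _ => ?_
    refine (Finset.sum_mul_sq_le_sq_mul_sq _ _ _).trans (le_of_eq ?_)
    simp only [dotProduct, pow_two]

/-- The marginal covariances of a Gauss–Markov path follow the Lyapunov recursion `hs`. -/
lemma IsGaussMarkov.map_apply {A : Fin m → Mat p₁ p₂ p₁ p₂} {Q₀ : Mat p₁ p₂ p₁ p₂}
    {Q : Fin m → Mat p₁ p₂ p₁ p₂} {P : Measure (Path m p₁ p₂)} [IsProbabilityMeasure P]
    (hP : IsGaussMarkov A Q₀ Q P) (hQ : ∀ i, (Q i).PosSemidef) {M : Fin (m + 1) → Mat p₁ p₂ p₁ p₂}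
    (hM : ∀ t, (M t).PosSemidef) (h0 : M 0 = Q₀)
    (hs : ∀ i : Fin m, M i.succ = A i * M i.castSucc * (A i)ᵀ + Q i) (t : Fin (m + 1)) :
    P.map (fun x => x t) = multivariateGaussian 0 (M t) := by
  induction t using Fin.induction with
  | zero => rw [h0]; exact hP.init
  | succ i ih =>
    have hA := measurable_toEuclideanLin (A i)
    have h1 := (hP.step i).comp_left (φ := fun x => x i.castSucc) (by fun_prop)
    have h2 : ∀ x : Path m p₁ p₂, trunc (i + 1) x i.castSucc = x i.castSucc := fun x =>
      trunc_apply_of_lt _ (by simp)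
    simp only [h2] at h1
    have h3 := congrArg (Measure.map fun p : Vec p₁ p₂ × Vec p₁ p₂ =>
      toEuclideanLin (A i) p.1 + toEuclideanLin (1 : Mat p₁ p₂ p₁ p₂) p.2) h1.map_prod
    have h1m := measurable_toEuclideanLin (1 : Mat p₁ p₂ p₁ p₂)
    rw [ih, map_add_multivariateGaussian (hM _) (hQ i), Matrix.one_mul, transpose_one,
      Matrix.mul_one, ← hs, Measure.map_map (by fun_prop) (by fun_prop)] at h3
    rw [← h3]
    congr 1
    ext x : 1
    simp only [Function.comp_apply, toLpLin_one, LinearMap.id_apply, add_sub_cancel]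

/-- There are Gauss-Markov noises with the transition matrices `A` and arbitrarily small scalar
covariances. -/
lemma exists_regularizing_noise (A : Fin m → Mat p₁ p₂ p₁ p₂) :
    ∃ c : ℝ, 0 < c ∧ ∀ ε : ℝ, 0 < ε → ∃ (P : Measure (Path m p₁ p₂))
      (R : Fin m → Mat p₁ p₂ p₁ p₂), IsProbabilityMeasure P ∧ IsGaussMarkov A (ε • 1) R P ∧
      (∀ i, (R i).PosSemidef) ∧
      (∀ i : Fin m, (ε * c ^ ((i : ℕ) + 1)) • (1 : Mat p₁ p₂ p₁ p₂) =
        A i * ((ε * c ^ (i : ℕ)) • 1) * (A i)ᵀ + R i) ∧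
      ∀ t : Fin (m + 1), P.map (fun x => x t) =
        multivariateGaussian 0 ((ε * c ^ (t : ℕ)) • 1) := by
  set b : Fin m → ℝ := fun i => ∑ k, ∑ j, A i j k ^ 2 with hb
  have hb0 : ∀ i, 0 ≤ b i := fun i =>
    Finset.sum_nonneg fun _ _ => Finset.sum_nonneg fun _ _ => sq_nonneg _
  -- One constant dominating every `A i * (A i)ᵀ`; the summand `1` keeps it positive even without
  -- transitions.
  set c : ℝ := 1 + ∑ i, b i with hc
  have hcpos : 0 < c := by
    have := Finset.sum_nonneg fun i (_ : i ∈ Finset.univ) => hb0 i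
    linarith
  have hbc : ∀ i, b i ≤ c := fun i => by
    have := Finset.single_le_sum (fun i _ => hb0 i) (Finset.mem_univ i)
    linarith
  have hcA : ∀ i, (c • (1 : Mat p₁ p₂ p₁ p₂) - A i * (A i)ᵀ).PosSemidef := by
    intro i
    have h := (posSemidef_smul_one (ι := Fin p₁ ⊕ Fin p₂) (sub_nonneg.2 (hbc i))).add
      (posSemidef_sum_sq_smul_one_sub (A i))
    convert h using 1
    rw [sub_smul, sub_add_sub_cancel]
  refine ⟨c, hcpos, fun ε hε => ?_⟩
  have hpos : ∀ k : ℕ, 0 < ε * c ^ k := fun k => mul_pos hε (pow_pos hcpos k)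
  -- The noise covariances complete `A (ε cⁱ) Aᵀ` to `ε cⁱ⁺¹`, so the covariance stays scalar and
  -- grows by the factor `c` at each step.
  set S : Source m p₁ p₂ p₁ p₂ :=
    { A := A
      B := fun _ => 1
      QX := ε • 1
      QW := fun i => (ε * c ^ (i : ℕ)) • (c • 1 - A i * (A i)ᵀ)
      posX := posSemidef_smul_one hε.le
      posW := fun i => (hcA i).smul (hpos i).le } with hS
  have hrec : ∀ i : Fin m, (ε * c ^ ((i : ℕ) + 1)) • (1 : Mat p₁ p₂ p₁ p₂) =
      A i * ((ε * c ^ (i : ℕ)) • 1) * (A i)ᵀ + S.noiseCov i := by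
    intro i
    have : S.noiseCov i = (ε * c ^ (i : ℕ)) • (c • 1 - A i * (A i)ᵀ) := by
      simp [Source.noiseCov, hS]
    rw [this, Matrix.mul_smul, Matrix.mul_one, smul_mul_assoc, smul_sub, smul_smul,
      add_sub_cancel, pow_succ, mul_assoc]
  refine ⟨S.law, S.noiseCov, inferInstance, S.isGaussMarkov_law, S.noiseCov_posSemidef, hrec,
    fun t => ?_⟩
  exact S.isGaussMarkov_law.map_apply S.noiseCov_posSemidef
    (M := fun t => (ε * c ^ (t : ℕ)) • 1) (fun t => posSemidef_smul_one (hpos t).le)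
    (by simp [hS]) (fun i => by simpa using hrec i) t

end Regularization

/-! ### Causality and estimation -/

section Causality

/-- If `φ Y` has the same conditional law given `X` and given `r X`, then a function of `X` which is
independent of `r X` is independent of `(r X, φ Y)`. -/
lemma indepLaw_of_condDistrib_eq {α α' β γ δ : Type*} [MeasurableSpace α] [MeasurableSpace α']
    [MeasurableSpace β] [StandardBorelSpace β] [Nonempty β] [MeasurableSpace γ] [MeasurableSpace δ]
    {μ : Measure (α × δ)} [IsProbabilityMeasure μ] {r : α → α'} {n : α → γ} {φ : δ → β}
    (hφ : Measurable φ) {N : Measure γ} [IsProbabilityMeasure N]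
    (hind : IndepLaw (μ.map Prod.fst) r n N)
    (h : ∀ᵐ ω ∂μ, condDistrib (fun ω => φ ω.2) (fun ω => ω.1) μ ω.1 =
      condDistrib (fun ω => φ ω.2) (fun ω => r ω.1) μ (r ω.1)) :
    IndepLaw μ (fun ω => (r ω.1, φ ω.2)) (fun ω => n ω.1) N := by
  have hr := hind.measurable_left
  have hn := hind.measurable_right
  have hφ2 : Measurable fun ω : α × δ => φ ω.2 := hφ.comp measurable_snd
  set κ := condDistrib (fun ω : α × δ => φ ω.2) (fun ω => r ω.1) μ with hκ
  -- By `h` the second component may be sampled from a kernel that sees `X` only through `r X`.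
  have hk : ∀ f : α × β → ℝ≥0∞, Measurable f →
      ∫⁻ ω, f (ω.1, φ ω.2) ∂μ = ∫⁻ ω, ∫⁻ b, f (ω.1, b) ∂(κ (r ω.1)) ∂μ := by
    intro f hf
    have h1 := compProd_map_condDistrib (mβ := ‹MeasurableSpace α›)
      (X := fun ω : α × δ => ω.1) hφ2.aemeasurable (μ := μ)
    have h2 := congrArg (fun τ => ∫⁻ p, f p ∂τ) h1
    rw [lintegral_map hf (by fun_prop), Measure.lintegral_compProd hf,
      lintegral_map (Measurable.lintegral_kernel_prod_right' hf) measurable_fst] at h2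
    rw [← h2]
    refine lintegral_congr_ae ?_
    filter_upwards [h] with ω hω
    rw [hω]
  refine ⟨by fun_prop, by fun_prop, ?_⟩
  refine Measure.ext_of_lintegral _ fun F hF => ?_
  obtain ⟨Φ, hΦd⟩ : ∃ Φ : α' × γ → ℝ≥0∞, ∀ a c, Φ (a, c) = ∫⁻ b, F ((a, b), c) ∂(κ a) :=
    ⟨fun p => ∫⁻ b, F ((p.1, b), p.2) ∂(κ p.1), fun _ _ => rfl⟩
  have hΦ : Measurable Φ := by
    have : Φ = fun p => ∫⁻ b, F ((p.1, b), p.2) ∂(κ p.1) := funext fun p => hΦd p.1 p.2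
    rw [this]
    exact Measurable.lintegral_kernel_prod_right' (κ := κ.comap Prod.fst measurable_fst)
      (f := fun q : (α' × γ) × β => F ((q.1.1, q.2), q.1.2)) (by fun_prop)
  have hΨ : Measurable fun p : α' × β => ∫⁻ c, F (p, c) ∂N := hF.lintegral_prod_right'
  have e1 := congrArg (fun τ => ∫⁻ p, Φ p ∂τ) hind.map_prod
  rw [lintegral_map hΦ (by fun_prop), lintegral_map (by fun_prop) measurable_fst,
    lintegral_prod _ hΦ.aemeasurable, Measure.map_map hr measurable_fst,
    lintegral_map hΦ.lintegral_prod_right' (by fun_prop)] at e1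
  simp only [hΦd, Function.comp_apply] at e1
  rw [lintegral_map hF (by fun_prop), lintegral_prod _ hF.aemeasurable,
    lintegral_map hΨ (by fun_prop),
    hk (fun p => F ((r p.1, p.2), n p.1)) (by fun_prop), e1,
    hk (fun p => ∫⁻ c, F ((r p.1, p.2), c) ∂N) (hΨ.comp (by fun_prop))]
  refine lintegral_congr fun ω => ?_
  exact lintegral_lintegral_swap (f := fun c b => F ((r ω.1, b), c)) (by fun_prop)

variable {m p₁ p₂ : ℕ}

/-- Causality in the form used by the converse: given the states so far, the reproductions so far
say nothing about the next source increment. -/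
lemma IsGaussMarkov.indepLaw_of_isCausal {A : Fin m → Mat p₁ p₂ p₁ p₂} {Q₀ : Mat p₁ p₂ p₁ p₂}
    {Q : Fin m → Mat p₁ p₂ p₁ p₂} {μ : Measure (Path m p₁ p₂ × Path m p₁ p₂)}
    [IsProbabilityMeasure μ] (hP : IsGaussMarkov A Q₀ Q (μ.map Prod.fst)) (hμ : IsCausal μ)
    (i : Fin m) :
    IndepLaw μ (fun ω => ((fun s => ω.1 s : Set.Iic i.castSucc → Vec p₁ p₂),
        (fun s => ω.2 s : Set.Iic i.castSucc → Vec p₁ p₂)))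
      (fun ω => ω.1 i.succ - Matrix.toEuclideanLin (A i) (ω.1 i.castSucc))
      (multivariateGaussian 0 (Q i)) := by
  have := Measure.isProbabilityMeasure_map (μ := μ) measurable_fst.aemeasurable
  have hr : Measurable fun (y : Path m p₁ p₂) (s : Set.Iic i.castSucc) => y s :=
    measurable_pi_iff.2 fun s => measurable_pi_apply _
  refine indepLaw_of_condDistrib_eq (r := fun (x : Path m p₁ p₂) (s : Set.Iic i.castSucc) => x s)
    (φ := fun (y : Path m p₁ p₂) (s : Set.Iic i.castSucc) => y s)
    (n := fun x => x i.succ - Matrix.toEuclideanLin (A i) (x i.castSucc)) hr ?_ (hμ i)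
  convert (hP.step i).comp_left hr using 2 with x
  ext s : 1
  exact (trunc_apply_of_lt _ (Nat.lt_succ_of_le (Fin.le_def.1 s.2))).symm

end Causality

/-! ### Least squares estimates as functions of the reproduction path -/

section Estimation

variable {m p₁ p₂ : ℕ}

lemma measurable_trunc_sigmaY (t : Fin (m + 1)) :
    Measurable[sigmaY t] fun ω : Path m p₁ p₂ × Path m p₁ p₂ => trunc (t + 1) ω.2 := by
  refine (@measurable_pi_iff _ _ _ (sigmaY t) _ _).2 fun s => ?_
  by_cases hs : (s : ℕ) < t + 1
  · simp only [trunc, if_pos hs]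
    exact Source.measurable_sigmaY (Fin.le_def.2 (Nat.le_of_lt_succ hs))
  · simp only [trunc, if_neg hs]
    exact @measurable_const _ _ _ (sigmaY t) _

/-- The preimage of a point under a `sigmaY t`-measurable function is determined by `Y^t`; the
unused source path is filled with `0` and the later reproductions are truncated. -/
lemma eq_of_measurable_sigmaY {t : Fin (m + 1)} {f : Path m p₁ p₂ × Path m p₁ p₂ → ℝ}
    (hf : Measurable[sigmaY t] f) (ω : Path m p₁ p₂ × Path m p₁ p₂) :
    f (0, trunc (t + 1) ω.2) = f ω := by
  obtain ⟨B, -, hB⟩ := hf (measurableSet_singleton (f ω))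
  have h1 : (fun s : Set.Iic t => ω.2 s) ∈ B := by
    have : ω ∈ f ⁻¹' {f ω} := rfl
    rwa [← hB] at this
  have h2 : ((0, trunc (t + 1) ω.2) : Path m p₁ p₂ × Path m p₁ p₂) ∈ f ⁻¹' {f ω} := by
    rw [← hB]
    have : (fun s : Set.Iic t => trunc (t + 1) ω.2 s) = fun s : Set.Iic t => ω.2 s := by
      ext s : 1
      exact trunc_apply_of_lt _ (Nat.lt_succ_of_le (Fin.le_def.1 s.2))
    rwa [Set.mem_preimage, this]
  exact h2

/-- The path `v y` consists of the least squares estimates of the states from the present and past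
reproductions. -/
structure IsEstimate (μ : Measure (Path m p₁ p₂ × Path m p₁ p₂))
    (v : Path m p₁ p₂ → Path m p₁ p₂) : Prop where
  measurable : Measurable v
  apply_trunc : ∀ (t : Fin (m + 1)) y, v (trunc (t + 1) y) t = v y t
  memLp : ∀ t j, MemLp (fun ω => v ω.2 t j) 2 μ
  orthogonal : ∀ (t : Fin (m + 1)) j (Φ : Path m p₁ p₂ → ℝ), Measurable Φ →
    (∀ y, Φ (trunc (t + 1) y) = Φ y) → MemLp (fun ω => Φ ω.2) 2 μ →
    ∫ ω, Φ ω.2 * (ω.1 t j - v ω.2 t j) ∂μ = 0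

lemma exists_estimate {μ : Measure (Path m p₁ p₂ × Path m p₁ p₂)} [IsProbabilityMeasure μ]
    (hX : ∀ t j, MemLp (fun ω => ω.1 t j) 2 μ) :
    ∃ v, IsEstimate μ v := by
  have hle : ∀ t : Fin (m + 1),
      (sigmaY t : MeasurableSpace (Path m p₁ p₂ × Path m p₁ p₂)) ≤
        Prod.instMeasurableSpace := fun t =>
    (Source.comap_sigmaY_le t).trans (Measurable.comap_le ((measurable_trunc _).comp
        measurable_snd))
  set f : Fin (m + 1) → Fin p₁ ⊕ Fin p₂ → Path m p₁ p₂ × Path m p₁ p₂ → ℝ := fun t j =>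
    condExp (sigmaY t) μ fun ω => ω.1 t j with hf
  have hfm : ∀ t j, Measurable[sigmaY t] (f t j) := fun t j =>
    stronglyMeasurable_condExp.measurable
  have hfm' : ∀ t j, Measurable (f t j) := fun t j => (hfm t j).mono (hle t) le_rfl
  -- By `eq_of_measurable_sigmaY` this represents the conditional expectations as functions of the
  -- path `y` at every point, not only almost everywhere.
  set v : Path m p₁ p₂ → Path m p₁ p₂ := fun y t =>
    WithLp.toLp 2 fun j => f t j (0, trunc (t + 1) y) with hv
  have hvf : ∀ t j ω, v ω.2 t j = f t j ω := fun t j ω => eq_of_measurable_sigmaY (hfm t j) ω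
  refine ⟨v, ?_, ?_, ?_, ?_⟩
  · refine measurable_pi_iff.2 fun t => ?_
    refine (WithLp.measurable_toLp 2 _).comp (measurable_pi_iff.2 fun j => ?_)
    exact (hfm' t j).comp (by fun_prop)
  · intro t y
    simp only [hv, trunc_trunc]
  · intro t j
    simp only [hvf]
    exact (hX t j).condExp one_le_two
  · intro t j Φ hΦ hΦt hΦ2
    simp only [hvf]
    have hΦm : StronglyMeasurable[sigmaY t] fun ω : Path m p₁ p₂ × Path m p₁ p₂ => Φ ω.2 := by
      have h1 := hΦ.comp (measurable_trunc_sigmaY (p₁ := p₁) (p₂ := p₂) t)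
      have h2 : (Φ ∘ fun ω : Path m p₁ p₂ × Path m p₁ p₂ => trunc (t + 1) ω.2) =
          fun ω => Φ ω.2 := funext fun ω => hΦt ω.2
      rw [h2] at h1
      exact h1.stronglyMeasurable
    have h1 : Integrable (fun ω => Φ ω.2 * ω.1 t j) μ := hΦ2.integrable_mul (hX t j)
    have h2 : Integrable (fun ω => Φ ω.2 * f t j ω) μ :=
      hΦ2.integrable_mul ((hX t j).condExp one_le_two)
    have h3 := condExp_mul_of_stronglyMeasurable_left hΦm h1 ((hX t j).integrable one_le_two)
    have h4 := integral_congr_ae h3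
    rw [integral_condExp (hle t)] at h4
    simp only [mul_sub]
    rw [integral_sub h1 h2, sub_eq_zero]
    exact h4

end Estimation

/-! ### The lower bound -/

section Converse

open Matrix Filter
open scoped Topology

/-- Sum `log λ ≤ λ - 1` over the eigenvalues and use that the trace of `1 - K` is nonnegative. -/
lemma det_le_one {ι : Type*} [Fintype ι] [DecidableEq ι] {K : Matrix ι ι ℝ} (hK : K.PosDef)
    (h : (1 - K).PosSemidef) : K.det ≤ 1 := by
  have h1 : K.det = ∏ i, hK.1.eigenvalues i := by simpa using hK.1.det_eq_prod_eigenvalues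
  have h2 : K.trace = ∑ i, hK.1.eigenvalues i := by simpa using hK.1.trace_eq_sum_eigenvalues
  have h3 : 0 ≤ ∑ i, (1 - hK.1.eigenvalues i) := by
    have := h.trace_nonneg
    rw [trace_sub, trace_one, h2] at this
    simpa using this
  rw [← Real.log_nonpos_iff hK.det_pos.le, h1, Real.log_prod fun i _ => (hK.eigenvalues_pos i).ne']
  have h4 : ∑ i, Real.log (hK.1.eigenvalues i) ≤ ∑ i, (hK.1.eigenvalues i - 1) :=
    Finset.sum_le_sum fun i _ => Real.log_le_sub_one_of_pos (hK.eigenvalues_pos i)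
  have h5 : ∑ i, (hK.1.eigenvalues i - 1) = -∑ i, (1 - hK.1.eigenvalues i) := by
    rw [← Finset.sum_neg_distrib]
    exact Finset.sum_congr rfl fun _ _ => by ring
  linarith

lemma regRate_nonneg {ι : Type*} [Fintype ι] [DecidableEq ι] {T G : Matrix ι ι ℝ}
    (hG : G.PosSemidef) (hTG : (T - G).PosSemidef) {η : ℝ} (hη : 0 < η) : 0 ≤ regRate η T G := by
  have hT : T.PosSemidef := by simpa using hG.add hTG
  have hTη := posDef_add_smul_one hT hη
  have hGη := posDef_add_smul_one hG hη
  -- Both regularized matrices are nonsingular, so their ranks agree, and the quotient of their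
  -- determinants is `1 / det K`.
  obtain ⟨S, K, hK, h1K, hS, hSK, -⟩ := exists_whitening hGη.posSemidef
    (T := T + η • 1) (by rwa [add_sub_add_right_eq_sub])
    (by rw [rank_eq_of_det_ne_zero hGη.det_pos.ne', rank_eq_of_det_ne_zero hTη.det_pos.ne'])
  have hK1 := det_le_one hK h1K
  have h1 : (G + η • 1).det = K.det * (T + η • 1).det := by
    rw [← hS, ← hSK]
    simp only [det_mul, det_one]
    ring
  refine mul_nonneg (by norm_num) (Real.log_nonneg ?_)
  rw [one_le_div hGη.det_pos, h1]
  exact mul_le_of_le_one_left hTη.det_pos.le hK1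

variable {m p₁ p₂ q₁ q₂ : ℕ} {S : Source m p₁ p₂ q₁ q₂}
  {μ : Measure (Path m p₁ p₂ × Path m p₁ p₂)} [IsProbabilityMeasure μ]
  {v : Path m p₁ p₂ → Path m p₁ p₂}

/-- Covariances of the errors of the estimates `v`. -/
noncomputable def estimateCov (μ : Measure (Path m p₁ p₂ × Path m p₁ p₂))
    (v : Path m p₁ p₂ → Path m p₁ p₂) (t : Fin (m + 1)) : Mat p₁ p₂ p₁ p₂ :=
  of fun i j => ∫ ω, (ω.1 t - v ω.2 t) i * (ω.1 t - v ω.2 t) j ∂μ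

lemma memLp_of_map_fst (hP : μ.map Prod.fst = S.law) (t : Fin (m + 1)) (j : Fin p₁ ⊕ Fin p₂) :
    MemLp (fun ω => ω.1 t j) 2 μ := by
  have h := (S.isGaussMarkov_law.memLp t).continuousLinearMap_comp (EuclideanSpace.proj (𝕜 := ℝ) j)
  rw [← hP, memLp_map_measure_iff
    (g := fun x : Path m p₁ p₂ => EuclideanSpace.proj (𝕜 := ℝ) j (x t))
    (by
      have : Measurable fun x : Path m p₁ p₂ => x t j := by fun_prop
      exact this.aestronglyMeasurable) measurable_fst.aemeasurable] at h
  exact h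

namespace IsEstimate

variable (hv : IsEstimate μ v)

include hv

lemma apply_congr (t : Fin (m + 1)) {y y' : Path m p₁ p₂}
    (h : ∀ s : Fin (m + 1), (s : ℕ) < t + 1 → y s = y' s) : v y t = v y' t := by
  rw [← hv.apply_trunc t y, ← hv.apply_trunc t y', trunc_congr h]

lemma measurable_apply (t : Fin (m + 1)) : Measurable fun y => v y t :=
  (measurable_pi_apply t).comp hv.measurable

lemma hasSecondMoment_error (hX : ∀ t j, MemLp (fun ω => ω.1 t j) 2 μ) (t : Fin (m + 1)) :
    HasSecondMoment μ (fun ω => ω.1 t - v ω.2 t) (estimateCov μ v t) :=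
  HasSecondMoment.of_memLp fun j => (hX t j).sub (hv.memLp t j)

/-- The prediction error is `A (X_t - v_t)` plus the source increment, which by causality is
independent of `X_t` and `Y^t`. No Gaussianity of `Y` is used. -/
lemma hasSecondMoment_prediction (hP : μ.map Prod.fst = S.law) (hc : IsCausal μ)
    (t : Fin (m + 1)) :
    HasSecondMoment μ (fun ω => ω.1 t - S.shift (v ω.2) t) (S.predCov (estimateCov μ v) t) := by
  have hGM : IsGaussMarkov S.A S.QX S.noiseCov (μ.map Prod.fst) := hP ▸ S.isGaussMarkov_law
  induction t using Fin.cases with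
  | zero =>
    simp only [Source.shift_zero, sub_zero]
    refine HasSecondMoment.of_map_eq (by fun_prop) S.posX ?_
    rw [Source.predCov_zero, ← S.isGaussMarkov_law.init, ← hP,
      Measure.map_map (by fun_prop) measurable_fst]
    rfl
  | succ i =>
    have hA := measurable_toEuclideanLin (S.A i)
    have hvm := hv.measurable_apply i.castSucc
    have h1 := (hv.hasSecondMoment_error (memLp_of_map_fst hP) i.castSucc).toEuclideanLin (S.A i)
    have h2 := (hGM.indepLaw_of_isCausal hc i).comp_left (φ := fun p =>
      toEuclideanLin (S.A i) (p.1 ⟨i.castSucc, Set.self_mem_Iic⟩ -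
        v (extendPath (Set.Iic i.castSucc) p.2) i.castSucc))
      (hA.comp ((by fun_prop : Measurable fun p :
        (Set.Iic i.castSucc → Vec p₁ p₂) × (Set.Iic i.castSucc → Vec p₁ p₂) =>
          p.1 ⟨i.castSucc, Set.self_mem_Iic⟩).sub (hvm.comp (by fun_prop))))
    have h3 : ∀ y : Path m p₁ p₂, v (extendPath (Set.Iic i.castSucc) fun s => y s) i.castSucc =
        v y i.castSucc := fun y => hv.apply_congr _ fun s hs =>
      extendPath_apply (s := Set.Iic i.castSucc) _
        (Set.mem_Iic.2 (Fin.le_def.2 (Nat.le_of_lt_succ hs)))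
    simp only [h3] at h2
    have h4 := h1.add_gaussian (S.noiseCov_posSemidef i) h2
    rw [S.predCov_succ]
    convert h4 using 2 with ω
    rw [map_sub, Source.shift_succ]
    abel

lemma shift_apply_trunc (t : Fin (m + 1)) (y : Path m p₁ p₂) :
    S.shift (v (trunc (t + 1) y)) t = S.shift (v y) t :=
  S.shift_congr t fun s hs => hv.apply_congr s fun r hr => trunc_apply_of_lt _ (by omega)

/-- Second moments of the sum of the error and a function of the present and past
reproductions. -/
lemma hasSecondMoment_add (hX : ∀ t j, MemLp (fun ω => ω.1 t j) 2 μ) (t : Fin (m + 1))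
    {Φ : Path m p₁ p₂ → Vec p₁ p₂} (hΦ : Measurable Φ) (hΦt : ∀ y, Φ (trunc (t + 1) y) = Φ y)
    (hΦ2 : ∀ j, MemLp (fun ω => Φ ω.2 j) 2 μ) :
    ∃ D : Mat p₁ p₂ p₁ p₂, D.PosSemidef ∧
      HasSecondMoment μ (fun ω => ω.1 t - v ω.2 t + Φ ω.2) (estimateCov μ v t + D) := by
  have h1 := HasSecondMoment.of_memLp hΦ2
  refine ⟨_, h1.posSemidef, (hv.hasSecondMoment_error hX t).add_of_orthogonal h1 fun i j => ?_⟩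
  have h2 := hv.orthogonal t i (fun y => Φ y j) (by fun_prop) (fun y => by rw [hΦt]) (hΦ2 j)
  simp only [PiLp.sub_apply]
  simp only [mul_comm] at h2 ⊢
  exact h2

/-- The prediction error is the error plus `v_t - A v_{t-1}`, a function of `Y^t`. By orthogonality
its second moment exceeds that of the error by a positive semidefinite matrix. -/
lemma isReduction (hP : μ.map Prod.fst = S.law) (hc : IsCausal μ) :
    S.IsReduction (estimateCov μ v) := by
  have hX := memLp_of_map_fst hP
  refine ⟨fun t => (hv.hasSecondMoment_error hX t).posSemidef, fun t => ?_⟩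
  have hpred := hv.hasSecondMoment_prediction hP hc t
  obtain ⟨D, hD, h⟩ := hv.hasSecondMoment_add hX t (Φ := fun y => v y t - S.shift (v y) t)
    ((hv.measurable_apply t).sub ((S.measurable_shift t).comp hv.measurable))
    (fun y => by rw [hv.apply_trunc, hv.shift_apply_trunc]) fun j => by
      -- `v_t - A v_{t-1}` is square integrable as the difference of the prediction error and the
      -- error.
      refine ((hpred.memLp j).sub ((hX t j).sub (hv.memLp t j))).congr_norm ?_
        (ae_of_all _ fun ω => ?_)
      · have h1 := hv.measurable_apply t
        have h2 := (S.measurable_shift t).comp hv.measurable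
        have h3 : Measurable fun y => (v y t - S.shift (v y) t) j :=
          (by fun_prop : Measurable fun x : Vec p₁ p₂ => x j).comp (h1.sub h2)
        exact (h3.comp measurable_snd).aestronglyMeasurable
      · simp
  have h5 : S.predCov (estimateCov μ v) t = estimateCov μ v t + D := by
    ext i j
    rw [← hpred.integral_mul, ← h.integral_mul]
    simp only [sub_add_sub_cancel]
  rw [h5, add_sub_cancel_left]
  exact hD

/-- `X_t - Y_t` is the error plus `v_t - Y_t`, a function of `Y^t`, so orthogonality applies again.
-/
lemma estimateCov_diag_le (hX : ∀ t j, MemLp (fun ω => ω.1 t j) 2 μ) (t : Fin (m + 1))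
    (hXY : ∀ j, MemLp (fun ω => ω.1 t j - ω.2 t j) 2 μ) (j : Fin p₁ ⊕ Fin p₂) :
    estimateCov μ v t j j ≤ ∫ ω, (ω.1 t j - ω.2 t j) ^ 2 ∂μ := by
  obtain ⟨D, hD, h⟩ := hv.hasSecondMoment_add hX t (Φ := fun y => v y t - y t)
    ((hv.measurable_apply t).sub (measurable_pi_apply t))
    (fun y => by rw [hv.apply_trunc, trunc_apply_of_lt _ (Nat.lt_succ_self _)]) fun j => by
      refine ((hXY j).sub ((hX t j).sub (hv.memLp t j))).congr_norm ?_
        (ae_of_all _ fun ω => ?_)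
      · have h3 : Measurable fun y => (v y t - y t) j :=
          (by fun_prop : Measurable fun x : Vec p₁ p₂ => x j).comp
            ((hv.measurable_apply t).sub (measurable_pi_apply t))
        exact (h3.comp measurable_snd).aestronglyMeasurable
      · simp
  have h1 := h.integral_mul j j
  simp only [sub_add_sub_cancel, PiLp.sub_apply, ← pow_two] at h1
  rw [h1, Matrix.add_apply]
  exact le_add_of_nonneg_right hD.diag_nonneg

end IsEstimate

/-- The mutual information is at least the rate of the source and the errors perturbed by a
Gauss-Markov noise with scalar covariances. -/
lemma ofReal_sum_regRate_le {P' : Measure (Path m p₁ p₂)} [IsProbabilityMeasure P']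
    {R : Fin m → Mat p₁ p₂ p₁ p₂} {η : Fin (m + 1) → ℝ} (hη : ∀ t, 0 < η t)
    (hP' : IsGaussMarkov S.A (η 0 • 1) R P') (hR : ∀ i, (R i).PosSemidef)
    (hηR : ∀ i : Fin m, η i.succ • (1 : Mat p₁ p₂ p₁ p₂) =
      S.A i * (η i.castSucc • 1) * (S.A i)ᵀ + R i)
    (hP't : ∀ t, P'.map (fun x => x t) = multivariateGaussian 0 (η t • 1))
    (hP : μ.map Prod.fst = S.law) (hc : IsCausal μ) (hv : IsEstimate μ v) :
    ENNReal.ofReal (∑ t, regRate (η t) (S.predCov (estimateCov μ v) t) (estimateCov μ v t)) ≤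
      mutualInfo μ Prod.fst Prod.snd := by
  set G := estimateCov μ v with hGd
  set T := S.predCov G with hTd
  have hred := hv.isReduction hP hc
  have hG : ∀ t, (G t + η t • 1).PosDef := fun t => posDef_add_smul_one (hred.pos t) (hη t)
  have hT : ∀ t, (T t + η t • 1).PosDef := fun t =>
    posDef_add_smul_one (S.predCov_posSemidef hred.pos t) (hη t)
  have hvm : Measurable v := hv.measurable
  have hvt := hv.measurable_apply
  have hst : ∀ t, Measurable fun y => S.shift (v y) t := fun t => (S.measurable_shift t).comp hvm
  have hPp : IsProbabilityMeasure (μ.map Prod.fst) :=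
    Measure.isProbabilityMeasure_map measurable_fst.aemeasurable
  have hYp : IsProbabilityMeasure (μ.map Prod.snd) :=
    Measure.isProbabilityMeasure_map measurable_snd.aemeasurable
  set π : (Path m p₁ p₂ × Path m p₁ p₂) × Path m p₁ p₂ → Path m p₁ p₂ × Path m p₁ p₂ :=
    fun p => (p.1.1 + p.2, p.1.2) with hπ
  have hπm : Measurable π := by fun_prop
  set P'' : Measure (Path m p₁ p₂) := (S.law.prod P').map fun p => p.1 + p.2 with hP''
  have hadd : Measurable fun p : Path m p₁ p₂ × Path m p₁ p₂ => p.1 + p.2 := by fun_prop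
  have hP''p : IsProbabilityMeasure P'' := Measure.isProbabilityMeasure_map hadd.aemeasurable
  have hGM : IsGaussMarkov S.A (S.QX + η 0 • 1) (fun i => S.noiseCov i + R i) P'' :=
    S.isGaussMarkov_law.add hP' S.posX (posSemidef_smul_one (hη 0).le) S.noiseCov_posSemidef hR
  have hπp : IsProbabilityMeasure ((μ.prod P').map π) :=
    Measure.isProbabilityMeasure_map hπm.aemeasurable
  have hle : klDiv ((μ.prod P').map π) (P''.prod (μ.map Prod.snd)) ≤
      mutualInfo μ Prod.fst Prod.snd := by
    -- Perturbing the source by independent noise preserves the product form of the reference law,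
    -- so data processing bounds the perturbed information.
    have h1 : ((S.law.prod (μ.map Prod.snd)).prod P').map π = P''.prod (μ.map Prod.snd) := by
      refine Measure.ext_of_lintegral _ fun F hF => ?_
      rw [lintegral_map hF hπm, lintegral_prod _ (by fun_prop), lintegral_prod _ (by fun_prop),
        lintegral_prod _ hF.aemeasurable, hP'', lintegral_map hF.lintegral_prod_right' hadd,
        lintegral_prod _ (by fun_prop)]
      refine lintegral_congr fun x => ?_
      exact lintegral_lintegral_swap (f := fun y z => F (x + z, y)) (by fun_prop)
    have h2 : μ.map (fun ω => (ω.1, ω.2)) = μ := Measure.map_id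
    rw [mutualInfo, h2, hP, ← h1]
    refine (klDiv_map_le _ _ hπm).trans (le_of_eq ?_)
    exact klDiv_prod_right _ _ _
  refine le_trans ?_ hle
  -- The Donsker–Varadhan test function: log likelihood of the filter with estimates `v` against
  -- that of its one-step predictions, both with regularized covariances.
  set F : Path m p₁ p₂ × Path m p₁ p₂ → ℝ := fun p =>
    ∑ t, (gaussLog (G t + η t • 1) (p.1 t - v p.2 t) -
      gaussLog (T t + η t • 1) (p.1 t - S.shift (v p.2) t)) with hF
  have hFm : Measurable F := by fun_prop
  have hmass : ∫⁻ p, ENNReal.ofReal (Real.exp (F p)) ∂(P''.prod (μ.map Prod.snd)) ≤ 1 := by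
    rw [lintegral_prod_symm _ (by fun_prop)]
    refine le_of_eq ?_
    have h1 : ∀ y, ∫⁻ x, ENNReal.ofReal (Real.exp (F (x, y))) ∂P'' = 1 := by
      intro y
      rw [← hGM.lintegral_prod_logRatio (v := v y) (w := S.shift (v y))
        (fun i => (S.noiseCov_posSemidef i).add (hR i)) hT hG rfl (fun i => ?_) rfl (fun i => rfl)]
      · refine lintegral_congr fun x => ?_
        rw [hF]
        simp only
        rw [Real.exp_sum, ENNReal.ofReal_prod_of_nonneg fun _ _ => (Real.exp_pos _).le]
      -- The regularized covariances obey the prediction recursion because the scalar covariances of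
      -- the noise follow the same transitions.
      · rw [hTd, S.predCov_succ, hηR, Matrix.mul_add, Matrix.add_mul]
        abel
    simp only [h1]
    simp
  have hsplit : ∀ t, HasSecondMoment (μ.prod P') (fun p => p.1.1 t - v p.1.2 t + p.2 t)
        (G t + η t • 1) ∧
      HasSecondMoment (μ.prod P') (fun p => p.1.1 t - S.shift (v p.1.2) t + p.2 t)
        (T t + η t • 1) := by
    intro t
    have hind := (indepLaw_fst_snd μ P').comp_right (φ := fun x => x t) (measurable_pi_apply t)
    rw [hP't t] at hind
    have hpos := posSemidef_smul_one (ι := Fin p₁ ⊕ Fin p₂) (hη t).le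
    have h1 := hv.hasSecondMoment_error (memLp_of_map_fst hP) t
    have h2 := hv.hasSecondMoment_prediction hP hc t
    exact ⟨(h1.comp_fst P').add_gaussian hpos (hind.comp_left (φ := fun ω => ω.1 t - v ω.2 t)
        (by fun_prop)),
      (h2.comp_fst P').add_gaussian hpos (hind.comp_left
        (φ := fun ω => ω.1 t - S.shift (v ω.2) t) (by fun_prop))⟩
  -- The perturbed error and prediction error have exactly the covariances of the two densities, so
  -- the quadratic terms integrate to equal constants and cancel.
  have hterm : ∀ t, Integrable (fun p => gaussLog (G t + η t • 1) ((π p).1 t - v (π p).2 t) -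
        gaussLog (T t + η t • 1) ((π p).1 t - S.shift (v (π p).2) t)) (μ.prod P') ∧
      ∫ p, gaussLog (G t + η t • 1) ((π p).1 t - v (π p).2 t) -
        gaussLog (T t + η t • 1) ((π p).1 t - S.shift (v (π p).2) t) ∂(μ.prod P') =
        regRate (η t) (T t) (G t) := by
    intro t
    obtain ⟨i1, e1⟩ := (hsplit t).1.integral_gaussLog (hG t)
    obtain ⟨i2, e2⟩ := (hsplit t).2.integral_gaussLog (hT t)
    simp only [hπ, Pi.add_apply, add_sub_right_comm]
    refine ⟨i1.sub i2, ?_⟩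
    rw [integral_sub i1 i2, e1, e2, regRate, Real.log_div (hT t).det_pos.ne' (hG t).det_pos.ne']
    ring
  have hFi : Integrable F ((μ.prod P').map π) := by
    rw [integrable_map_measure hFm.aestronglyMeasurable hπm.aemeasurable]
    exact integrable_finsetSum _ fun t _ => (hterm t).1
  have hFv : ∫ p, F p ∂((μ.prod P').map π) = ∑ t, regRate (η t) (T t) (G t) := by
    rw [integral_map hπm.aemeasurable hFm.aestronglyMeasurable]
    simp only [hF]
    rw [integral_finsetSum _ fun t _ => (hterm t).1]
    exact Finset.sum_congr rfl fun t _ => (hterm t).2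
  rw [← hFv]
  exact ofReal_integral_le_klDiv hFm hFi hmass

/-- The sum of the rates of the least squares error covariances is at most the mutual
information. -/
theorem sum_gaussRate_le_mutualInfo (hP : μ.map Prod.fst = S.law) (hc : IsCausal μ)
    (hv : IsEstimate μ v) :
    ∑ t, gaussRate (S.predCov (estimateCov μ v) t) (estimateCov μ v t) ≤
      mutualInfo μ Prod.fst Prod.snd := by
  have hred := hv.isReduction hP hc
  obtain ⟨c, hc0, h⟩ := exists_regularizing_noise S.A
  -- At time `t` the regularization is `ε c ^ t`, which tends to zero through positive values.
  have hlim : Tendsto (fun ε : ℝ => ∑ t : Fin (m + 1), ENNReal.ofReal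
      (regRate (ε * c ^ (t : ℕ)) (S.predCov (estimateCov μ v) t) (estimateCov μ v t))) (𝓝[>] 0)
      (𝓝 (∑ t, gaussRate (S.predCov (estimateCov μ v) t) (estimateCov μ v t))) := by
    refine tendsto_finsetSum _ fun t _ => ?_
    refine (tendsto_regRate (hred.pos t) (hred.le t)).comp ?_
    refine tendsto_nhdsWithin_iff.2 ⟨?_, ?_⟩
    · have h1 : Tendsto (fun ε : ℝ => ε * c ^ (t : ℕ)) (𝓝 0) (𝓝 (0 * c ^ (t : ℕ))) :=
        tendsto_id.mul_const _
      rw [zero_mul] at h1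
      exact h1.mono_left nhdsWithin_le_nhds
    · filter_upwards [self_mem_nhdsWithin] with ε hε
      exact mul_pos hε (pow_pos hc0 _)
  refine le_of_tendsto hlim ?_
  filter_upwards [self_mem_nhdsWithin] with ε hε
  have hpos : ∀ t : Fin (m + 1), 0 < ε * c ^ (t : ℕ) := fun t => mul_pos hε (pow_pos hc0 _)
  obtain ⟨P', R, hP'p, hP', hR, hηR, hP't⟩ := h ε hε
  rw [← ENNReal.ofReal_sum_of_nonneg fun t _ => regRate_nonneg (hred.pos t) (hred.le t) (hpos t)]
  exact ofReal_sum_regRate_le hpos (by simpa using hP') hR (by simpa using hηR) hP't hP hc hv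

/-- Every feasible law has at least the rate of some admissible family of error covariances. -/
theorem exists_isErrorCov_le_mutualInfo {Δ₁ Δ₂ : ℝ} (hμ : IsFeasible S.law Δ₁ Δ₂ μ) :
    ∃ G, S.IsErrorCov Δ₁ Δ₂ G ∧
      ∑ t, gaussRate (S.predCov G t) (G t) ≤ mutualInfo μ Prod.fst Prod.snd := by
  have hX := memLp_of_map_fst hμ.marginal
  obtain ⟨v, hv⟩ := exists_estimate hX
  have hred := hv.isReduction hμ.marginal hμ.causal
  have hm : (0 : ℝ) < 1 / ((m : ℝ) + 1) := by positivity
  -- Each squared coordinate is dominated by the integrable sum; `f` selects the block.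
  have hterm : ∀ {κ : Type} [Fintype κ] (f : κ → Fin p₁ ⊕ Fin p₂),
      Integrable (fun ω : Path m p₁ p₂ × Path m p₁ p₂ => (1 / ((m : ℝ) + 1)) *
        ∑ t, ∑ j, (ω.1 t (f j) - ω.2 t (f j)) ^ 2) μ →
      ∀ t j, Integrable (fun ω => (ω.1 t (f j) - ω.2 t (f j)) ^ 2) μ := by
    intro κ _ f hf t j
    have hf' : Integrable (fun ω : Path m p₁ p₂ × Path m p₁ p₂ =>
        ∑ t, ∑ j, (ω.1 t (f j) - ω.2 t (f j)) ^ 2) μ :=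
      (integrable_const_mul_iff (IsUnit.mk0 _ hm.ne') _).1 hf
    have hms : Measurable fun ω : Path m p₁ p₂ × Path m p₁ p₂ =>
      (ω.1 t (f j) - ω.2 t (f j)) ^ 2 := by fun_prop
    refine hf'.mono' hms.aestronglyMeasurable (ae_of_all _ fun ω => ?_)
    rw [Real.norm_of_nonneg (sq_nonneg _)]
    refine le_trans ?_ (Finset.single_le_sum
      (f := fun t => ∑ j, (ω.1 t (f j) - ω.2 t (f j)) ^ 2)
      (fun _ _ => Finset.sum_nonneg fun _ _ => sq_nonneg _) (Finset.mem_univ t))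
    exact Finset.single_le_sum (f := fun j => (ω.1 t (f j) - ω.2 t (f j)) ^ 2)
      (fun _ _ => sq_nonneg _) (Finset.mem_univ j)
  have h1 := hterm Sum.inl hμ.integrable₁
  have h2 := hterm Sum.inr hμ.integrable₂
  have hXY : ∀ t j, MemLp (fun ω => ω.1 t j - ω.2 t j) 2 μ := by
    intro t j
    have hms : Measurable fun ω : Path m p₁ p₂ × Path m p₁ p₂ => ω.1 t j - ω.2 t j := by fun_prop
    rw [memLp_two_iff_integrable_sq hms.aestronglyMeasurable]
    rcases j with j | j
    · exact h1 t j
    · exact h2 t j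
  have hle := fun t => hv.estimateCov_diag_le hX t (hXY t)
  refine ⟨estimateCov μ v, ⟨hred.pos, hred.le, ?_, ?_⟩,
    sum_gaussRate_le_mutualInfo hμ.marginal hμ.causal hv⟩
  · refine le_trans ?_ hμ.fidelity₁
    unfold distortion₁
    rw [integral_const_mul, integral_finsetSum _ fun t _ =>
      integrable_finsetSum _ fun j _ => h1 t j]
    refine mul_le_mul_of_nonneg_left (Finset.sum_le_sum fun t _ => ?_) hm.le
    rw [integral_finsetSum _ fun j _ => h1 t j]
    exact Finset.sum_le_sum fun j _ => hle t (Sum.inl j)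
  · refine le_trans ?_ hμ.fidelity₂
    unfold distortion₂
    rw [integral_const_mul, integral_finsetSum _ fun t _ =>
      integrable_finsetSum _ fun j _ => h2 t j]
    refine mul_le_mul_of_nonneg_left (Finset.sum_le_sum fun t _ => ?_) hm.le
    rw [integral_finsetSum _ fun j _ => h2 t j]
    exact Finset.sum_le_sum fun j _ => hle t (Sum.inr j)

end Converse

/-! ### Compactness of the constraint set and existence of a minimizer -/

section Minimizer

open Matrix Filter
open scoped Topology

lemma isClosed_posSemidef {ι : Type*} [Fintype ι] :
    IsClosed {M : Matrix ι ι ℝ | M.PosSemidef} := by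
  have h : {M : Matrix ι ι ℝ | M.PosSemidef} =
      {M | Mᵀ = M} ∩ ⋂ x : ι → ℝ, {M | 0 ≤ x ⬝ᵥ M *ᵥ x} := by
    ext M
    simp only [Set.mem_ofPred_eq, posSemidef_iff_dotProduct_mulVec, Set.mem_inter_iff,
      Set.mem_iInter, star_trivial, IsHermitian, conjTranspose_eq_transpose_of_trivial]
  rw [h]
  refine (isClosed_eq (by fun_prop) continuous_id).inter (isClosed_iInter fun x => ?_)
  exact isClosed_le continuous_const (by fun_prop)

/-- Testing with `e_i ± e_j` gives `2 |M i j| ≤ M i i + M j j`. -/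
lemma abs_apply_le_trace {ι : Type*} [Fintype ι] [DecidableEq ι] {M : Matrix ι ι ℝ}
    (hM : M.PosSemidef) (i j : ι) : |M i j| ≤ M.trace := by
  have hd : ∀ i, M i i ≤ M.trace := fun i =>
    Finset.single_le_sum (f := fun i => M i i) (fun i _ => hM.diag_nonneg) (Finset.mem_univ i)
  have hs : M j i = M i j := by
    have := congrFun (congrFun hM.1 i) j
    simpa using this
  have h1 := hM.dotProduct_mulVec_nonneg (Pi.single i 1 + Pi.single j 1)
  have h2 := hM.dotProduct_mulVec_nonneg (Pi.single i 1 - Pi.single j 1)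
  simp only [star_trivial, mulVec_add, mulVec_sub, add_dotProduct, sub_dotProduct, dotProduct_add,
    dotProduct_sub, mulVec_single_one, single_one_dotProduct, col_apply, hs] at h1 h2
  have hi := hd i
  have hj := hd j
  exact abs_le.2 ⟨by linarith, by linarith⟩

/-- Each regularized rate is a lower bound and they converge to the rate. As a supremum of
continuous functions the rate is lower semicontinuous even where the rank of `G` drops. -/
lemma gaussRate_eq_iSup {ι : Type*} [Fintype ι] [DecidableEq ι] {T G : Matrix ι ι ℝ}
    (hG : G.PosSemidef) (hTG : (T - G).PosSemidef) :
    gaussRate T G = ⨆ (η : ℝ) (_ : 0 < η), ENNReal.ofReal (regRate η T G) := by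
  refine le_antisymm (le_of_tendsto (tendsto_regRate hG hTG) ?_)
    (iSup₂_le fun η hη => regRate_le_gaussRate hG hTG hη)
  filter_upwards [self_mem_nhdsWithin] with η hη
  exact le_iSup₂ (f := fun (η : ℝ) (_ : 0 < η) => ENNReal.ofReal (regRate η T G)) η hη

variable {m p₁ p₂ q₁ q₂ : ℕ} (S : Source m p₁ p₂ q₁ q₂) {Δ₁ Δ₂ : ℝ}

lemma continuous_predCov (t : Fin (m + 1)) :
    Continuous fun G : Fin (m + 1) → Mat p₁ p₂ p₁ p₂ => S.predCov G t := by
  induction t using Fin.cases with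
  | zero => exact continuous_const
  | succ i =>
    simp only [S.predCov_succ]
    fun_prop

lemma isClosed_isErrorCov (Δ₁ Δ₂ : ℝ) : IsClosed {G | S.IsErrorCov Δ₁ Δ₂ G} := by
  have hpred := continuous_predCov S
  have happ : ∀ t, Continuous fun G : Fin (m + 1) → Mat p₁ p₂ p₁ p₂ => G t := continuous_apply
  have h : {G | S.IsErrorCov Δ₁ Δ₂ G} =
      ((⋂ t, {G | (G t).PosSemidef}) ∩ ⋂ t, {G | (S.predCov G t - G t).PosSemidef}) ∩
      ({G | (1 / ((m : ℝ) + 1)) * ∑ t, (G t).toBlocks₁₁.trace ≤ Δ₁} ∩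
        {G | (1 / ((m : ℝ) + 1)) * ∑ t, (G t).toBlocks₂₂.trace ≤ Δ₂}) := by
    ext G
    simp only [Set.mem_ofPred_eq, Set.mem_inter_iff, Set.mem_iInter]
    exact ⟨fun h => ⟨⟨h.pos, h.le⟩, h.trace₁, h.trace₂⟩, fun h => ⟨h.1.1, h.1.2, h.2.1, h.2.2⟩⟩
  rw [h]
  refine IsClosed.inter (IsClosed.inter ?_ ?_) (IsClosed.inter ?_ ?_)
  · exact isClosed_iInter fun t => isClosed_posSemidef.preimage (happ t)
  · exact isClosed_iInter fun t => isClosed_posSemidef.preimage ((hpred t).sub (happ t))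
  · refine isClosed_le ?_ continuous_const
    simp only [trace, diag, toBlocks₁₁, of_apply]
    fun_prop
  · refine isClosed_le ?_ continuous_const
    simp only [trace, diag, toBlocks₂₂, of_apply]
    fun_prop

variable {S} in
lemma abs_apply_le_of_isErrorCov {G : Fin (m + 1) → Mat p₁ p₂ p₁ p₂} (hG : S.IsErrorCov Δ₁ Δ₂ G)
    (t : Fin (m + 1)) (i j : Fin p₁ ⊕ Fin p₂) : |G t i j| ≤ ((m : ℝ) + 1) * (Δ₁ + Δ₂) := by
  refine (abs_apply_le_trace (hG.pos t) i j).trans ?_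
  have hm : (0 : ℝ) < (m : ℝ) + 1 := by positivity
  have h1 : ∀ t, 0 ≤ (G t).toBlocks₁₁.trace := fun t =>
    Finset.sum_nonneg fun i _ => (hG.pos t).diag_nonneg
  have h2 : ∀ t, 0 ≤ (G t).toBlocks₂₂.trace := fun t =>
    Finset.sum_nonneg fun i _ => (hG.pos t).diag_nonneg
  have h3 : (G t).trace = (G t).toBlocks₁₁.trace + (G t).toBlocks₂₂.trace := by
    simp only [trace, diag, Fintype.sum_sum_type]
    rfl
  have h4 := Finset.single_le_sum (fun t _ => h1 t) (Finset.mem_univ t)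
  have h5 := Finset.single_le_sum (fun t _ => h2 t) (Finset.mem_univ t)
  have h6 := hG.trace₁
  have h7 := hG.trace₂
  rw [one_div_mul_eq_div, div_le_iff₀ hm] at h6 h7
  linarith

lemma isCompact_isErrorCov (Δ₁ Δ₂ : ℝ) : IsCompact {G | S.IsErrorCov Δ₁ Δ₂ G} := by
  have h : IsCompact (Set.pi Set.univ fun _ : Fin (m + 1) => Set.pi Set.univ
      fun _ : Fin p₁ ⊕ Fin p₂ => Set.pi Set.univ fun _ : Fin p₁ ⊕ Fin p₂ =>
        Set.Icc (-(((m : ℝ) + 1) * (Δ₁ + Δ₂))) (((m : ℝ) + 1) * (Δ₁ + Δ₂))) :=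
    isCompact_univ_pi fun _ => isCompact_univ_pi fun _ => isCompact_univ_pi fun _ => isCompact_Icc
  refine IsCompact.of_isClosed_subset h (isClosed_isErrorCov S Δ₁ Δ₂) fun G hG => ?_
  exact fun t _ i _ j _ => abs_le.1 (abs_apply_le_of_isErrorCov hG t i j)

lemma lowerSemicontinuousOn_sum_gaussRate (Δ₁ Δ₂ : ℝ) : LowerSemicontinuousOn
    (fun G => ∑ t, gaussRate (S.predCov G t) (G t)) {G | S.IsErrorCov Δ₁ Δ₂ G} := by
  have hpred := continuous_predCov S
  refine lowerSemicontinuousOn_sum fun t _ => ?_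
  have h : LowerSemicontinuousOn (fun G => ⨆ (η : ℝ) (_ : 0 < η),
      ENNReal.ofReal (regRate η (S.predCov G t) (G t))) {G | S.IsErrorCov Δ₁ Δ₂ G} := by
    refine lowerSemicontinuousOn_biSup fun η hη => ContinuousOn.lowerSemicontinuousOn ?_
    refine ENNReal.continuous_ofReal.comp_continuousOn ?_
    have hGd : ∀ G ∈ {G | S.IsErrorCov Δ₁ Δ₂ G}, (G t + η • 1).det ≠ 0 := fun G hG =>
      (posDef_add_smul_one (hG.pos t) hη).det_pos.ne'
    have hTd : ∀ G ∈ {G | S.IsErrorCov Δ₁ Δ₂ G}, (S.predCov G t + η • 1).det ≠ 0 := fun G hG =>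
      (posDef_add_smul_one (S.predCov_posSemidef hG.pos t) hη).det_pos.ne'
    have c1 : Continuous fun G : Fin (m + 1) → Mat p₁ p₂ p₁ p₂ => (G t + η • 1).det :=
      Continuous.matrix_det ((continuous_apply t).add continuous_const)
    have c2 : Continuous fun G : Fin (m + 1) → Mat p₁ p₂ p₁ p₂ => (S.predCov G t + η • 1).det :=
      Continuous.matrix_det ((hpred t).add continuous_const)
    exact continuousOn_const.mul ((c2.continuousOn.div c1.continuousOn hGd).log
      fun G hG => div_ne_zero (hTd G hG) (hGd G hG))
  intro G hG
  refine LowerSemicontinuousWithinAt.congr_of_eventuallyEq (h G hG) hG ?_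
  filter_upwards [self_mem_nhdsWithin] with G hG
  exact (gaussRate_eq_iSup (hG.pos t) (hG.le t)).symm

lemma exists_minimizer (h₁ : 0 ≤ Δ₁) (h₂ : 0 ≤ Δ₂) : ∃ G, S.IsErrorCov Δ₁ Δ₂ G ∧
    ∑ t, gaussRate (S.predCov G t) (G t) =
      ⨅ (G) (_ : S.IsErrorCov Δ₁ Δ₂ G), ∑ t, gaussRate (S.predCov G t) (G t) := by
  have h0 : S.IsErrorCov Δ₁ Δ₂ 0 := by
    refine ⟨fun t => PosSemidef.zero, fun t => ?_, ?_, ?_⟩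
    · simpa using S.predCov_posSemidef (G := 0) (fun t => PosSemidef.zero) t
    · refine le_of_eq_of_le ?_ h₁
      simp [trace, toBlocks₁₁]
    · refine le_of_eq_of_le ?_ h₂
      simp [trace, toBlocks₂₂]
  obtain ⟨G, hG, hmin⟩ := LowerSemicontinuousOn.exists_isMinOn ⟨0, h0⟩
    (isCompact_isErrorCov S Δ₁ Δ₂) (lowerSemicontinuousOn_sum_gaussRate S Δ₁ Δ₂)
  refine ⟨G, hG, le_antisymm (le_iInf₂ fun G' hG' => hmin hG') (iInf₂_le G hG)⟩

end Minimizer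

/-! ### The rate distortion function and its optimal realizations -/

section Main

variable {m p₁ p₂ q₁ q₂ : ℕ} (S : Source m p₁ p₂ q₁ q₂) (Δ₁ Δ₂ : ℝ)

theorem jointNRDF_eq_iInf_gaussRate : jointNRDF S.law Δ₁ Δ₂ =
    ⨅ (G) (_ : S.IsErrorCov Δ₁ Δ₂ G), ∑ t, gaussRate (S.predCov G t) (G t) := by
  refine le_antisymm (le_iInf₂ fun G hG => ?_) (le_iInf₂ fun μ hμ => ?_)
  · obtain ⟨H, QV, hH⟩ := Source.exists_isChannel hG.isReduction
    exact iInf₂_le_of_le ⟨S.jointLaw H QV, inferInstance⟩ (Source.isFeasible_jointLaw hG hH)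
      (Source.mutualInfo_jointLaw_le hG.isReduction hH)
  · obtain ⟨G, hG, hle⟩ := exists_isErrorCov_le_mutualInfo hμ
    exact iInf₂_le_of_le G hG hle

/-- The stage informations do not depend on which channel is chosen for `G`; existence of one keeps
the inner infimum from being `∞` by default. -/
theorem iInf_stageInfo_eq_iInf_gaussRate :
    (⨅ (G) (_ : S.IsErrorCov Δ₁ Δ₂ G) (H) (QV) (_ : S.IsChannel G H QV),
        ∑ t, stageInfo (S.jointLaw H QV) t) =
      ⨅ (G) (_ : S.IsErrorCov Δ₁ Δ₂ G), ∑ t, gaussRate (S.predCov G t) (G t) := by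
  refine iInf_congr fun G => iInf_congr fun hG => ?_
  have h : ∀ H QV, S.IsChannel G H QV → ∑ t, stageInfo (S.jointLaw H QV) t =
      ∑ t, gaussRate (S.predCov G t) (G t) := fun H QV hH =>
    Finset.sum_congr rfl fun t _ => Source.stageInfo_jointLaw hG.isReduction hH t
  obtain ⟨H, QV, hH⟩ := Source.exists_isChannel hG.isReduction
  refine le_antisymm ?_ (le_iInf fun H => le_iInf₂ fun QV hH => (h H QV hH).ge)
  rw [← h H QV hH]
  exact iInf_le_of_le H (iInf₂_le QV hH)

theorem exists_optimal_jointLaw (h₁ : 0 ≤ Δ₁) (h₂ : 0 ≤ Δ₂) :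
    ∃ G, S.IsErrorCov Δ₁ Δ₂ G ∧ ∃ H QV, S.IsChannel G H QV ∧
      mutualInfo (S.jointLaw H QV) Prod.fst Prod.snd = jointNRDF S.law Δ₁ Δ₂ := by
  obtain ⟨G, hG, hmin⟩ := exists_minimizer S h₁ h₂
  obtain ⟨H, QV, hH⟩ := Source.exists_isChannel hG.isReduction
  refine ⟨G, hG, H, QV, hH, le_antisymm ?_ ?_⟩
  · rw [jointNRDF_eq_iInf_gaussRate, ← hmin]
    exact Source.mutualInfo_jointLaw_le hG.isReduction hH
  · exact iInf₂_le (⟨S.jointLaw H QV, inferInstance⟩ : ProbabilityMeasure _)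
      (Source.isFeasible_jointLaw hG hH)

variable {S Δ₁ Δ₂}

theorem noise_of_full_rank (hX : S.QX.rank = p₁ + p₂)
    (hB : ∀ i, (S.B i * S.QW i * (S.B i).transpose).rank = p₁ + p₂)
    {G H QV : Fin (m + 1) → Mat p₁ p₂ p₁ p₂} (hG : S.IsReduction G) (hH : S.IsChannel G H QV)
    (t : Fin (m + 1)) :
    IsUnit (S.predCov G t) ∧ QV t = G t - G t * (S.predCov G t)⁻¹ * G t ∧
      (G t - G t * (S.predCov G t)⁻¹ * G t).PosSemidef := by
  have hpos : ∀ {Q : Mat p₁ p₂ p₁ p₂}, Q.PosSemidef → Q.rank = p₁ + p₂ → Q.PosDef :=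
    fun hQ hr => hQ.posDef_iff_det_ne_zero.2 (det_ne_zero_of_rank_eq hQ (by simpa using hr))
  have hT : (S.predCov G t).PosDef := by
    induction t using Fin.cases with
    | zero => exact hpos S.posX hX
    | succ i =>
      -- The transition noise alone is definite, and the propagated error covariance only adds to
      -- it.
      exact Matrix.PosDef.posSemidef_add (posSemidef_mul_mul_transpose (hG.pos _) _)
        (hpos (S.noiseCov_posSemidef i) (hB i))
  have hu := hT.isUnit
  have hQ := noise_eq_of_isUnit hu (hH.gain t) (hH.gain_symm t)
  rw [← hH.noise] at hQ
  exact ⟨hu, hQ, hQ ▸ hH.noise_pos t⟩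

end Main

end JointNRDF

theorem theorem4 {m p₁ p₂ q₁ q₂ : ℕ} (S : Source m p₁ p₂ q₁ q₂) (Δ₁ Δ₂ : ℝ) :
    -- every admissible family of error covariances is realized
    (∀ G, S.IsErrorCov Δ₁ Δ₂ G →
      (∃ H QV, S.IsChannel G H QV) ∧
      ∀ H QV, S.IsChannel G H QV →
        IsFeasible S.law Δ₁ Δ₂ (S.jointLaw H QV) ∧
        S.HasGaussianTestChannel H QV (S.jointLaw H QV) ∧
        (∀ t, estimate (S.jointLaw H QV) t t =ᵐ[S.jointLaw H QV] fun ω => ω.2 t) ∧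
        (∀ t, errorCov (S.jointLaw H QV) t t = G t) ∧
        (∀ i : Fin m, errorCov (S.jointLaw H QV) i.succ i.castSucc = S.predCov G i.succ)) ∧
    -- a realization of this form is optimal
    (0 ≤ Δ₁ → 0 ≤ Δ₂ →
      ∃ G, S.IsErrorCov Δ₁ Δ₂ G ∧ ∃ H QV, S.IsChannel G H QV ∧
        mutualInfo (S.jointLaw H QV) Prod.fst Prod.snd = jointNRDF S.law Δ₁ Δ₂) ∧
    -- the noise covariance in the full rank case
    (S.QX.rank = p₁ + p₂ → (∀ i, (S.B i * S.QW i * (S.B i).transpose).rank = p₁ + p₂) →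
      ∀ G, S.IsErrorCov Δ₁ Δ₂ G → ∀ H QV, S.IsChannel G H QV → ∀ t,
        IsUnit (S.predCov G t) ∧
        QV t = G t - G t * (S.predCov G t)⁻¹ * G t ∧
        (G t - G t * (S.predCov G t)⁻¹ * G t).PosSemidef) ∧
    -- the joint NRDF as the two infima
    jointNRDF S.law Δ₁ Δ₂ =
      (⨅ (G) (_ : S.IsErrorCov Δ₁ Δ₂ G) (H) (QV) (_ : S.IsChannel G H QV),
        ∑ t, stageInfo (S.jointLaw H QV) t) ∧
    jointNRDF S.law Δ₁ Δ₂ =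
      ⨅ (G) (_ : S.IsErrorCov Δ₁ Δ₂ G), ∑ t, gaussRate (S.predCov G t) (G t) := by
  refine ⟨fun G hG => ⟨Source.exists_isChannel hG.isReduction, fun H QV hH =>
      ⟨Source.isFeasible_jointLaw hG hH, Source.hasGaussianTestChannel_jointLaw,
        Source.estimate_jointLaw hG.isReduction hH, Source.errorCov_jointLaw hG.isReduction hH,
        Source.errorCov_pred_jointLaw hG.isReduction hH⟩⟩,
    exists_optimal_jointLaw S Δ₁ Δ₂,
    fun hX hB G hG H QV hH t => noise_of_full_rank hX hB hG.isReduction hH t, ?_,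
    jointNRDF_eq_iInf_gaussRate S Δ₁ Δ₂⟩
  rw [iInf_stageInfo_eq_iInf_gaussRate, jointNRDF_eq_iInf_gaussRate]
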